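/- Let $T>0$ and let $L\ge 1$ be an integer. For $\Gamma\subseteq\{0,\dots,L-1\}^2$ let $$M_\Gamma=\bigcup_{(k,m)\in\Gamma}\big[kT,(k+1)T\big)\times\Big[\tfrac{m}{TL},\tfrac{m+1}{TL}\Big)\subseteq\mathbb R^2 ,$$ a union of cells of area $1/L$ each. To $s\in L^2(\mathbb R^2)$ supported (up to a null set) in some $M_\Gamma$ associate the operator $H$ with spreading function $s_H=s$, $$Hx=\iint s_H(\tau,\nu)\,M_\nu T_\tau x\;d\nu\,d\tau ,\qquad (T_\tau x)(t)=x(t-\tau),\quad (M_\nu x)(t)=e^{2\pi i\nu t}x(t),$$ for tempered distributions $x$ on $\mathbb R$, the integral being understood weakly (against Schwartz functions), and put $\|H\|=\|s_H\|_{L^2(\mathbb R^2)}$. For $\Delta\in\mathbb R$ let $\mathcal X(\Delta)$ be the union, over all $\Gamma$ with $\mathrm{area}(M_\Gamma)\le\Delta$, of the sets of operators with spreading function supported in $M_\Gamma$. A probing signal $x$ stably identifies $\mathcal X(\Delta)$ if $Hx\in L^2(\mathbb R)$ for all $H\in\mathcal X(\Delta)$ and there are constants $0<\alpha\le\beta<\infty$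 with $$\alpha\|H_1-H_2\|\le\|H_1x-H_2x\|_{L^2(\mathbb R)}\le\beta\|H_1-H_2\|\qquad\text{for all }H_1,H_2\in\mathcal X(\Delta);$$ $\mathcal X(\Delta)$ is stably identifiable if some tempered distribution $x$ stably identifies it. (a) Let $L\ge2$ and suppose that, in case $\Delta>1/2$, there is a region $M_\Gamma$ with $1/2<\mathrm{area}(M_\Gamma)\le\Delta$ (this holds in particular if $\Delta>1/2$ is itself the area of some $M_\Gamma$). Then $\mathcal X(\Delta)$ is stably identifiable if and only if $\Delta\le 1/2$. (b) If $\Delta\le 1/2$ (and $L\ge 1$), then $\mathcal X(\Delta)$ is stably identified by a weighted Dirac train $x=\sum_{k\in\mathbb Z}c_k\,\delta(t+kT)$ with some $L$-periodic sequence of complex weights, $c_{k+L}=c_k$. -/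

import Mathlib

open MeasureTheory Set
open scoped SchwartzMap

noncomputable section

namespace OperatorIdentification

/-- The character `t ↦ e^{2πiνt}`. -/
def modChar (ν : ℝ) (t : ℝ) : ℂ :=
  Complex.exp (2 * (Real.pi : ℂ) * Complex.I * (ν : ℂ) * (t : ℂ))

theorem modChar_hasDerivAt (ν t : ℝ) :
    HasDerivAt (modChar ν) ((2 * (Real.pi : ℂ) * Complex.I * (ν : ℂ)) * modChar ν t) t := by
  have h := ((Complex.ofRealCLM.hasDerivAt (x := t)).const_mul
    (2 * (Real.pi : ℂ) * Complex.I * (ν : ℂ))).cexp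
  rw [mul_comm]
  have e : modChar ν = fun u : ℝ =>
      Complex.exp (2 * (Real.pi : ℂ) * Complex.I * (ν : ℂ) * Complex.ofRealCLM u) := rfl
  rw [e]
  simpa using h

theorem modChar_norm (ν t : ℝ) : ‖modChar ν t‖ = 1 := by
  rw [modChar, Complex.norm_exp]
  simp

theorem modChar_iteratedDeriv (ν : ℝ) (n : ℕ) :
    iteratedDeriv n (modChar ν) =
      fun t => (2 * (Real.pi : ℂ) * Complex.I * (ν : ℂ)) ^ n * modChar ν t := by
  induction n with
  | zero => simp
  | succ n ih =>
    rw [iteratedDeriv_succ, ih]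
    funext t
    rw [((modChar_hasDerivAt ν t).const_mul _).deriv]
    ring

/-- Characters have temperate growth, so multiplication by them acts on tempered distributions. -/
theorem modChar_hasTemperateGrowth (ν : ℝ) : (modChar ν).HasTemperateGrowth := by
  refine ⟨?_, fun n => ⟨0, ‖(2 * (Real.pi : ℂ) * Complex.I * (ν : ℂ)) ^ n‖, fun t => ?_⟩⟩
  · have : ContDiff ℝ ((⊤ : ℕ∞) : WithTop ℕ∞) (fun t : ℝ =>
        Complex.exp (2 * (Real.pi : ℂ) * Complex.I * (ν : ℂ) * (t : ℂ))) :=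
      (contDiff_const.mul Complex.ofRealCLM.contDiff).cexp
    exact this
  · rw [norm_iteratedFDeriv_eq_norm_iteratedDeriv, modChar_iteratedDeriv, norm_mul, modChar_norm]
    simp

/-- The translation operator `T_τ`, `(T_τ x)(t) = x(t - τ)`, on tempered distributions:
`⟨T_τ x, φ⟩ = ⟨x, φ(· + τ)⟩`. -/
def translation (τ : ℝ) : 𝓢'(ℝ, ℂ) →L[ℂ] 𝓢'(ℝ, ℂ) :=
  PointwiseConvergenceCLM.precomp ℂ (SchwartzMap.compSubConstCLM ℂ (-τ))

/-- The modulation operator `M_ν`, `(M_ν x)(t) = e^{2πiνt} x(t)`, on tempered distributions. -/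
def modulation (ν : ℝ) : 𝓢'(ℝ, ℂ) →L[ℂ] 𝓢'(ℝ, ℂ) :=
  TemperedDistribution.smulLeftCLM ℂ (modChar ν)

/-- An operator of the class `𝓗` is given by its square-integrable spreading function
`s(τ, ν)`; the norm of the operator is by definition the `L²` norm of its spreading function. -/
abbrev SpreadingFunction : Type := Lp ℂ 2 (volume : Measure (ℝ × ℝ))

/-- The square-integrable output signals. -/
abbrev OutputSignal : Type := Lp ℂ 2 (volume : Measure ℝ)

/-- `y = H x`, where `H` is the operator with spreading function `s`, that is,
`H x = ∫∫ s(τ, ν) M_ν T_τ x d(τ, ν)`. The integral is a weak one: for every Schwartz function `φ`,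
`∫ y φ = ∫∫ s(τ, ν) ⟨M_ν T_τ x, φ⟩ d(τ, ν)`, the right hand side converging absolutely. -/
def IsResponse (s : SpreadingFunction) (x : 𝓢'(ℝ, ℂ)) (y : OutputSignal) : Prop :=
  ∀ φ : 𝓢(ℝ, ℂ),
    Integrable (fun p : ℝ × ℝ => s p * (modulation p.2 (translation p.1 x)) φ) ∧
      ∫ p : ℝ × ℝ, s p * (modulation p.2 (translation p.1 x)) φ = ∫ t : ℝ, y t * φ t

/-- The probing signal `x` stably identifies the set `Q` of operators: it maps all of them to
square-integrable signals, and
`α ‖H₁ - H₂‖ ≤ ‖H₁ x - H₂ x‖ ≤ β ‖H₁ - H₂‖` for all `H₁, H₂ ∈ Q`, with fixed `0 < α ≤ β < ∞`. -/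
def StablyIdentifies (x : 𝓢'(ℝ, ℂ)) (Q : Set SpreadingFunction) : Prop :=
  ∃ α β : ℝ, 0 < α ∧ α ≤ β ∧ ∀ s₁ ∈ Q, ∀ s₂ ∈ Q, ∃ y₁ y₂ : OutputSignal,
    IsResponse s₁ x y₁ ∧ IsResponse s₂ x y₂ ∧
      α * ‖s₁ - s₂‖ ≤ ‖y₁ - y₂‖ ∧ ‖y₁ - y₂‖ ≤ β * ‖s₁ - s₂‖

/-- Some probing signal stably identifies `Q`. -/
def StablyIdentifiable (Q : Set SpreadingFunction) : Prop :=
  ∃ x : 𝓢'(ℝ, ℂ), StablyIdentifies x Q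

/-- The cell `[kT, (k+1)T) × [m/(TL), (m+1)/(TL))` of the `(τ, ν)`-plane. -/
def cell (T : ℝ) (L k m : ℕ) : Set (ℝ × ℝ) :=
  Ico ((k : ℝ) * T) (((k : ℝ) + 1) * T) ×ˢ
    Ico ((m : ℝ) / (T * (L : ℝ))) (((m : ℝ) + 1) / (T * (L : ℝ)))

/-- The support region `M_Γ`, the union of the cells with index in `Γ ⊆ {0, …, L-1}²`. -/
def region (T : ℝ) (L : ℕ) (Γ : Finset (Fin L × Fin L)) : Set (ℝ × ℝ) :=
  ⋃ i ∈ Γ, cell T L i.1 i.2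

/-- The area of `M_Γ`. -/
def area (T : ℝ) (L : ℕ) (Γ : Finset (Fin L × Fin L)) : ℝ :=
  (volume : Measure (ℝ × ℝ)).real (region T L Γ)

/-- The operators whose spreading function is supported in the set `M` (up to a null set). -/
def supportedOperators (M : Set (ℝ × ℝ)) : Set SpreadingFunction :=
  {s | ∀ᵐ p : ℝ × ℝ, p ∉ M → s p = 0}

/-- The set `𝒳(Δ)`: the union, over all `Γ` with `area M_Γ ≤ Δ`, of the operators whose spreading
function is supported in `M_Γ`. -/
def blindOperators (T : ℝ) (L : ℕ) (Δ : ℝ) : Set SpreadingFunction :=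
  ⋃ Γ : Finset (Fin L × Fin L), ⋃ _ : area T L Γ ≤ Δ, supportedOperators (region T L Γ)

/-- The tempered distribution `x` is the weighted Dirac train `∑_{k ∈ ℤ} c_k δ(t + kT)`. -/
def IsDiracTrain (T : ℝ) (c : ℤ → ℂ) (x : 𝓢'(ℝ, ℂ)) : Prop :=
  ∀ φ : 𝓢(ℝ, ℂ), HasSum (fun k : ℤ => c k * φ (-((k : ℝ) * T))) (x φ)

end OperatorIdentification

end

noncomputable section

/-!
The difference of two operators on at most `L / 2` cells each is supported on at most `L` cells, so
identifying them amounts to bounding `H ↦ H x` below on operators supported on `L` cells.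

For the Dirac train with `L`-periodic weights `c`, Parseval's identity expresses the energy of `H x`
through the values of the spreading function at congruent points of the cells, multiplied by
the `L × L²` Gabor matrix of the window `c`. For suitable `c` any `L` columns of this matrix are
linearly independent: a minor is a polynomial in the parameter of the window, in which one
coefficient is a product of Vandermonde determinants.

If `Δ > 1 / 2`, stable identification bounds `H ↦ H x` above and below on operators supported on
`L + 1` cells, a set of area greater than one. Fill the cells with time-frequency atoms. Bounded
responses are localized where the atoms are, so the responses to `(L + 1) n²` atoms are
nearly contained in a space spanned by about `L n²` exponentials, which contradicts the lower bound.
-/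

namespace OperatorIdentification

theorem modChar_add_left (ν h t : ℝ) : modChar (ν + h) t = modChar ν t * modChar h t := by
  rw [modChar, modChar, modChar, ← Complex.exp_add]
  push_cast
  ring_nf

theorem modChar_comm (ν t : ℝ) : modChar ν t = modChar t ν := by
  rw [modChar, modChar]
  ring_nf

theorem modChar_add_right (ν t h : ℝ) : modChar ν (t + h) = modChar ν t * modChar ν h := by
  rw [modChar_comm, modChar_add_left, modChar_comm t, modChar_comm h]

@[simp] theorem modChar_zero_left (t : ℝ) : modChar 0 t = 1 := by simp [modChar]

theorem modChar_neg_mul_self (ν t : ℝ) : modChar (-ν) t * modChar ν t = 1 := by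
  rw [← modChar_add_left, neg_add_cancel, modChar_zero_left]

theorem conj_modChar (ν t : ℝ) : (starRingEnd ℂ) (modChar ν t) = modChar (-ν) t := by
  rw [modChar, modChar, ← Complex.exp_conj]
  simp [map_ofNat]

theorem continuous_modChar : Continuous fun p : ℝ × ℝ => modChar p.1 p.2 := by
  unfold modChar
  fun_prop

theorem enorm_modChar_mul (ν t : ℝ) (z : ℂ) : ‖modChar ν t * z‖ₑ = ‖z‖ₑ := by
  rw [← ofReal_norm, ← ofReal_norm, norm_mul, modChar_norm, one_mul]

/-- The test function `t ↦ e^{2πiν(t+τ)} φ(t+τ)`, where `p = (τ, ν)`: the transpose of `M_ν T_τ`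
applied to `φ`. -/
def shiftedTest (p : ℝ × ℝ) (φ : 𝓢(ℝ, ℂ)) : 𝓢(ℝ, ℂ) :=
  SchwartzMap.compSubConstCLM ℂ (-p.1) (SchwartzMap.smulLeftCLM ℂ (modChar p.2) φ)

theorem shiftedTest_apply (p : ℝ × ℝ) (φ : 𝓢(ℝ, ℂ)) (t : ℝ) :
    shiftedTest p φ t = modChar p.2 (t + p.1) * φ (t + p.1) := by
  simp [shiftedTest, SchwartzMap.smulLeftCLM_apply_apply (modChar_hasTemperateGrowth p.2)]

theorem modulation_translation_apply (p : ℝ × ℝ) (x : 𝓢'(ℝ, ℂ)) (φ : 𝓢(ℝ, ℂ)) :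
    (modulation p.2 (translation p.1 x)) φ = x (shiftedTest p φ) := rfl

/-! ### Responses -/

section Response

variable {x : 𝓢'(ℝ, ℂ)} {s s₁ s₂ : SpreadingFunction} {y y₁ y₂ : OutputSignal}

theorem integrable_mul_schwartz (y : OutputSignal) (φ : 𝓢(ℝ, ℂ)) :
    Integrable fun t : ℝ => y t * φ t :=
  (Lp.memLp y).integrable_mul (φ.memLp 2 volume)

theorem IsResponse.unique (h₁ : IsResponse s x y₁) (h₂ : IsResponse s x y₂) : y₁ = y₂ := by
  have hinj := LinearMap.ker_eq_bot.1
    (Lp.ker_toTemperedDistributionCLM_eq_bot (F := ℂ) (μ := (volume : Measure ℝ)) (p := 2))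
  apply hinj
  ext φ
  have h := (h₁ φ).2.symm.trans (h₂ φ).2
  simpa [Lp.toTemperedDistribution_apply, mul_comm] using h

theorem coeFn_add_mul_ae_eq {α : Type*} [MeasurableSpace α] {μ : Measure α} (f g : Lp ℂ 2 μ)
    (w : α → ℂ) : (fun a => (f + g) a * w a) =ᵐ[μ] fun a => f a * w a + g a * w a := by
  filter_upwards [Lp.coeFn_add f g] with a ha
  rw [ha, Pi.add_apply, add_mul]

theorem coeFn_smul_mul_ae_eq {α : Type*} [MeasurableSpace α] {μ : Measure α} (c : ℂ)
    (f : Lp ℂ 2 μ) (w : α → ℂ) : (fun a => (c • f) a * w a) =ᵐ[μ] fun a => c * (f a * w a) := by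
  filter_upwards [Lp.coeFn_smul c f] with a ha
  rw [ha, Pi.smul_apply, smul_eq_mul, mul_assoc]

theorem IsResponse.add (h₁ : IsResponse s₁ x y₁) (h₂ : IsResponse s₂ x y₂) :
    IsResponse (s₁ + s₂) x (y₁ + y₂) := by
  intro φ
  refine ⟨((h₁ φ).1.add (h₂ φ).1).congr (coeFn_add_mul_ae_eq ..).symm, ?_⟩
  rw [integral_congr_ae (coeFn_add_mul_ae_eq ..), integral_congr_ae (coeFn_add_mul_ae_eq ..),
    integral_add (h₁ φ).1 (h₂ φ).1,
    integral_add (integrable_mul_schwartz _ _) (integrable_mul_schwartz _ _), (h₁ φ).2, (h₂ φ).2]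

theorem IsResponse.const_smul (c : ℂ) (h : IsResponse s x y) : IsResponse (c • s) x (c • y) := by
  intro φ
  refine ⟨((h φ).1.const_mul c).congr (coeFn_smul_mul_ae_eq ..).symm, ?_⟩
  rw [integral_congr_ae (coeFn_smul_mul_ae_eq ..), integral_congr_ae (coeFn_smul_mul_ae_eq ..),
    integral_const_mul, integral_const_mul, (h φ).2]

/-- The graph of the linear map `H ↦ H x`, defined on the operators `H` with `H x` in `L²`. -/
def responseGraph (x : 𝓢'(ℝ, ℂ)) : Submodule ℂ (SpreadingFunction × OutputSignal) where
  carrier := {z | IsResponse z.1 x z.2}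
  add_mem' := IsResponse.add
  zero_mem' := fun φ => by simp
  smul_mem' c _ := IsResponse.const_smul c

theorem IsResponse.sub (h₁ : IsResponse s₁ x y₁) (h₂ : IsResponse s₂ x y₂) :
    IsResponse (s₁ - s₂) x (y₁ - y₂) :=
  (responseGraph x).sub_mem (x := (s₁, y₁)) (y := (s₂, y₂)) h₁ h₂

theorem IsResponse.sum_smul {ι : Type*} (F : Finset ι) (c : ι → ℂ) {s : ι → SpreadingFunction}
    {y : ι → OutputSignal} (h : ∀ i, IsResponse (s i) x (y i)) :
    IsResponse (∑ i ∈ F, c i • s i) x (∑ i ∈ F, c i • y i) := by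
  have hmem : ∑ i ∈ F, c i • (s i, y i) ∈ responseGraph x :=
    (responseGraph x).sum_mem fun i _ => (responseGraph x).smul_mem (c i) (h i)
  change IsResponse (∑ i ∈ F, c i • (s i, y i)).1 x (∑ i ∈ F, c i • (s i, y i)).2 at hmem
  simpa only [Prod.fst_sum, Prod.snd_sum, Prod.smul_mk] using hmem

/-- The probing signal `x` maps each operator in `Q` to a square-integrable response whose norm is
comparable to that of the operator, with constants `α` and `β`. On a linear space `Q` this is
stable identification. -/
def BoundedResponses (x : 𝓢'(ℝ, ℂ)) (α β : ℝ) (Q : Set SpreadingFunction) : Prop :=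
  ∀ s ∈ Q, ∃ y : OutputSignal, IsResponse s x y ∧ α * ‖s‖ ≤ ‖y‖ ∧ ‖y‖ ≤ β * ‖s‖

/-! ### Operators with prescribed support -/

/-- `supportedOperators M` as a linear subspace. -/
def supportedSubmodule (M : Set (ℝ × ℝ)) : Submodule ℂ SpreadingFunction where
  carrier := supportedOperators M
  add_mem' {s₁ s₂} h₁ h₂ := by
    rw [supportedOperators, mem_ofPred_eq] at *
    filter_upwards [h₁, h₂, Lp.coeFn_add s₁ s₂] with p hp₁ hp₂ hp hpM
    rw [hp, Pi.add_apply, hp₁ hpM, hp₂ hpM, add_zero]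
  zero_mem' := by
    rw [supportedOperators, mem_ofPred_eq]
    filter_upwards [Lp.coeFn_zero ℂ 2 (volume : Measure (ℝ × ℝ))] with p hp _
    rw [hp, Pi.zero_apply]
  smul_mem' c s h := by
    rw [supportedOperators, mem_ofPred_eq] at *
    filter_upwards [h, Lp.coeFn_smul c s] with p hp₁ hp hpM
    rw [hp, Pi.smul_apply, hp₁ hpM, smul_zero]

theorem supportedOperators_mono {M N : Set (ℝ × ℝ)} (h : M ⊆ N) :
    supportedOperators M ⊆ supportedOperators N := by
  intro s hs
  rw [supportedOperators, mem_ofPred_eq] at *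
  filter_upwards [hs] with p hp hpN using hp fun hpM => hpN (h hpM)

/-- The restriction of a spreading function to a measurable set, extended by zero. -/
def restrictTo {M : Set (ℝ × ℝ)} (hM : MeasurableSet M) (s : SpreadingFunction) :
    SpreadingFunction :=
  ((Lp.memLp s).indicator hM).toLp _

theorem coeFn_restrictTo {M : Set (ℝ × ℝ)} (hM : MeasurableSet M) (s : SpreadingFunction) :
    restrictTo hM s =ᵐ[volume] M.indicator s :=
  MemLp.coeFn_toLp _

theorem restrictTo_add_restrictTo_compl {M : Set (ℝ × ℝ)} (hM : MeasurableSet M)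
    (s : SpreadingFunction) : restrictTo hM s + restrictTo hM.compl s = s := by
  apply Lp.ext
  filter_upwards [coeFn_restrictTo hM s, coeFn_restrictTo hM.compl s,
    Lp.coeFn_add (restrictTo hM s) (restrictTo hM.compl s)] with p h₁ h₂ h₃
  rw [h₃, Pi.add_apply, h₁, h₂, indicator_self_add_compl_apply]

theorem restrictTo_mem_supportedOperators {M N : Set (ℝ × ℝ)} (hM : MeasurableSet M)
    (hs : s ∈ supportedOperators N) : restrictTo hM s ∈ supportedOperators (M ∩ N) := by
  rw [supportedOperators, mem_ofPred_eq] at *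
  filter_upwards [coeFn_restrictTo hM s, hs] with p hp hpN hpMN
  rw [hp]
  by_cases hpM : p ∈ M
  · rw [indicator_of_mem hpM, hpN fun h => hpMN ⟨hpM, h⟩]
  · exact indicator_of_notMem hpM _

-- An operator supported in `M₁ ∪ M₂` is a difference of operators supported in `M₁` and `M₂`.
theorem StablyIdentifies.exists_boundedResponses_union {Q : Set SpreadingFunction}
    {M₁ M₂ : Set (ℝ × ℝ)} (hx : StablyIdentifies x Q) (hM₁ : MeasurableSet M₁)
    (h₁ : supportedOperators M₁ ⊆ Q) (h₂ : supportedOperators M₂ ⊆ Q) :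
    ∃ α β : ℝ, 0 < α ∧ 0 < β ∧ BoundedResponses x α β (supportedOperators (M₁ ∪ M₂)) := by
  obtain ⟨α, β, hα, hαβ, h⟩ := hx
  refine ⟨α, β, hα, hα.trans_le hαβ, fun s hs => ?_⟩
  have hs₁ : restrictTo hM₁ s ∈ Q :=
    h₁ (supportedOperators_mono inter_subset_left (restrictTo_mem_supportedOperators hM₁ hs))
  have hs₂ : -restrictTo hM₁.compl s ∈ Q := by
    refine h₂ ((supportedSubmodule M₂).neg_mem (supportedOperators_mono ?_
      (restrictTo_mem_supportedOperators hM₁.compl hs)))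
    rintro p ⟨hp, hp' | hp'⟩
    exacts [absurd hp' hp, hp']
  obtain ⟨y₁, y₂, hy₁, hy₂, hbound⟩ := h _ hs₁ _ hs₂
  have hy := hy₁.sub hy₂
  rw [sub_neg_eq_add, restrictTo_add_restrictTo_compl] at hbound hy
  exact ⟨_, hy, hbound⟩

end Response

/-! ### Cells and regions -/

section Cells

variable {T : ℝ} {L : ℕ}

theorem measurableSet_cell (T : ℝ) (L k m : ℕ) : MeasurableSet (cell T L k m) :=
  measurableSet_Ico.prod measurableSet_Ico

theorem measurableSet_region (T : ℝ) (L : ℕ) (Γ : Finset (Fin L × Fin L)) :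
    MeasurableSet (region T L Γ) :=
  Γ.measurableSet_biUnion fun _ _ => measurableSet_cell _ _ _ _

theorem mem_region {Γ : Finset (Fin L × Fin L)} {p : ℝ × ℝ} :
    p ∈ region T L Γ ↔ ∃ i ∈ Γ, p ∈ cell T L i.1 i.2 := by
  simp [region]

theorem region_mono {Γ Γ' : Finset (Fin L × Fin L)} (h : Γ ⊆ Γ') :
    region T L Γ ⊆ region T L Γ' :=
  biUnion_subset_biUnion_left h

theorem region_union (Γ Γ' : Finset (Fin L × Fin L)) :
    region T L (Γ ∪ Γ') = region T L Γ ∪ region T L Γ' :=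
  Finset.set_biUnion_union _ _ _

theorem mem_blindOperators {Δ : ℝ} {s : SpreadingFunction} :
    s ∈ blindOperators T L Δ ↔
      ∃ Γ, area T L Γ ≤ Δ ∧ s ∈ supportedOperators (region T L Γ) := by
  simp [blindOperators]

theorem mem_cell_iff (hT : 0 < T) (hL : 1 ≤ L) (k m : ℕ) (p : ℝ × ℝ) :
    p ∈ cell T L k m ↔ ⌊p.1 / T⌋ = (k : ℤ) ∧ ⌊p.2 * (T * L)⌋ = (m : ℤ) := by
  have hL' : (0 : ℝ) < L := by exact_mod_cast hL
  have hTL : 0 < T * L := mul_pos hT hL'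
  rw [cell, mem_prod, mem_Ico, mem_Ico, Int.floor_eq_iff, Int.floor_eq_iff, le_div_iff₀ hT,
    div_lt_iff₀ hT, div_le_iff₀ hTL, lt_div_iff₀ hTL]
  simp

theorem volume_cell (hT : 0 < T) (hL : 1 ≤ L) (k m : ℕ) :
    volume (cell T L k m) = ENNReal.ofReal (1 / L) := by
  rw [cell, Measure.volume_eq_prod, Measure.prod_prod, Real.volume_Ico, Real.volume_Ico,
    ← ENNReal.ofReal_mul (by linarith)]
  congr 1
  field_simp
  ring

theorem disjoint_cell (hT : 0 < T) (hL : 1 ≤ L) {i j : Fin L × Fin L} (hij : i ≠ j) :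
    Disjoint (cell T L i.1 i.2) (cell T L j.1 j.2) := by
  rw [Set.disjoint_left]
  intro p hp hp'
  rw [mem_cell_iff hT hL] at hp hp'
  apply hij
  ext
  · exact_mod_cast hp.1.symm.trans hp'.1
  · exact_mod_cast hp.2.symm.trans hp'.2

theorem area_eq (hT : 0 < T) (hL : 1 ≤ L) (Γ : Finset (Fin L × Fin L)) :
    area T L Γ = Γ.card / L := by
  rw [area, Measure.real, region, measure_biUnion_finset
    (fun i _ j _ hij => disjoint_cell hT hL hij) (fun _ _ => measurableSet_cell _ _ _ _)]
  simp only [volume_cell hT hL, Finset.sum_const, nsmul_eq_mul, ENNReal.toReal_mul,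
    ENNReal.toReal_natCast]
  rw [ENNReal.toReal_ofReal (by positivity)]
  ring

theorem area_le_half_iff (hT : 0 < T) (hL : 1 ≤ L) (Γ : Finset (Fin L × Fin L)) :
    area T L Γ ≤ 1 / 2 ↔ 2 * Γ.card ≤ L := by
  have hL' : (0 : ℝ) < L := by exact_mod_cast hL
  rw [area_eq hT hL, div_le_div_iff₀ hL' two_pos, one_mul, mul_comm]
  exact_mod_cast Iff.rfl

theorem area_le_area_iff (hT : 0 < T) (hL : 1 ≤ L) (Γ Γ' : Finset (Fin L × Fin L)) :
    area T L Γ ≤ area T L Γ' ↔ Γ.card ≤ Γ'.card := by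
  have hL' : (0 : ℝ) < L := by exact_mod_cast hL
  rw [area_eq hT hL, area_eq hT hL, div_le_div_iff_of_pos_right hL', Nat.cast_le]

theorem supportedOperators_region_subset_blindOperators {Γ : Finset (Fin L × Fin L)} {Δ : ℝ}
    (h : area T L Γ ≤ Δ) : supportedOperators (region T L Γ) ⊆ blindOperators T L Δ :=
  fun _ hs => mem_blindOperators.2 ⟨Γ, h, hs⟩

-- The difference of two operators on `L / 2` cells each lives on `L` cells.
theorem stablyIdentifies_blindOperators {x : 𝓢'(ℝ, ℂ)} (hT : 0 < T) (hL : 1 ≤ L) {Δ α β : ℝ}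
    (hΔ : Δ ≤ 1 / 2) (hα : 0 < α) (hαβ : α ≤ β)
    (h : ∀ Γ : Finset (Fin L × Fin L), Γ.card ≤ L →
      BoundedResponses x α β (supportedOperators (region T L Γ))) :
    StablyIdentifies x (blindOperators T L Δ) := by
  refine ⟨α, β, hα, hαβ, fun s₁ hs₁ s₂ hs₂ => ?_⟩
  obtain ⟨Γ₁, hΓ₁, hs₁⟩ := mem_blindOperators.1 hs₁
  obtain ⟨Γ₂, hΓ₂, hs₂⟩ := mem_blindOperators.1 hs₂
  have hcard₁ := (area_le_half_iff hT hL Γ₁).1 (hΓ₁.trans hΔ)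
  have hcard₂ := (area_le_half_iff hT hL Γ₂).1 (hΓ₂.trans hΔ)
  have hsub : s₁ - s₂ ∈ supportedOperators (region T L (Γ₁ ∪ Γ₂)) :=
    (supportedSubmodule _).sub_mem
      (supportedOperators_mono (region_mono Finset.subset_union_left) hs₁)
      (supportedOperators_mono (region_mono Finset.subset_union_right) hs₂)
  obtain ⟨y₁, hy₁, -⟩ := h Γ₁ (by omega) s₁ hs₁
  obtain ⟨y₂, hy₂, -⟩ := h Γ₂ (by omega) s₂ hs₂
  obtain ⟨y, hy, hbound⟩ := h (Γ₁ ∪ Γ₂) ((Finset.card_union_le _ _).trans (by omega)) _ hsub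
  rw [hy.unique (hy₁.sub hy₂)] at hbound
  exact ⟨y₁, y₂, hy₁, hy₂, hbound⟩

theorem exists_card_union_eq {α : Type*} [Fintype α] [DecidableEq α] {m n : ℕ}
    (hn : n ≤ Fintype.card α) (hmn : n ≤ 2 * m) :
    ∃ A B : Finset α, A.card ≤ m ∧ B.card ≤ m ∧ (A ∪ B).card = n := by
  obtain ⟨U, -, hU⟩ := Finset.exists_subset_card_eq (s := (Finset.univ : Finset α)) hn
  obtain ⟨A, hA, hAcard⟩ := Finset.exists_subset_card_eq (s := U) (n := min m n) (by omega)
  refine ⟨A, U \ A, by omega, ?_, by rw [Finset.union_sdiff_of_subset hA, hU]⟩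
  rw [Finset.card_sdiff_of_subset hA]
  omega

theorem StablyIdentifies.exists_boundedResponses_region {x : 𝓢'(ℝ, ℂ)} (hT : 0 < T) (hL : 2 ≤ L)
    {Δ : ℝ} {Γ : Finset (Fin L × Fin L)} (hΓ : 1 / 2 < area T L Γ) (hΓΔ : area T L Γ ≤ Δ)
    (hx : StablyIdentifies x (blindOperators T L Δ)) :
    ∃ (α β : ℝ) (U : Finset (Fin L × Fin L)), 0 < α ∧ 0 < β ∧ U.card = L + 1 ∧
      BoundedResponses x α β (supportedOperators (region T L U)) := by
  have hL1 : 1 ≤ L := by omega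
  have hcard : L < 2 * Γ.card := not_le.1 ((area_le_half_iff hT hL1 Γ).not.1 hΓ.not_ge)
  obtain ⟨Γ₁, Γ₂, h₁, h₂, hU⟩ := exists_card_union_eq (α := Fin L × Fin L) (n := L + 1)
    (by simp only [Fintype.card_prod, Fintype.card_fin]; nlinarith) hcard
  have hsub : ∀ Γ' : Finset (Fin L × Fin L), Γ'.card ≤ Γ.card →
      supportedOperators (region T L Γ') ⊆ blindOperators T L Δ := fun Γ' hΓ' =>
    supportedOperators_region_subset_blindOperators
      (((area_le_area_iff hT hL1 Γ' Γ).2 hΓ').trans hΓΔ)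
  obtain ⟨α, β, hα, hβ, hbound⟩ := hx.exists_boundedResponses_union
    (measurableSet_region T L Γ₁) (hsub Γ₁ h₁) (hsub Γ₂ h₂)
  exact ⟨α, β, Γ₁ ∪ Γ₂, hα, hβ, hU, by rwa [region_union]⟩

end Cells

/-! ### Gabor matrices of full spark -/

section GaborMatrix

open Polynomial

/-- The exponents of the window `d ↦ z ^ (L² d + d²)` of the Gabor system. The linear term dominates
and penalizes wrapping around modulo `L`, the quadratic term makes the rearrangement inequality
applicable. -/
def windowExponent (L d : ℕ) : ℕ := L ^ 2 * d + d ^ 2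

theorem comp_perm_eq_of_sum_mul_eq {n : ℕ} {k : Fin n → Fin n} (hk : Monotone k)
    (σ : Equiv.Perm (Fin n))
    (h : ∑ i, (k i : ℤ) * (σ i : ℤ) = ∑ i, (k i : ℤ) * (i : ℤ)) (i : Fin n) : k (σ i) = k i := by
  have hmono : Monovary (fun i => (k i : ℤ)) (fun j : Fin n => (j : ℤ)) := by
    intro i j hij
    have hij' : i ≤ j := by
      have : (i : ℤ) < j := hij
      exact Fin.le_def.2 (by omega)
    exact Int.ofNat_le.2 (hk hij')
  have hvary := hmono.sum_mul_comp_perm_eq_sum_mul_iff.1 h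
  have hmono' : Monotone (k ∘ ((σ⁻¹ : Equiv.Perm (Fin n)) : Fin n → Fin n)) := by
    intro a b hab
    rcases hab.eq_or_lt with rfl | hlt
    · exact le_rfl
    exact Int.ofNat_le.1 (@hvary (σ⁻¹ a) (σ⁻¹ b) (by simpa using hlt))
  have heq := Tuple.unique_monotone (σ := σ⁻¹) (τ := 1) hmono' (by simpa using hk)
  simpa using (congr_fun heq (σ i)).symm

section Parking

variable {L : ℕ} {k : Fin L → Fin L} {σ : Equiv.Perm (Fin L)}

theorem le_perm_of_sum_windowExponent_eq (hki : ∀ i, k i ≤ i)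
    (h : ∑ i, windowExponent L (σ i - k i : Fin L) = ∑ i, windowExponent L (i - k i : Fin L))
    (i : Fin L) : k i ≤ σ i := by
  set wraps : Fin L → ℤ := fun i => if k i ≤ σ i then 0 else 1 with hwraps
  have hwraps0 : ∀ i, 0 ≤ wraps i := fun i => by simp only [hwraps]; split_ifs <;> simp
  have hσ : ∀ i, ((σ i - k i : Fin L) : ℤ) = (σ i : ℤ) - k i + L * wraps i := fun i => by
    rw [Fin.intCast_val_sub_eq_sub_add_ite]
    simp only [hwraps]
    split_ifs <;> simp
  have hid : ∀ i, ((i - k i : Fin L) : ℤ) = (i : ℤ) - k i := fun i => by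
    rw [Fin.intCast_val_sub_eq_sub_add_ite, if_pos (hki i), Nat.cast_zero, add_zero]
  have hlinear : ∑ i, ((σ i - k i : Fin L) : ℤ) =
      ∑ i, ((i - k i : Fin L) : ℤ) + L * ∑ i, wraps i := by
    simp only [hσ, hid, Finset.sum_add_distrib, Finset.sum_sub_distrib, Finset.mul_sum]
    rw [Equiv.sum_comp σ fun i : Fin L => (i : ℤ)]
  have hquadratic : (L : ℤ) ^ 3 * ∑ i, wraps i + ∑ i, ((σ i - k i : Fin L) : ℤ) ^ 2 =
      ∑ i, ((i - k i : Fin L) : ℤ) ^ 2 := by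
    zify [windowExponent] at h
    simp only [Finset.sum_add_distrib, ← Finset.mul_sum, hlinear] at h
    linarith
  have hlt : ∑ i, ((i - k i : Fin L) : ℤ) ^ 2 < (L : ℤ) ^ 3 := by
    calc ∑ i, ((i - k i : Fin L) : ℤ) ^ 2 < ∑ _i : Fin L, (L : ℤ) ^ 2 := by
          refine Finset.sum_lt_sum_of_nonempty ⟨i, Finset.mem_univ _⟩ fun j _ => ?_
          have := (j - k j).2
          gcongr
        _ = (L : ℤ) ^ 3 := by simp; ring
  have hsum : ∑ i, wraps i < 1 := by
    have hsq : 0 ≤ ∑ i, ((σ i - k i : Fin L) : ℤ) ^ 2 := by positivity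
    exact lt_of_mul_lt_mul_left (a := (L : ℤ) ^ 3) (by linarith) (by positivity)
  have hi := Finset.single_le_sum (fun j _ => hwraps0 j) (Finset.mem_univ i)
  by_contra hne
  simp only [hwraps, if_neg hne] at hi hsum
  omega

theorem sum_windowExponent_perm_eq_iff (hk : Monotone k) (hki : ∀ i, k i ≤ i) :
    ∑ i, windowExponent L (σ i - k i : Fin L) = ∑ i, windowExponent L (i - k i : Fin L) ↔
      ∀ i, k (σ i) = k i := by
  constructor
  · intro h
    refine comp_perm_eq_of_sum_mul_eq hk σ ?_
    have hσ : ∀ i, ((σ i - k i : Fin L) : ℤ) = (σ i : ℤ) - k i := fun i => by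
      rw [Fin.sub_val_of_le (le_perm_of_sum_windowExponent_eq hki h i),
        Nat.cast_sub (le_perm_of_sum_windowExponent_eq hki h i)]
    have hid : ∀ i, ((i - k i : Fin L) : ℤ) = (i : ℤ) - k i := fun i => by
      rw [Fin.sub_val_of_le (hki i), Nat.cast_sub (hki i)]
    zify [windowExponent] at h
    simp only [hσ, hid, sub_sq, Finset.sum_add_distrib, Finset.sum_sub_distrib,
      ← Finset.mul_sum] at h
    rw [Equiv.sum_comp σ fun i : Fin L => (i : ℤ),
      Equiv.sum_comp σ fun i : Fin L => (i : ℤ) ^ 2] at h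
    simp only [mul_assoc, ← Finset.mul_sum, mul_comm (Fin.val _ : ℤ) (k _ : ℤ)] at h
    linarith
  · intro h
    rw [← Equiv.sum_comp σ fun i => windowExponent L (i - k i : Fin L)]
    simp only [h]

end Parking

-- Divide by `X ^ m`: the vanishing sums are values of a polynomial of degree less than `B.card`.
theorem eq_zero_of_sum_mul_pow_eq_zero {ι K : Type*} [Field K] {B : Finset ι} {e : ι → ℕ} {m : ℕ}
    {μ v : ι → K} (he : InjOn e B) (hem : ∀ j ∈ B, m ≤ e j ∧ e j < m + B.card)
    (hμ0 : ∀ i ∈ B, μ i ≠ 0) (hμ : InjOn μ B) (h : ∀ i ∈ B, ∑ j ∈ B, μ i ^ e j * v j = 0)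
    {j : ι} (hj : j ∈ B) : v j = 0 := by
  classical
  set Q : K[X] := ∑ j ∈ B, C (v j) * X ^ (e j - m) with hQ
  have hdeg : Q.natDegree < B.card := by
    have hle : Q.natDegree ≤ B.card - 1 :=
      natDegree_sum_le_of_forall_le _ _ fun j hj =>
        (natDegree_C_mul_X_pow_le _ _).trans (by have := hem j hj; omega)
    have := Finset.card_pos.2 ⟨j, hj⟩
    omega
  have hroot : ∀ z ∈ B.image μ, Q.eval z = 0 := by
    intro z hz
    obtain ⟨i, hi, rfl⟩ := Finset.mem_image.1 hz
    have hmul : μ i ^ m * Q.eval (μ i) = 0 := by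
      rw [← h i hi, hQ, eval_finsetSum, Finset.mul_sum]
      refine Finset.sum_congr rfl fun j hj => ?_
      simp only [eval_mul, eval_C, eval_pow, eval_X]
      rw [mul_left_comm, ← pow_add, Nat.add_sub_cancel' (hem j hj).1, mul_comm]
    exact (mul_eq_zero.1 hmul).resolve_left (pow_ne_zero _ (hμ0 i hi))
  have hQ0 : Q = 0 := eq_zero_of_natDegree_lt_card_of_eval_eq_zero' Q (B.image μ) hroot
    (by rwa [Finset.card_image_of_injOn hμ])
  have hcoeff : Q.coeff (e j - m) = v j := by
    rw [hQ, finsetSum_coeff, Finset.sum_eq_single j _ (absurd hj)]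
    · simp
    · intro i hi hij
      rw [coeff_C_mul, coeff_X_pow, if_neg, mul_zero]
      have := hem i hi
      have := hem j hj
      exact fun heq => hij (he hi hj (by omega))
  rw [← hcoeff, hQ0, coeff_zero]

theorem exists_forall_fiber_mem_Ico {n : ℕ} {α : Type*} [PartialOrder α] [DecidableEq α]
    {k : Fin n → α} (hk : Monotone k) (i : Fin n) :
    ∃ m : ℕ, ∀ j, k j = k i → m ≤ j ∧ (j : ℕ) < m + Finset.card {j | k j = k i} := by
  set B : Finset (Fin n) := {j | k j = k i} with hB
  have hmem : ∀ j, j ∈ B ↔ k j = k i := by simp [hB]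
  have hne : B.Nonempty := ⟨i, (hmem i).2 rfl⟩
  refine ⟨B.min' hne, fun j hj => ?_⟩
  have hle : B.min' hne ≤ j := B.min'_le j ((hmem j).2 hj)
  have hsub : Finset.Icc (B.min' hne) j ⊆ B := by
    intro l hl
    rw [Finset.mem_Icc] at hl
    exact (hmem l).2 (le_antisymm ((hk hl.2).trans_eq hj)
      (((hmem _).1 (B.min'_mem hne)).symm.trans_le (hk hl.1)))
  have hcard := Finset.card_le_card hsub
  rw [Fin.card_Icc] at hcard
  exact ⟨hle, by omega⟩

theorem det_block_pow_ne_zero {L : ℕ} {K α : Type*} [Field K] [PartialOrder α] [DecidableEq α]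
    {k : Fin L → α} (hk : Monotone k) {μ : Fin L → K}
    (hμ0 : ∀ i, μ i ≠ 0) (hμ : ∀ i j, k i = k j → μ i = μ j → i = j) :
    (Matrix.of fun i j : Fin L => if k i = k j then μ i ^ (j : ℕ) else 0).det ≠ 0 := by
  intro hdet
  obtain ⟨v, hv, hker⟩ := Matrix.exists_mulVec_eq_zero_iff.2 hdet
  refine hv (funext fun i => ?_)
  obtain ⟨m, hm⟩ := exists_forall_fiber_mem_Ico hk i
  refine eq_zero_of_sum_mul_pow_eq_zero (B := {j | k j = k i}) (e := Fin.val) (m := m) (μ := μ)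
    (Fin.val_injective.injOn) (fun j hj => hm j (by simpa using hj)) (fun j _ => hμ0 j)
    (fun j hj l hl => hμ j l ?_) (fun l hl => ?_) (by simp)
  · simp only [Finset.coe_filter, Finset.mem_univ, true_and, mem_ofPred_eq] at hj hl
    rw [hj, hl]
  · have hl' : k l = k i := by simpa using hl
    have hrow := congr_fun hker l
    simp only [Matrix.mulVec, dotProduct, Matrix.of_apply, Pi.zero_apply, ite_mul, zero_mul, hl',
      eq_comm (a := k i)] at hrow
    rwa [Finset.sum_filter]

-- The coefficient of `X ^ ∑ i, windowExponent L (i - k i)` is a block Vandermonde determinant.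
theorem det_parking_ne_zero {L : ℕ} {K : Type*} [Field K] {k : Fin L → Fin L} (hk : Monotone k)
    (hki : ∀ i, k i ≤ i) {μ : Fin L → K} (hμ0 : ∀ i, μ i ≠ 0)
    (hμ : ∀ i j, k i = k j → μ i = μ j → i = j) :
    (Matrix.of fun j i : Fin L =>
      (X : K[X]) ^ windowExponent L (j - k i : Fin L) * C (μ i ^ (j : ℕ))).det ≠ 0 := by
  intro h0
  have hcoeff := congr_arg (fun P : K[X] => P.coeff (∑ i, windowExponent L (i - k i : Fin L))) h0
  refine det_block_pow_ne_zero hk hμ0 hμ (Eq.trans ?_ hcoeff)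
  rw [← Matrix.det_transpose, Matrix.det_apply', Matrix.det_apply', finsetSum_coeff]
  refine Finset.sum_congr rfl fun σ _ => ?_
  simp only [Matrix.transpose_apply, Matrix.of_apply]
  rw [Finset.prod_mul_distrib, Finset.prod_pow_eq_pow_sum, ← map_prod, mul_comm (X ^ _),
    ← mul_assoc, ← C_eq_intCast, ← map_mul, coeff_C_mul, coeff_X_pow, mul_assoc]
  congr 1
  simp only [eq_comm (a := ∑ i, windowExponent L (i - k i : Fin L)),
    sum_windowExponent_perm_eq_iff hk hki]
  split_ifs with hσ
  · simp [hσ]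
  · obtain ⟨i, hi⟩ := not_forall.1 hσ
    rw [mul_zero]
    exact Finset.prod_eq_zero (Finset.mem_univ i) (if_neg (Ne.symm hi))

theorem exists_rotation_le_card {L : ℕ} [NeZero L] (q : Fin L → Fin L) :
    ∃ a : Fin L, ∀ r ≤ L, r ≤ Finset.card {i | ((q i - a : Fin L) : ℕ) < r} := by
  set N : ℕ → ℤ := fun r => ∑ i, if (q i : ℕ) < r then 1 else 0 with hN
  -- Rotating to a minimum of the excess `N r - r` makes all later excesses nonnegative.
  obtain ⟨a, ha⟩ := Finite.exists_min fun r : Fin L => N r - r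
  have hNL : N L = L := by simp [hN]
  have ha0 : N a - a ≤ 0 := by simpa [hN] using ha 0
  have hmin : ∀ r ≤ L, N a - a ≤ N r - r := by
    intro r hr
    rcases hr.eq_or_lt with rfl | hlt
    · rw [hNL]
      omega
    · exact ha ⟨r, hlt⟩
  have hrot : ∀ i, ((q i - a : Fin L) : ℤ) = q i - a + if a ≤ q i then 0 else (L : ℤ) :=
    fun i => by rw [Fin.intCast_val_sub_eq_sub_add_ite]; split_ifs <;> simp
  refine ⟨a, fun r hr => ?_⟩
  rw [← Nat.cast_le (α := ℤ), Finset.natCast_card_filter]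
  rcases le_or_gt ((a : ℕ) + r) L with h | h
  · have hsum : ∑ i, (if ((q i - a : Fin L) : ℕ) < r then (1 : ℤ) else 0) = N (a + r) - N a := by
      rw [hN, ← Finset.sum_sub_distrib]
      refine Finset.sum_congr rfl fun i _ => ?_
      have := hrot i
      have := (q i).2
      simp only [Fin.le_def] at *
      split_ifs at * <;> omega
    have := hmin (a + r) h
    push_cast at this
    linarith
  · have hsum : ∑ i, (if ((q i - a : Fin L) : ℕ) < r then (1 : ℤ) else 0) =
        N L - N a + N (a + r - L) := by
      rw [hN, ← Finset.sum_sub_distrib, ← Finset.sum_add_distrib]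
      refine Finset.sum_congr rfl fun i _ => ?_
      have := hrot i
      have := (q i).2
      simp only [Fin.le_def] at *
      split_ifs at * <;> omega
    have := hmin (a + r - L) (by omega)
    push_cast [Nat.cast_sub h.le] at this
    linarith

theorem le_of_monotone_of_lt_card {n : ℕ} {k : Fin n → ℕ} (hk : Monotone k) {i : Fin n}
    (h : (i : ℕ) < Finset.card {j | k j < i + 1}) : k i ≤ i := by
  by_contra! hlt
  have hsub : ({j | k j < i + 1} : Finset (Fin n)) ⊆ Finset.Iio i := by
    intro j hj
    rw [Finset.mem_filter] at hj
    rw [Finset.mem_Iio]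
    by_contra! hij
    have := hk hij
    omega
  have := Finset.card_le_card hsub
  rw [Fin.card_Iio] at this
  omega

-- The cycle lemma for parking functions.
theorem exists_rotation_parking {L : ℕ} [NeZero L] (q : Fin L → Fin L) :
    ∃ (a : Fin L) (π : Equiv.Perm (Fin L)),
      Monotone (fun i => q (π i) - a) ∧ ∀ i, q (π i) - a ≤ i := by
  obtain ⟨a, ha⟩ := exists_rotation_le_card q
  set k : Fin L → Fin L := fun i => q i - a with hk
  have hsort : Monotone (fun i => k (Tuple.sort k i)) := Tuple.monotone_sort k
  refine ⟨a, Tuple.sort k, hsort, fun i => ?_⟩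
  refine le_of_monotone_of_lt_card (k := fun i => (k (Tuple.sort k i) : ℕ)) hsort ?_
  refine Nat.lt_of_succ_le ((ha (i + 1) i.2).trans_eq ?_)
  refine (Finset.card_bij (fun j _ => Tuple.sort k j) ?_ ?_ ?_).symm
  · simp [hk]
  · simp
  · intro j hj
    exact ⟨(Tuple.sort k).symm j, by simpa [hk] using hj, by simp⟩

/-- The `L × L²` matrix whose columns are the time-frequency shifts of the window `c`; its entry in
row `p` and column `(q, m)` is `c_{q - p} ζ ^ (m p)`, where `ζ` is meant to be an `L`-th root of
unity. -/
def gaborMatrix {R : Type*} [CommSemiring R] (L : ℕ) (ζ : R) (c : ℤ → R) :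
    Matrix (Fin L) (Fin L × Fin L) R :=
  Matrix.of fun p i => c ((i.1 : ℤ) - p) * ζ ^ ((i.2 : ℕ) * p)

/-- The `L`-periodic window `k ↦ z ^ windowExponent L (-k mod L)`. -/
def monomialWindow {R : Type*} [CommSemiring R] (L : ℕ) (z : R) (k : ℤ) : R :=
  z ^ windowExponent L (-k % L).toNat

theorem monomialWindow_add_period {R : Type*} [CommSemiring R] (L : ℕ) (z : R) (k : ℤ) :
    monomialWindow L z (k + L) = monomialWindow L z k := by
  rw [monomialWindow, monomialWindow, show -(k + (L : ℤ)) = -k + L * (-1) by ring,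
    Int.add_mul_emod_self_left]

theorem monomialWindow_sub {R : Type*} [CommSemiring R] {L : ℕ} (z : R) (p q : Fin L) :
    monomialWindow L z ((q : ℤ) - p) = z ^ windowExponent L (p - q : Fin L) := by
  rw [monomialWindow, neg_sub, ← Fin.coe_int_sub_eq_mod, Int.toNat_natCast]

-- Rotating rows and permuting columns reduces to translations that form a parking function.
theorem det_gaborMatrix_monomialWindow_ne_zero {L : ℕ} [NeZero L] {K : Type*} [Field K] {ζ : K}
    (hζ : IsPrimitiveRoot ζ L) {l : Fin L → Fin L × Fin L} (hl : Function.Injective l) :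
    ((gaborMatrix L (C ζ) (monomialWindow L (X : K[X]))).submatrix id l).det ≠ 0 := by
  set M := (gaborMatrix L (C ζ) (monomialWindow L (X : K[X]))).submatrix id l with hM
  have hζ0 : ζ ≠ 0 := hζ.ne_zero (NeZero.ne L)
  obtain ⟨a, π, hmono, hpark⟩ := exists_rotation_parking fun i => (l i).1
  set μ : Fin L → K := fun i => ζ ^ ((l (π i)).2 : ℕ) with hμ
  have hparking := det_parking_ne_zero hmono hpark (μ := μ) (fun i => pow_ne_zero _ hζ0)
    fun i j hij hμij => π.injective <| hl <| Prod.ext (sub_left_injective hij) <|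
      Fin.ext <| hζ.pow_inj (l (π i)).2.2 (l (π j)).2.2 hμij
  have hmod : ∀ m n : ℕ, ζ ^ (m * (n % L)) = ζ ^ (m * n) := fun m n => by
    conv_rhs => rw [← Nat.mod_add_div n L, mul_add, pow_add, mul_left_comm, pow_mul _ L,
      hζ.pow_eq_one, one_pow, mul_one]
  have hfactor : (M.submatrix (Equiv.addRight a) id).submatrix id π =
      Matrix.of fun j i => C (μ i ^ (a : ℕ)) *
        (Matrix.of fun j i : Fin L =>
          (X : K[X]) ^ windowExponent L (j - ((l (π i)).1 - a) : Fin L) *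
            C (μ i ^ (j : ℕ))) j i := by
    ext1 j i
    simp only [hM, gaborMatrix, Matrix.submatrix_apply, id, Matrix.of_apply, Equiv.coe_addRight,
      monomialWindow_sub, ← C_pow]
    rw [mul_left_comm, ← map_mul, Fin.val_add, hmod, sub_sub_eq_add_sub]
    simp only [hμ, ← pow_mul, ← pow_add, ← mul_add, add_comm (a : ℕ)]
  intro h0
  have hzero : ((M.submatrix (Equiv.addRight a) id).submatrix id π).det = 0 := by
    rw [Matrix.det_permute', Matrix.det_permute, h0, mul_zero, mul_zero]
  rw [hfactor, Matrix.det_mul_row] at hzero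
  refine hparking ((mul_eq_zero.1 hzero).resolve_left (Finset.prod_ne_zero_iff.2 fun i _ => ?_))
  exact C_ne_zero.2 (pow_ne_zero _ (pow_ne_zero _ hζ0))

/-- Any set of at most as many columns of `A` as `A` has rows is linearly independent, phrased in
terms of sparse vectors in the kernel. -/
def IsFullSpark {m n R : Type*} [Fintype m] [Fintype n] [CommSemiring R] (A : Matrix m n R) :
    Prop :=
  ∀ Γ : Finset n, Γ.card ≤ Fintype.card m → ∀ v : n → R, (∀ i ∉ Γ, v i = 0) →
    A.mulVec v = 0 → v = 0

theorem isFullSpark_of_det_submatrix_ne_zero {m n K : Type*} [Fintype m] [DecidableEq m] [Fintype n]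
    [Field K] {A : Matrix m n K} (hmn : Fintype.card m ≤ Fintype.card n)
    (h : ∀ l : m → n, Function.Injective l → (A.submatrix id l).det ≠ 0) : IsFullSpark A := by
  intro Γ hΓ v hv hker
  obtain ⟨Γ', hΓ', hcard⟩ := Finset.exists_superset_card_eq hΓ hmn
  let e : m ≃ Γ' := Fintype.equivOfCardEq (by rw [Fintype.card_coe, hcard])
  have hv' : ∀ i ∉ Γ', v i = 0 := fun i hi => hv i fun hiΓ => hi (hΓ' hiΓ)
  have hsub : (A.submatrix id fun i => (e i : n)).mulVec (fun i => v (e i)) = 0 := by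
    rw [← hker]
    ext p
    simp only [Matrix.mulVec, dotProduct, Matrix.submatrix_apply, id]
    rw [Equiv.sum_comp e fun i : Γ' => A p i * v i, Finset.sum_coe_sort Γ' fun i => A p i * v i]
    exact Finset.sum_subset (Finset.subset_univ _) fun i _ hi => by rw [hv' i hi, mul_zero]
  have hzero : (fun i => v (e i)) = 0 := by
    by_contra hne
    exact h _ (Subtype.val_injective.comp e.injective)
      (Matrix.exists_mulVec_eq_zero_iff.1 ⟨_, hne, hsub⟩)
  ext i
  by_cases hi : i ∈ Γ'
  · simpa using congr_fun hzero (e.symm ⟨i, hi⟩)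
  · exact hv' i hi

theorem exists_isFullSpark_gaborMatrix {L : ℕ} (hL : 1 ≤ L) {K : Type*} [Field K] [Infinite K]
    {ζ : K} (hζ : IsPrimitiveRoot ζ L) :
    ∃ c : ℤ → K, (∀ k, c (k + L) = c k) ∧ IsFullSpark (gaborMatrix L ζ c) := by
  classical
  have : NeZero L := ⟨by omega⟩
  set D : (Fin L → Fin L × Fin L) → K[X] := fun l =>
    ((gaborMatrix L (C ζ) (monomialWindow L (X : K[X]))).submatrix id l).det with hD
  have hprod : ∏ l with Function.Injective l, D l ≠ 0 := Finset.prod_ne_zero_iff.2 fun l hl =>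
    det_gaborMatrix_monomialWindow_ne_zero hζ (Finset.mem_filter.1 hl).2
  obtain ⟨z, hz⟩ : ∃ z, (∏ l with Function.Injective l, D l).eval z ≠ 0 := by
    by_contra! h
    exact hprod (Polynomial.funext fun r => by simpa using h r)
  rw [eval_prod, Finset.prod_ne_zero_iff] at hz
  refine ⟨monomialWindow L z, monomialWindow_add_period L z,
    isFullSpark_of_det_submatrix_ne_zero (by simp; nlinarith) fun l hl => ?_⟩
  have hdet := hz l (by simp [hl])
  rw [hD, ← coe_evalRingHom, RingHom.map_det] at hdet
  convert hdet using 2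
  ext p i
  simp [gaborMatrix, monomialWindow]

theorem enorm_sq_eq_ofReal {E : Type*} [SeminormedAddGroup E] (z : E) :
    ‖z‖ₑ ^ 2 = ENNReal.ofReal (‖z‖ ^ 2) := by
  rw [← ofReal_norm, ENNReal.ofReal_pow (norm_nonneg _)]

theorem sum_enorm_sq_eq_ofReal {𝕜 ι : Type*} [RCLike 𝕜] [Fintype ι] (v : EuclideanSpace 𝕜 ι) :
    ∑ i, ‖v i‖ₑ ^ 2 = ENNReal.ofReal (‖v‖ ^ 2) := by
  rw [EuclideanSpace.norm_sq_eq, ENNReal.ofReal_sum_of_nonneg fun i _ => by positivity]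
  simp only [enorm_sq_eq_ofReal]

theorem IsFullSpark.exists_norm_le {m n 𝕜 : Type*} [Fintype m] [Fintype n] [DecidableEq n]
    [RCLike 𝕜] {A : Matrix m n 𝕜} (hA : IsFullSpark A) {Γ : Finset n}
    (hΓ : Γ.card ≤ Fintype.card m) :
    ∃ K : ℝ, 0 ≤ K ∧ ∀ v : EuclideanSpace 𝕜 n, (∀ i ∉ Γ, v i = 0) →
      ‖v‖ ≤ K * ‖A.toEuclideanLin v‖ := by
  let V : Submodule 𝕜 (EuclideanSpace 𝕜 n) :=
    { carrier := {v | ∀ i ∉ Γ, v i = 0}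
      add_mem' := fun {a b} ha hb i hi => by simp [ha i hi, hb i hi]
      zero_mem' := fun i _ => by simp
      smul_mem' := fun r a ha i hi => by simp [ha i hi] }
  have hker : LinearMap.ker (A.toEuclideanLin.comp V.subtype) = ⊥ := by
    rw [LinearMap.ker_eq_bot']
    rintro ⟨v, hv⟩ hv0
    have hzero : v.ofLp = 0 := hA Γ hΓ v hv (congr_arg WithLp.ofLp hv0)
    ext i
    exact congr_fun hzero i
  obtain ⟨K, -, hK⟩ := (A.toEuclideanLin.comp V.subtype).exists_antilipschitzWith hker
  exact ⟨K, K.2, fun v hv => by simpa [dist_eq_norm] using hK.le_mul_dist ⟨v, hv⟩ 0⟩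

theorem IsFullSpark.exists_bounds {m n 𝕜 : Type*} [Fintype m] [Fintype n] [RCLike 𝕜]
    {A : Matrix m n 𝕜} (hA : IsFullSpark A) :
    ∃ K : ℝ, 1 ≤ K ∧ ∀ Γ : Finset n, Γ.card ≤ Fintype.card m → ∀ v : n → 𝕜, (∀ i ∉ Γ, v i = 0) →
      ∑ i, ‖v i‖ₑ ^ 2 ≤ ENNReal.ofReal K * ∑ p, ‖A.mulVec v p‖ₑ ^ 2 ∧
      ∑ p, ‖A.mulVec v p‖ₑ ^ 2 ≤ ENNReal.ofReal K * ∑ i, ‖v i‖ₑ ^ 2 := by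
  classical
  choose K hK0 hK using fun Γ : {Γ : Finset n // Γ.card ≤ Fintype.card m} =>
    hA.exists_norm_le Γ.2
  set lower := ∑ Γ, K Γ
  set upper := ‖LinearMap.toContinuousLinearMap A.toEuclideanLin‖
  refine ⟨lower ^ 2 + upper ^ 2 + 1, le_add_of_nonneg_left (by positivity), fun Γ hΓ v hv => ?_⟩
  set w : EuclideanSpace 𝕜 n := WithLp.toLp 2 v
  have hw : ∑ i, ‖v i‖ₑ ^ 2 = ENNReal.ofReal (‖w‖ ^ 2) := sum_enorm_sq_eq_ofReal w
  have hAw : ∑ p, ‖A.mulVec v p‖ₑ ^ 2 = ENNReal.ofReal (‖A.toEuclideanLin w‖ ^ 2) :=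
    sum_enorm_sq_eq_ofReal (A.toEuclideanLin w)
  rw [hw, hAw, ← ENNReal.ofReal_mul (by positivity), ← ENNReal.ofReal_mul (by positivity)]
  constructor <;> apply ENNReal.ofReal_le_ofReal
  · have hle : ‖w‖ ≤ lower * ‖A.toEuclideanLin w‖ := (hK ⟨Γ, hΓ⟩ w hv).trans
      (mul_le_mul_of_nonneg_right (Finset.single_le_sum (fun Γ _ => hK0 Γ) (Finset.mem_univ _))
        (norm_nonneg _))
    have hsq := pow_le_pow_left₀ (norm_nonneg _) hle 2
    nlinarith [sq_nonneg (upper * ‖A.toEuclideanLin w‖), sq_nonneg ‖A.toEuclideanLin w‖]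
  · have hle : ‖A.toEuclideanLin w‖ ≤ upper * ‖w‖ :=
      (LinearMap.toContinuousLinearMap A.toEuclideanLin).le_opNorm w
    have hsq := pow_le_pow_left₀ (norm_nonneg _) hle 2
    nlinarith [sq_nonneg (lower * ‖w‖), sq_nonneg ‖w‖]

end GaborMatrix

/-! ### Weighted Dirac trains -/

/-- A Schwartz seminorm controlling the decay `|φ t| = O((1 + |t|)⁻²)`, strong enough to sum the
samples of `φ` along a lattice. -/
def decaySeminorm : Seminorm ℂ 𝓢(ℝ, ℂ) :=
  (Finset.Iic ((2, 0) : ℕ × ℕ)).sup (schwartzSeminormFamily ℂ ℝ ℂ)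

theorem norm_schwartz_le (φ : 𝓢(ℝ, ℂ)) (t : ℝ) :
    ‖φ t‖ ≤ 4 * decaySeminorm φ * (1 / (1 + |t|) ^ 2) := by
  have h := SchwartzMap.one_add_le_sup_seminorm_apply (𝕜 := ℂ) (m := (2, 0)) (k := 2) (n := 0)
    le_rfl le_rfl φ t
  rw [norm_iteratedFDeriv_zero, Real.norm_eq_abs] at h
  rw [mul_one_div, le_div_iff₀ (by positivity), mul_comm]
  exact h.trans_eq (congr_arg (· * decaySeminorm φ) (by norm_num))

section DiracTrain

variable {T : ℝ} {c : ℤ → ℂ}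

theorem summable_one_div_one_add_abs_sq (hT : 0 < T) :
    Summable fun k : ℤ => 1 / (1 + |(k : ℝ) * T|) ^ 2 := by
  have hbase : Summable fun k : ℤ => T⁻¹ ^ 2 * (1 / (k : ℝ) ^ 2) :=
    (Real.summable_one_div_int_pow.2 one_lt_two).mul_left _
  refine hbase.of_norm_bounded_eventually ?_
  filter_upwards [Filter.eventually_cofinite_ne (0 : ℤ)] with k hk
  rw [Real.norm_of_nonneg (by positivity), inv_pow, ← one_div, one_div_mul_one_div, ← mul_pow,
    mul_comm T, ← sq_abs (k * T)]
  gcongr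
  linarith

theorem exists_summable_norm_schwartz_sub_le (hT : 0 < T) (R : ℝ) (φ : 𝓢(ℝ, ℂ)) :
    ∃ b : ℤ → ℝ, Summable b ∧ ∀ (k : ℤ) (τ : ℝ), |τ| ≤ R → ‖φ (τ - k * T)‖ ≤ b k := by
  refine ⟨fun k => 4 * decaySeminorm φ * ((1 + R) ^ 2 * (1 / (1 + |(k : ℝ) * T|) ^ 2)),
    ((summable_one_div_one_add_abs_sq hT).mul_left _).mul_left _, fun k τ hτ => ?_⟩
  have hR : 0 ≤ R := (abs_nonneg τ).trans hτ
  have hpeetre : 1 + |(k : ℝ) * T| ≤ (1 + R) * (1 + |τ - k * T|) := by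
    have := abs_sub_abs_le_abs_sub ((k : ℝ) * T) τ
    rw [abs_sub_comm] at this
    nlinarith [mul_nonneg hR (abs_nonneg (τ - k * T))]
  refine (norm_schwartz_le φ _).trans (mul_le_mul_of_nonneg_left ?_ (by positivity))
  rw [mul_one_div, div_le_div_iff₀ (by positivity) (by positivity), one_mul, ← mul_pow]
  gcongr

theorem norm_mul_schwartz_sample_le {B : ℝ} (hc : ∀ k, ‖c k‖ ≤ B) (φ : 𝓢(ℝ, ℂ)) (k : ℤ) :
    ‖c k * φ (-((k : ℝ) * T))‖ ≤
      B * 4 * decaySeminorm φ * (1 / (1 + |(k : ℝ) * T|) ^ 2) := by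
  have hφ := norm_schwartz_le φ (-((k : ℝ) * T))
  rw [abs_neg] at hφ
  calc ‖c k * φ (-((k : ℝ) * T))‖ = ‖c k‖ * ‖φ (-((k : ℝ) * T))‖ := norm_mul _ _
    _ ≤ B * (4 * decaySeminorm φ * (1 / (1 + |(k : ℝ) * T|) ^ 2)) :=
        mul_le_mul (hc k) hφ (norm_nonneg _) ((norm_nonneg _).trans (hc 0))
    _ = _ := by ring

theorem exists_isDiracTrain (hT : 0 < T) {B : ℝ} (hc : ∀ k, ‖c k‖ ≤ B) :
    ∃ x : 𝓢'(ℝ, ℂ), IsDiracTrain T c x := by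
  have hB : 0 ≤ B := (norm_nonneg _).trans (hc 0)
  have hdecay := summable_one_div_one_add_abs_sq hT
  have hsummable (φ : 𝓢(ℝ, ℂ)) : Summable fun k : ℤ => c k * φ (-((k : ℝ) * T)) :=
    (hdecay.mul_left _).of_norm_bounded (norm_mul_schwartz_sample_le hc φ)
  let x : 𝓢(ℝ, ℂ) →L[ℂ] ℂ := SchwartzMap.mkCLMtoNormedSpace
    (fun φ => ∑' k : ℤ, c k * φ (-((k : ℝ) * T)))
    (fun φ ψ => by
      rw [← (hsummable φ).tsum_add (hsummable ψ)]
      simp [mul_add])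
    (fun a φ => by
      rw [RingHom.id_apply, smul_eq_mul, ← tsum_mul_left]
      simp [mul_left_comm])
    ⟨Finset.Iic (2, 0), B * 4 * ∑' k : ℤ, 1 / (1 + |(k : ℝ) * T|) ^ 2, by positivity, fun φ => by
      have hbound := tsum_of_norm_bounded (hdecay.mul_left _).hasSum
        (norm_mul_schwartz_sample_le hc φ)
      rw [tsum_mul_left, mul_right_comm] at hbound
      exact hbound⟩
  exact ⟨ContinuousLinearMap.toPointwiseConvergenceCLM _ _ _ _ x, fun φ => (hsummable φ).hasSum⟩

/-- The contribution of the `k`-th Dirac mass of a weighted Dirac train to the pairing of its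
time-frequency shift `M_ν T_τ x`, where `p = (τ, ν)`, with the test function `φ`. -/
def trainSample (T : ℝ) (c : ℤ → ℂ) (φ : 𝓢(ℝ, ℂ)) (k : ℤ) (p : ℝ × ℝ) : ℂ :=
  c k * (modChar p.2 (p.1 - k * T) * φ (p.1 - k * T))

theorem continuous_trainSample (T : ℝ) (c : ℤ → ℂ) (φ : 𝓢(ℝ, ℂ)) (k : ℤ) :
    Continuous (trainSample T c φ k) := by
  have hchar : Continuous fun p : ℝ × ℝ => modChar p.2 (p.1 - k * T) :=
    continuous_modChar.comp (by fun_prop : Continuous fun p : ℝ × ℝ => (p.2, p.1 - k * T))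
  exact continuous_const.mul (hchar.mul (by fun_prop))

theorem IsDiracTrain.hasSum_trainSample {x : 𝓢'(ℝ, ℂ)} (hx : IsDiracTrain T c x) (φ : 𝓢(ℝ, ℂ))
    (p : ℝ × ℝ) :
    HasSum (fun k => trainSample T c φ k p) ((modulation p.2 (translation p.1 x)) φ) := by
  rw [modulation_translation_apply]
  convert hx (shiftedTest p φ) using 2 with k
  rw [shiftedTest_apply, trainSample, neg_add_eq_sub]

theorem exists_summable_norm_mul_trainSample_le (hT : 0 < T) {B : ℝ} (hB : ∀ k, ‖c k‖ ≤ B) {R : ℝ}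
    {σ : ℝ × ℝ → ℂ} (hσ : ∀ p : ℝ × ℝ, p.1 ∉ Ico 0 R → σ p = 0) (φ : 𝓢(ℝ, ℂ)) :
    ∃ b : ℤ → ℝ, Summable b ∧ ∀ k p, ‖σ p * trainSample T c φ k p‖ ≤ ‖σ p‖ * b k := by
  obtain ⟨b, hb, hbφ⟩ := exists_summable_norm_schwartz_sub_le hT R φ
  refine ⟨fun k => B * b k, hb.mul_left B, fun k p => ?_⟩
  by_cases hp : p.1 ∈ Ico 0 R
  · have hB0 : 0 ≤ B := (norm_nonneg _).trans (hB 0)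
    simp only [trainSample, norm_mul, modChar_norm, one_mul]
    gcongr
    · exact hB k
    · exact hbφ k p.1 (by rw [abs_of_nonneg hp.1]; exact hp.2.le)
  · simp [hσ p hp]

end DiracTrain

/-! ### Periodic decompositions of integrals and Parseval's identity -/

theorem tsum_int_eq_sum_fin {M : Type*} [AddCommMonoid M] [TopologicalSpace M] {L : ℕ}
    {f : ℤ → M} (hf : ∀ k : ℤ, ¬(0 ≤ k ∧ k < L) → f k = 0) :
    ∑' k, f k = ∑ q : Fin L, f (q : ℕ) := by
  rw [← tsum_fintype (L := .unconditional _)]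
  refine (Function.Injective.tsum_eq (g := fun q : Fin L => ((q : ℕ) : ℤ)) ?_ ?_).symm
  · intro a b hab
    exact Fin.ext (Int.ofNat.inj hab)
  · intro k hk
    by_contra hne
    refine hk (hf k fun h => hne ⟨⟨k.toNat, by omega⟩, ?_⟩)
    simp [h.1]

theorem measurePreserving_add_right_restrict_Ico (T a : ℝ) :
    MeasurePreserving (fun u : ℝ => u + a) (volume.restrict (Ico 0 T))
      (volume.restrict (Ico a (a + T))) := by
  have := (measurePreserving_add_right (volume : Measure ℝ) a).restrict_preimage
    (measurableSet_Ico (a := a) (b := a + T))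
  simpa [add_comm] using this

theorem pairwise_disjoint_Ico_mul (T : ℝ) :
    Pairwise (Function.onFun Disjoint fun k : ℤ => Ico ((k : ℝ) * T) (k * T + T)) := by
  have := pairwise_disjoint_Ico_zsmul T
  simpa [add_mul] using this

theorem iUnion_Ico_mul {T : ℝ} (hT : 0 < T) :
    ⋃ k : ℤ, Ico ((k : ℝ) * T) (k * T + T) = univ := by
  have := iUnion_Ico_zsmul hT
  simpa [add_mul] using this

theorem lintegral_eq_tsum_Ico {T : ℝ} (hT : 0 < T) (g : ℝ → ENNReal) :
    ∫⁻ t, g t = ∑' k : ℤ, ∫⁻ u in Ico 0 T, g (u + k * T) := by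
  rw [← setLIntegral_univ, ← iUnion_Ico_mul hT, lintegral_iUnion (fun _ => measurableSet_Ico)
    (pairwise_disjoint_Ico_mul T)]
  refine tsum_congr fun k => ?_
  exact ((measurePreserving_add_right_restrict_Ico T (k * T)).lintegral_comp_emb
    (measurableEmbedding_addRight _) _).symm

theorem integral_eq_tsum_Ico {T : ℝ} (hT : 0 < T) {g : ℝ → ℂ} (hg : Integrable g) :
    ∫ t, g t = ∑' k : ℤ, ∫ u in Ico 0 T, g (u + k * T) := by
  rw [← setIntegral_univ, ← iUnion_Ico_mul hT, integral_iUnion (fun _ => measurableSet_Ico)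
    (pairwise_disjoint_Ico_mul T) hg.integrableOn]
  refine tsum_congr fun k => ?_
  exact ((measurePreserving_add_right_restrict_Ico T (k * T)).integral_comp
    (measurableEmbedding_addRight _) _).symm

theorem add_mul_notMem_Ico {T u : ℝ} (hT : 0 < T) {L : ℕ} (hu : u ∈ Ico 0 T) {k : ℤ}
    (hk : ¬(0 ≤ k ∧ k < L)) : u + k * T ∉ Ico 0 (L * T) := by
  intro h
  refine hk ⟨?_, ?_⟩
  · by_contra! hlt
    have : (k : ℝ) ≤ -1 := by exact_mod_cast (by omega : k ≤ -1)
    nlinarith [h.1, hu.2]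
  · by_contra! hle
    have : (L : ℝ) ≤ k := by exact_mod_cast hle
    nlinarith [h.2, hu.1]

theorem lintegral_eq_sum_Ico {T : ℝ} (hT : 0 < T) (L : ℕ) {g : ℝ → ENNReal}
    (hg : ∀ t ∉ Ico 0 (L * T), g t = 0) :
    ∫⁻ t, g t = ∑ q : Fin L, ∫⁻ u in Ico 0 T, g (u + (q : ℕ) * T) := by
  rw [lintegral_eq_tsum_Ico hT, tsum_int_eq_sum_fin (L := L) fun k hk => ?_]
  · simp
  · rw [setLIntegral_congr_fun measurableSet_Ico fun u hu => hg _ (add_mul_notMem_Ico hT hu hk)]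
    simp

theorem integral_eq_sum_Ico {T : ℝ} (hT : 0 < T) (L : ℕ) {g : ℝ → ℂ} (hgi : Integrable g)
    (hg : ∀ t ∉ Ico 0 (L * T), g t = 0) :
    ∫ t, g t = ∑ q : Fin L, ∫ u in Ico 0 T, g (u + (q : ℕ) * T) := by
  rw [integral_eq_tsum_Ico hT hgi, tsum_int_eq_sum_fin (L := L) fun k hk => ?_]
  · simp
  · rw [setIntegral_congr_fun measurableSet_Ico fun u hu => hg _ (add_mul_notMem_Ico hT hu hk)]
    simp

theorem norm_sq_integral_modChar {l : ℝ} (hl : 0 < l) (f : ℝ → ℂ) (r : ℤ) :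
    ‖∫ η in Ico 0 l, f η * modChar η (r / l)‖ ^ 2 = l ^ 2 * ‖fourierCoeffOn hl f (-r)‖ ^ 2 := by
  have hint : ∫ η in (0 : ℝ)..l, fourier (-(-r)) (η : AddCircle (l - 0)) • f η =
      ∫ η in Ico 0 l, f η * modChar η (r / l) := by
    rw [intervalIntegral.integral_of_le hl.le, ← restrict_Ico_eq_restrict_Ioc]
    congr with η
    simp only [fourier_coe_apply, smul_eq_mul, modChar]
    rw [mul_comm]
    congr 2
    push_cast
    ring
  rw [fourierCoeffOn_eq_integral, hint, norm_smul, ← mul_pow, ← mul_assoc, Real.norm_of_nonneg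
    (by simpa using hl.le), sub_zero, mul_one_div_cancel hl.ne', one_mul]

theorem tsum_enorm_sq_integral_modChar {l : ℝ} (hl : 0 < l) {f : ℝ → ℂ}
    (hf : MemLp f 2 (volume.restrict (Ico 0 l))) :
    ∑' r : ℤ, ‖∫ η in Ico 0 l, f η * modChar η (r / l)‖ₑ ^ 2 =
      ENNReal.ofReal l * ∫⁻ η in Ico 0 l, ‖f η‖ₑ ^ 2 := by
  have henergy : ENNReal.ofReal (∫ η in (0 : ℝ)..l, ‖f η‖ ^ 2) = ∫⁻ η in Ico 0 l, ‖f η‖ₑ ^ 2 := by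
    rw [intervalIntegral.integral_of_le hl.le, ← restrict_Ico_eq_restrict_Ioc,
      ofReal_integral_eq_lintegral_ofReal hf.norm.integrable_sq
        (Filter.Eventually.of_forall fun _ => sq_nonneg _)]
    simp_rw [enorm_sq_eq_ofReal]
  have hparseval := ((Equiv.neg ℤ).hasSum_iff.2 <| hasSum_sq_fourierCoeffOn hl <|
    restrict_Ico_eq_restrict_Ioc (μ := volume) (a := 0) (b := l) ▸ hf).mul_left (l ^ 2)
  simp only [Function.comp_def, Equiv.neg_apply, ← norm_sq_integral_modChar] at hparseval
  simp_rw [enorm_sq_eq_ofReal]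
  rw [← ENNReal.ofReal_tsum_of_nonneg (fun _ => sq_nonneg _) hparseval.summable, hparseval.tsum_eq]
  simp_rw [← enorm_sq_eq_ofReal]
  rw [← henergy, ← ENNReal.ofReal_mul hl.le, smul_eq_mul, sub_zero, sq, mul_assoc,
    mul_inv_cancel_left₀ hl.ne']

/-! ### Square-integrable functions -/

section SquareIntegrable

variable {α : Type*} [MeasurableSpace α] {μ : Measure α}

theorem lintegral_enorm_sq_eq (f : Lp ℂ 2 μ) :
    ∫⁻ a, ‖f a‖ₑ ^ 2 ∂μ = ENNReal.ofReal (‖f‖ ^ 2) := by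
  have h := eLpNorm_nnreal_pow_eq_lintegral (f := f) (μ := μ) (p := 2) two_ne_zero
  rw [Lp.norm_def, ← ENNReal.toReal_pow, ENNReal.ofReal_toReal
    (ENNReal.pow_ne_top (Lp.eLpNorm_ne_top f))]
  simpa using h.symm

theorem lintegral_enorm_sq_of_ae_eq {f : Lp ℂ 2 μ} {g : α → ℂ} (h : f =ᵐ[μ] g) :
    ∫⁻ a, ‖g a‖ₑ ^ 2 ∂μ = ENNReal.ofReal (‖f‖ ^ 2) := by
  rw [← lintegral_enorm_sq_eq]
  exact lintegral_congr_ae (h.symm.fun_comp fun z => ‖z‖ₑ ^ 2)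

theorem memLp_two_iff_lintegral_lt_top {f : α → ℂ} (hf : AEStronglyMeasurable f μ) :
    MemLp f 2 μ ↔ ∫⁻ a, ‖f a‖ₑ ^ 2 ∂μ < ⊤ := by
  rw [MemLp, and_iff_right hf,
    eLpNorm_lt_top_iff_lintegral_rpow_enorm_lt_top two_ne_zero ENNReal.ofNat_ne_top]
  simp

theorem integrable_of_memLp_two_of_eq_zero {g : α → ℂ} {S : Set α} (hg : MemLp g 2 μ)
    (hS : μ S ≠ ⊤) (h0 : ∀ a ∉ S, g a = 0) : Integrable g μ := by
  have : IsFiniteMeasure (μ.restrict S) := ⟨by simpa using hS.lt_top⟩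
  exact (integrableOn_iff_integrable_of_support_subset (Function.support_subset_iff'.2 h0)).1
    ((hg.restrict S).integrable one_le_two)

theorem memLp_modChar_mul {μ : Measure ℝ} {g : ℝ → ℂ} (hg : MemLp g 2 μ) (a : ℝ) :
    MemLp (fun η => modChar η a * g η) 2 μ := by
  refine hg.of_le (AEStronglyMeasurable.mul ?_ hg.1) (Filter.Eventually.of_forall fun η => ?_)
  · exact (continuous_modChar.comp (continuous_id.prodMk continuous_const)).aestronglyMeasurable
  · rw [norm_mul, modChar_norm, one_mul]

theorem ae_memLp_slice {σ : ℝ × ℝ → ℂ} (hσm : StronglyMeasurable σ) (hσ2 : MemLp σ 2) :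
    ∀ᵐ τ : ℝ, MemLp (fun ν => σ (τ, ν)) 2 := by
  have hm : Measurable fun p : ℝ × ℝ => ‖σ p‖ₑ ^ 2 := hσm.enorm.pow_const _
  have hfin := (memLp_two_iff_lintegral_lt_top hσm.aestronglyMeasurable).1 hσ2
  rw [Measure.volume_eq_prod, lintegral_prod _ hm.aemeasurable] at hfin
  filter_upwards [ae_lt_top hm.lintegral_prod_right' hfin.ne] with τ hτ
  have hslice : StronglyMeasurable fun ν => σ (τ, ν) := hσm.comp_measurable measurable_prodMk_left
  exact (memLp_two_iff_lintegral_lt_top hslice.aestronglyMeasurable).2 hτ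

theorem ae_memLp_slice_translates {σ : ℝ × ℝ → ℂ} (hσm : StronglyMeasurable σ)
    (hσ2 : MemLp σ 2) (T : ℝ) (L : ℕ) :
    ∀ᵐ u : ℝ, ∀ q : Fin L, MemLp (fun ν => σ (u + (q : ℕ) * T, ν)) 2 :=
  ae_all_iff.2 fun q =>
    (measurePreserving_add_right volume ((q : ℕ) * T)).quasiMeasurePreserving.ae
      (ae_memLp_slice hσm hσ2)

end SquareIntegrable

/-! ### The response to a weighted Dirac train -/

section TrainResponse

variable {T : ℝ} {L : ℕ} {c : ℤ → ℂ} {σ : ℝ × ℝ → ℂ}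

/-- The response, as a function of time, to the Dirac train with weights `c` of the operator with
spreading function `σ`. In the lemmas below `σ` is supported in `0 ≤ τ < LT`, so that at most `L`
terms of the series are nonzero. -/
def trainResponse (T : ℝ) (c : ℤ → ℂ) (σ : ℝ × ℝ → ℂ) (t : ℝ) : ℂ :=
  ∑' k : ℤ, c k * ∫ ν, σ (t + k * T, ν) * modChar ν t

theorem hasSum_trainResponse (hT : 0 < T) (c : ℤ → ℂ)
    (hσ : ∀ p : ℝ × ℝ, p.1 ∉ Ico 0 (L * T) → σ p = 0) (t : ℝ) :
    HasSum (fun k : ℤ => c k * ∫ ν, σ (t + k * T, ν) * modChar ν t) (trainResponse T c σ t) := by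
  refine (summable_of_hasFiniteSupport
    ((finite_Icc ⌊-t / T⌋ ⌈(L * T - t) / T⌉).subset fun k hk => ?_)).hasSum
  have hmem : t + k * T ∈ Ico 0 (L * T) := by
    by_contra h
    simp [fun ν => hσ (t + k * T, ν) h] at hk
  rw [mem_Icc]
  constructor
  · exact Int.cast_le.1 ((Int.floor_le (-t / T)).trans ((div_le_iff₀ hT).2 (by linarith [hmem.1])))
  · exact Int.cast_le.1 (le_trans ((le_div_iff₀ hT).2 (by linarith [hmem.2])) (Int.le_ceil _))

theorem trainResponse_add_mul (hT : 0 < T) (c : ℤ → ℂ)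
    (hσ : ∀ p : ℝ × ℝ, p.1 ∉ Ico 0 (L * T) → σ p = 0) {u : ℝ} (hu : u ∈ Ico 0 T) (p : ℤ) :
    trainResponse T c σ (u + p * T) =
      ∑ q : Fin L, c ((q : ℕ) - p) * ∫ ν, σ (u + (q : ℕ) * T, ν) * modChar ν (u + p * T) := by
  have hshift : ∀ k : ℤ, u + p * T + ((k - p : ℤ) : ℝ) * T = u + k * T := fun k => by
    push_cast
    ring
  rw [trainResponse, ← (Equiv.subRight p).tsum_eq]
  simp only [Equiv.subRight_apply, hshift]
  rw [tsum_int_eq_sum_fin (L := L) fun k hk => ?_]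
  · simp only [Int.cast_natCast]
  · simp [fun ν => hσ (u + k * T, ν) (add_mul_notMem_Ico hT hu hk)]

theorem stronglyMeasurable_trainResponse (hT : 0 < T) (c : ℤ → ℂ) (hσm : StronglyMeasurable σ)
    (hσ : ∀ p : ℝ × ℝ, p.1 ∉ Ico 0 (L * T) → σ p = 0) :
    StronglyMeasurable (trainResponse T c σ) := by
  refine stronglyMeasurable_of_tendsto Filter.atTop (f := fun (F : Finset ℤ) t =>
    ∑ k ∈ F, c k * ∫ ν, σ (t + k * T, ν) * modChar ν t) (fun F => ?_)
    (tendsto_pi_nhds.2 fun t => hasSum_trainResponse hT c hσ t)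
  refine Finset.stronglyMeasurable_fun_sum _ fun k _ => StronglyMeasurable.const_mul
    (StronglyMeasurable.integral_prod_right (f := fun t ν : ℝ => σ (t + k * T, ν) * modChar ν t)
      (.mul (hσm.comp_measurable (by fun_prop)) ?_)) _
  exact (continuous_modChar.comp continuous_swap).stronglyMeasurable

theorem integrable_mul_of_norm_le {α : Type*} [MeasurableSpace α] {μ : Measure α} {f g : α → ℂ}
    {b : ℝ} (hf : Integrable f μ) (hg : AEStronglyMeasurable g μ)
    (hb : ∀ a, ‖f a * g a‖ ≤ ‖f a‖ * b) :
    Integrable (fun a => f a * g a) μ :=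
  (hf.norm.mul_const b).mono' (hf.1.mul hg) (Filter.Eventually.of_forall hb)

theorem summable_integral_norm_mul {ι α : Type*} [MeasurableSpace α] {μ : Measure α} {f : α → ℂ}
    {g : ι → α → ℂ} {b : ι → ℝ} (hf : Integrable f μ) (hg : ∀ i, AEStronglyMeasurable (g i) μ)
    (hb : Summable b) (hgb : ∀ i a, ‖f a * g i a‖ ≤ ‖f a‖ * b i) :
    Summable fun i => ∫ a, ‖f a * g i a‖ ∂μ := by
  refine Summable.of_nonneg_of_le (fun i => integral_nonneg fun a => norm_nonneg _) (fun i => ?_)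
    (hb.mul_left (∫ a, ‖f a‖ ∂μ))
  rw [← integral_mul_const]
  exact integral_mono (integrable_mul_of_norm_le hf (hg i) (hgb i)).norm (hf.norm.mul_const _)
    (hgb i)

theorem integrable_mul_of_hasSum {ι α : Type*} [Countable ι] [MeasurableSpace α] {μ : Measure α}
    {f K : α → ℂ} {g : ι → α → ℂ} {b : ι → ℝ} (hf : Integrable f μ)
    (hg : ∀ i, AEStronglyMeasurable (g i) μ) (hb : Summable b)
    (hgb : ∀ i a, ‖f a * g i a‖ ≤ ‖f a‖ * b i) (hK : ∀ a, HasSum (fun i => g i a) (K a)) :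
    Integrable (fun a => f a * K a) μ := by
  refine integrable_mul_of_norm_le (b := ∑' i, b i) hf ?_ fun a => ?_
  · exact aestronglyMeasurable_of_tendsto_ae Filter.atTop
      (f := fun (F : Finset ι) a => ∑ i ∈ F, g i a)
      (fun F => Finset.aestronglyMeasurable_fun_sum _ fun i _ => hg i)
      (Filter.Eventually.of_forall hK)
  · rw [← (hK a).tsum_eq, ← tsum_mul_left, ← tsum_mul_left]
    exact tsum_of_norm_bounded (hb.mul_left _).hasSum fun i => hgb i a

theorem integrable_add_fst {F : ℝ × ℝ → ℂ} (hF : Integrable F) (τ : ℝ) :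
    Integrable (fun p : ℝ × ℝ => F (p.1 + τ, p.2)) ((volume : Measure ℝ).prod volume) := by
  simpa [Prod.add_def, Measure.volume_eq_prod] using hF.comp_add_right (τ, (0 : ℝ))

theorem integral_integral_add_fst {F : ℝ × ℝ → ℂ} (hF : Integrable F) (τ : ℝ) :
    ∫ t, ∫ ν, F (t + τ, ν) = ∫ p, F p := by
  rw [← integral_add_right_eq_self F (τ, (0 : ℝ)), Measure.volume_eq_prod]
  simpa [Prod.add_def] using (integral_prod _ (integrable_add_fst hF τ)).symm

theorem integral_norm_integral_add_fst_le {F : ℝ × ℝ → ℂ} (hF : Integrable F) (τ : ℝ) :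
    ∫ t, ‖∫ ν, F (t + τ, ν)‖ ≤ ∫ p, ‖F p‖ := by
  rw [← integral_add_right_eq_self (fun p => ‖F p‖) (τ, (0 : ℝ)), Measure.volume_eq_prod]
  have hnorm := (integrable_add_fst hF τ).norm
  simp only [Prod.add_def, add_zero]
  rw [integral_prod _ hnorm]
  exact integral_mono (integrable_add_fst hF τ).integral_prod_left.norm hnorm.integral_prod_left
    fun t => norm_integral_le_integral_norm _

theorem integral_mul_trainSample_add (σ : ℝ × ℝ → ℂ) (φ : 𝓢(ℝ, ℂ)) (k : ℤ) (t : ℝ) :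
    ∫ ν, σ (t + k * T, ν) * trainSample T c φ k (t + k * T, ν) =
      c k * (∫ ν, σ (t + k * T, ν) * modChar ν t) * φ t := by
  rw [← integral_const_mul, ← integral_mul_const]
  simp only [trainSample, add_sub_cancel_right]
  exact integral_congr_ae (Filter.Eventually.of_forall fun ν => by ring)

theorem isResponse_of_ae_eq_trainResponse (hT : 0 < T) {B : ℝ} (hB : ∀ k, ‖c k‖ ≤ B)
    {x : 𝓢'(ℝ, ℂ)} (hx : IsDiracTrain T c x) {s : SpreadingFunction} (hs : s =ᵐ[volume] σ)
    (hσ1 : Integrable σ) {R : ℝ} (hσ : ∀ p : ℝ × ℝ, p.1 ∉ Ico 0 R → σ p = 0) {y : OutputSignal}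
    (hy : y =ᵐ[volume] trainResponse T c σ) : IsResponse s x y := by
  intro φ
  set K : ℝ × ℝ → ℂ := fun p => (modulation p.2 (translation p.1 x)) φ
  obtain ⟨b, hb, hbound⟩ := exists_summable_norm_mul_trainSample_le hT hB hσ φ
  have hmeas := fun k => (continuous_trainSample T c φ k).aestronglyMeasurable (μ := volume)
  have hint := fun k => integrable_mul_of_norm_le hσ1 (hmeas k) (hbound k)
  have hsummable := summable_integral_norm_mul hσ1 hmeas hb hbound
  have hsum : ∀ p, HasSum (fun k => trainSample T c φ k p) (K p) := hx.hasSum_trainSample φ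
  have hfrequency := hasSum_integral_of_summable_integral_norm hint hsummable
  have htime := hasSum_integral_of_summable_integral_norm
    (fun k => (integrable_add_fst (hint k) (k * T)).integral_prod_left)
    (.of_nonneg_of_le (fun k => integral_nonneg fun t => norm_nonneg _)
      (fun k => integral_norm_integral_add_fst_le (hint k) (k * T)) hsummable)
  simp only [tsum_mul_left, fun p => (hsum p).tsum_eq,
    ← fun k : ℤ => integral_integral_add_fst (hint k) (k * T)] at hfrequency
  simp only [integral_mul_trainSample_add, tsum_mul_right] at hfrequency htime
  have hsK : (fun p : ℝ × ℝ => s p * K p) =ᵐ[volume] fun p => σ p * K p := hs.mul .rfl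
  have hyφ : (fun t : ℝ => y t * φ t) =ᵐ[volume] fun t => trainResponse T c σ t * φ t :=
    hy.mul .rfl
  refine ⟨(integrable_mul_of_hasSum hσ1 hmeas hb hbound hsum).congr hsK.symm, ?_⟩
  rw [integral_congr_ae hsK, integral_congr_ae hyφ]
  exact hfrequency.unique htime

/-! ### The energy of the response -/

/-- The extent `1 / (TL)` of a cell in the frequency direction. -/
def cellHeight (T : ℝ) (L : ℕ) : ℝ := 1 / (T * L)

/-- The primitive `L`-th root of unity `e^{2πi/L}`. -/
def rootOfUnity (L : ℕ) : ℂ := Complex.exp (2 * Real.pi * Complex.I / L)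

/-- The values of `σ` at the points of all cells that are in the same relative position `(u, η)`,
up to unimodular factors: the coefficient vector to which the Gabor matrix is applied. -/
def cellVector (T : ℝ) (L : ℕ) (σ : ℝ × ℝ → ℂ) (u η : ℝ) (i : Fin L × Fin L) : ℂ :=
  modChar ((i.2 : ℕ) * cellHeight T L) u *
    σ (u + (i.1 : ℕ) * T, η + (i.2 : ℕ) * cellHeight T L)

theorem cellHeight_pos (hT : 0 < T) (hL : 1 ≤ L) : 0 < cellHeight T L :=
  one_div_pos.2 (mul_pos hT (by exact_mod_cast hL))

theorem mem_Ico_of_mem_region (hT : 0 < T) (hL : 1 ≤ L) {Γ : Finset (Fin L × Fin L)} {p : ℝ × ℝ}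
    (hp : p ∈ region T L Γ) : p.1 ∈ Ico 0 (L * T) ∧ p.2 ∈ Ico 0 (L * cellHeight T L) := by
  obtain ⟨i, -, h⟩ := mem_region.1 hp
  have hTL : 0 < T * L := mul_pos hT (by exact_mod_cast hL)
  have hi₁ : ((i.1 : ℕ) : ℝ) + 1 ≤ L := by exact_mod_cast i.1.2
  have hi₂ : ((i.2 : ℕ) : ℝ) + 1 ≤ L := by exact_mod_cast i.2.2
  rw [cell, mem_prod, mem_Ico, mem_Ico] at h
  refine ⟨⟨le_trans (by positivity) h.1.1, h.1.2.trans_le (by gcongr)⟩,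
    ⟨le_trans (by positivity) h.2.1, h.2.2.trans_le ?_⟩⟩
  rw [cellHeight, mul_one_div]
  gcongr

theorem add_mul_mem_cell {u η : ℝ} (hu : u ∈ Ico 0 T) (hη : η ∈ Ico 0 (cellHeight T L))
    (i : Fin L × Fin L) :
    (u + (i.1 : ℕ) * T, η + (i.2 : ℕ) * cellHeight T L) ∈ cell T L i.1 i.2 := by
  rw [cellHeight, mem_Ico] at hη
  have hdiv : ∀ a : ℝ, a / (T * L) = a * (1 / (T * L)) := fun a => div_eq_mul_one_div a _
  rw [cell, mem_prod, hdiv (i.2 : ℕ), hdiv ((i.2 : ℕ) + 1), cellHeight]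
  refine ⟨⟨?_, ?_⟩, ⟨?_, ?_⟩⟩ <;> simp only <;> linarith [hu.1, hu.2, hη.1, hη.2]

theorem cellVector_eq_zero (hT : 0 < T) (hL : 1 ≤ L) {Γ : Finset (Fin L × Fin L)}
    (hσ : ∀ p ∉ region T L Γ, σ p = 0) {u η : ℝ} (hu : u ∈ Ico 0 T)
    (hη : η ∈ Ico 0 (cellHeight T L)) {i : Fin L × Fin L} (hi : i ∉ Γ) :
    cellVector T L σ u η i = 0 := by
  rw [cellVector, hσ _ fun hmem => ?_, mul_zero]
  obtain ⟨j, hj, hmem⟩ := mem_region.1 hmem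
  exact disjoint_left.1 (disjoint_cell hT hL fun h : j = i => hi (h ▸ hj)) hmem
    (add_mul_mem_cell hu hη i)

theorem modChar_add_mul_cellHeight (hT : 0 < T) (hL : 1 ≤ L) (u η : ℝ) (m p : ℕ) (r : ℤ) :
    modChar (η + m * cellHeight T L) (u + (p + r * L : ℤ) * T) =
      modChar η (u + p * T) * modChar (m * cellHeight T L) u * rootOfUnity L ^ (m * p) *
        modChar η (r / cellHeight T L) := by
  have hL0 : (L : ℝ) ≠ 0 := by positivity
  have hL' : (L : ℂ) ≠ 0 := by exact_mod_cast hL0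
  have hT' : (T : ℂ) ≠ 0 := by exact_mod_cast hT.ne'
  have hsplit : (u + (p + r * L : ℤ) * T : ℝ) = u + p * T + r / cellHeight T L := by
    rw [cellHeight]
    push_cast
    field_simp
    ring
  have hroot : modChar (m * cellHeight T L) (p * T) = rootOfUnity L ^ (m * p) := by
    rw [rootOfUnity, ← Complex.exp_nat_mul, modChar, cellHeight]
    congr 1
    push_cast
    field_simp
  have hperiod : modChar (m * cellHeight T L) (r / cellHeight T L) = 1 := by
    rw [modChar, cellHeight]
    refine Complex.exp_eq_one_iff.2 ⟨m * r, ?_⟩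
    push_cast
    field_simp
  rw [hsplit, modChar_add_left, modChar_add_right η, modChar_add_right (m * cellHeight T L),
    modChar_add_right (m * cellHeight T L), hroot, hperiod]
  ring

theorem integrable_mul_modChar {g : ℝ → ℂ} {l : ℝ} (hg : MemLp g 2) (h0 : ∀ t ∉ Ico 0 l, g t = 0)
    (a : ℝ) : Integrable fun ν => g ν * modChar ν a := by
  refine integrable_of_memLp_two_of_eq_zero (S := Ico 0 l) ?_ measure_Ico_lt_top.ne fun ν hν => by
    rw [h0 ν hν, zero_mul]
  simpa only [mul_comm] using memLp_modChar_mul hg a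

-- The values of the response along a coset of the lattice `LTℤ` are Fourier coefficients.
theorem trainResponse_eq_integral_mulVec (hT : 0 < T) (hL : 1 ≤ L)
    (hc : Function.Periodic c (L : ℤ))
    (hσ : ∀ p : ℝ × ℝ, p.1 ∉ Ico 0 (L * T) → σ p = 0)
    (hσ' : ∀ p : ℝ × ℝ, p.2 ∉ Ico 0 (L * cellHeight T L) → σ p = 0) {u : ℝ} (hu : u ∈ Ico 0 T)
    (hu2 : ∀ q : Fin L, MemLp (fun ν => σ (u + (q : ℕ) * T, ν)) 2) (p : Fin L) (r : ℤ) :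
    trainResponse T c σ (u + (p + r * L : ℤ) * T) =
      ∫ η in Ico 0 (cellHeight T L), modChar η (u + (p : ℕ) * T) *
        (gaborMatrix L (rootOfUnity L) c).mulVec (cellVector T L σ u η) p *
          modChar η (r / cellHeight T L) := by
  set t : ℝ := u + (p + r * L : ℤ) * T with ht
  have hint : ∀ q : Fin L, Integrable fun ν => σ (u + (q : ℕ) * T, ν) * modChar ν t := fun q =>
    integrable_mul_modChar (hu2 q) (fun ν hν => hσ' _ hν) t
  have hper : ∀ n : ℤ, c (n - r * L) = c n := fun n => hc.sub_int_mul_eq r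
  have hfold : ∀ q : Fin L, c ((q : ℕ) - (p + r * L : ℤ)) * ∫ ν, σ (u + (q : ℕ) * T, ν) *
      modChar ν t = ∑ m : Fin L, ∫ η in Ico 0 (cellHeight T L), c ((q : ℕ) - (p : ℕ)) *
        (σ (u + (q : ℕ) * T, η + (m : ℕ) * cellHeight T L) *
          modChar (η + (m : ℕ) * cellHeight T L) t) := by
    intro q
    rw [← sub_sub, hper, integral_eq_sum_Ico (cellHeight_pos hT hL) L (hint q)
      fun ν hν => by rw [hσ' _ hν, zero_mul], Finset.mul_sum]
    exact Finset.sum_congr rfl fun m _ => (integral_const_mul _ _).symm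
  rw [trainResponse_add_mul hT c hσ hu, ← ht, Finset.sum_congr rfl fun q _ => hfold q,
    ← Fintype.sum_prod_type' (f := fun q m : Fin L => ∫ η in Ico 0 (cellHeight T L),
      c ((q : ℕ) - (p : ℕ)) * (σ (u + (q : ℕ) * T, η + (m : ℕ) * cellHeight T L) *
        modChar (η + (m : ℕ) * cellHeight T L) t)), ← integral_finsetSum]
  · congr with η
    simp only [Matrix.mulVec, dotProduct, Finset.mul_sum, Finset.sum_mul]
    refine Finset.sum_congr rfl fun i _ => ?_
    rw [ht, modChar_add_mul_cellHeight hT hL, gaborMatrix, cellVector, Matrix.of_apply]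
    ring
  · exact fun i _ =>
      (((hint i.1).comp_add_right ((i.2 : ℕ) * cellHeight T L)).const_mul _).integrableOn

theorem memLp_mulVec_cellVector {u : ℝ}
    (hu : ∀ q : Fin L, MemLp (fun ν => σ (u + (q : ℕ) * T, ν)) 2)
    (A : Matrix (Fin L) (Fin L × Fin L) ℂ) (p : Fin L) :
    MemLp (fun η => A.mulVec (cellVector T L σ u η) p) 2 :=
  memLp_finsetSum _ fun i _ => (((hu i.1).comp_measurePreserving
    (measurePreserving_add_right volume _)).const_mul _).const_mul _

theorem tsum_enorm_sq_trainResponse (hT : 0 < T) (hL : 1 ≤ L) (hc : Function.Periodic c (L : ℤ))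
    (hσ : ∀ p : ℝ × ℝ, p.1 ∉ Ico 0 (L * T) → σ p = 0)
    (hσ' : ∀ p : ℝ × ℝ, p.2 ∉ Ico 0 (L * cellHeight T L) → σ p = 0) {u : ℝ} (hu : u ∈ Ico 0 T)
    (hu2 : ∀ q : Fin L, MemLp (fun ν => σ (u + (q : ℕ) * T, ν)) 2) :
    ∑' k : ℤ, ‖trainResponse T c σ (u + k * T)‖ₑ ^ 2 = ENNReal.ofReal (cellHeight T L) *
      ∫⁻ η in Ico 0 (cellHeight T L), ∑ p,
        ‖(gaborMatrix L (rootOfUnity L) c).mulVec (cellVector T L σ u η) p‖ₑ ^ 2 := by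
  have : NeZero L := ⟨by omega⟩
  have hmem := memLp_mulVec_cellVector hu2 (gaborMatrix L (rootOfUnity L) c)
  rw [← (Int.divModEquiv L).symm.tsum_eq, ENNReal.tsum_prod', ENNReal.tsum_comm, tsum_fintype,
    lintegral_finsetSum' _ fun p _ => (hmem p).restrict _ |>.1.enorm.pow_const _, Finset.mul_sum]
  refine Finset.sum_congr rfl fun p _ => ?_
  have hparseval := tsum_enorm_sq_integral_modChar (cellHeight_pos hT hL)
    (memLp_modChar_mul ((hmem p).restrict _) (u + (p : ℕ) * T))
  simp only [enorm_modChar_mul] at hparseval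
  rw [← hparseval]
  refine tsum_congr fun r => ?_
  have hcoset : (Int.divModEquiv L).symm (r, p) = p + r * L := by
    simp [Int.divModEquiv, add_comm]
  rw [← trainResponse_eq_integral_mulVec hT hL hc hσ hσ' hu hu2 p r, hcoset]

theorem lintegral_enorm_sq_trainResponse (hT : 0 < T) (hL : 1 ≤ L)
    (hc : Function.Periodic c (L : ℤ)) (hσm : StronglyMeasurable σ) (hσ2 : MemLp σ 2)
    (hσ : ∀ p : ℝ × ℝ, p.1 ∉ Ico 0 (L * T) → σ p = 0)
    (hσ' : ∀ p : ℝ × ℝ, p.2 ∉ Ico 0 (L * cellHeight T L) → σ p = 0) :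
    ∫⁻ t, ‖trainResponse T c σ t‖ₑ ^ 2 = ENNReal.ofReal (cellHeight T L) *
      ∫⁻ u in Ico 0 T, ∫⁻ η in Ico 0 (cellHeight T L), ∑ p,
        ‖(gaborMatrix L (rootOfUnity L) c).mulVec (cellVector T L σ u η) p‖ₑ ^ 2 := by
  rw [lintegral_eq_tsum_Ico hT, ← lintegral_tsum, ← lintegral_const_mul' _ _ ENNReal.ofReal_ne_top]
  · refine lintegral_congr_ae ?_
    filter_upwards [ae_restrict_of_ae (ae_memLp_slice_translates hσm hσ2 T L),
      ae_restrict_mem measurableSet_Ico] with u hu2 hu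
    exact tsum_enorm_sq_trainResponse hT hL hc hσ hσ' hu hu2
  · exact fun k => (((stronglyMeasurable_trainResponse hT c hσm hσ).comp_measurable
      (measurable_id.add_const _)).enorm.pow_const _).aemeasurable

theorem lintegral_enorm_sq_eq_cellVector (hT : 0 < T) (hL : 1 ≤ L) (hσm : StronglyMeasurable σ)
    (hσ : ∀ p : ℝ × ℝ, p.1 ∉ Ico 0 (L * T) → σ p = 0)
    (hσ' : ∀ p : ℝ × ℝ, p.2 ∉ Ico 0 (L * cellHeight T L) → σ p = 0) :
    ∫⁻ p, ‖σ p‖ₑ ^ 2 = ∫⁻ u in Ico 0 T, ∫⁻ η in Ico 0 (cellHeight T L),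
      ∑ i, ‖cellVector T L σ u η i‖ₑ ^ 2 := by
  have hm : Measurable fun p : ℝ × ℝ => ‖σ p‖ₑ ^ 2 := hσm.enorm.pow_const _
  simp only [cellVector, enorm_modChar_mul]
  rw [Measure.volume_eq_prod, lintegral_prod _ hm.aemeasurable, lintegral_eq_sum_Ico hT L,
    ← lintegral_finsetSum]
  · refine lintegral_congr fun u => ?_
    rw [lintegral_finsetSum, Fintype.sum_prod_type]
    · exact Finset.sum_congr rfl fun q _ => lintegral_eq_sum_Ico (cellHeight_pos hT hL) L
        fun ν hν => by rw [hσ' _ hν]; simp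
    · exact fun i _ => hm.comp (measurable_const.prodMk (measurable_id.add_const _))
  · exact fun q _ => hm.lintegral_prod_right'.comp (measurable_id.add_const _)
  · exact fun t ht => by simp [fun ν => hσ (t, ν) ht]

theorem setLIntegral_setLIntegral_le_const_mul {A B : Set ℝ} (hA : MeasurableSet A)
    (hB : MeasurableSet B) (K : ℝ) {f g : ℝ → ℝ → ENNReal}
    (h : ∀ u ∈ A, ∀ η ∈ B, f u η ≤ ENNReal.ofReal K * g u η) :
    ∫⁻ u in A, ∫⁻ η in B, f u η ≤ ENNReal.ofReal K * ∫⁻ u in A, ∫⁻ η in B, g u η := by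
  rw [← lintegral_const_mul' _ _ ENNReal.ofReal_ne_top]
  refine setLIntegral_mono' hA fun u hu => ?_
  rw [← lintegral_const_mul' _ _ ENNReal.ofReal_ne_top]
  exact setLIntegral_mono' hB (h u hu)

theorem exists_trainResponse_energy_bounds (hT : 0 < T) (hL : 1 ≤ L)
    (hc : Function.Periodic c (L : ℤ)) (hspark : IsFullSpark (gaborMatrix L (rootOfUnity L) c)) :
    ∃ K : ℝ, 1 ≤ K ∧ ∀ Γ : Finset (Fin L × Fin L), Γ.card ≤ L → ∀ σ : ℝ × ℝ → ℂ,
      StronglyMeasurable σ → MemLp σ 2 → (∀ p ∉ region T L Γ, σ p = 0) →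
      ENNReal.ofReal (cellHeight T L) * ∫⁻ p, ‖σ p‖ₑ ^ 2 ≤
        ENNReal.ofReal K * ∫⁻ t, ‖trainResponse T c σ t‖ₑ ^ 2 ∧
      ∫⁻ t, ‖trainResponse T c σ t‖ₑ ^ 2 ≤
        ENNReal.ofReal (cellHeight T L * K) * ∫⁻ p, ‖σ p‖ₑ ^ 2 := by
  obtain ⟨K, hK, hbound⟩ := hspark.exists_bounds
  refine ⟨K, hK, fun Γ hΓ σ hσm hσ2 hσ => ?_⟩
  have hcard : Γ.card ≤ Fintype.card (Fin L) := by rwa [Fintype.card_fin]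
  have htime : ∀ p : ℝ × ℝ, p.1 ∉ Ico 0 (L * T) → σ p = 0 := fun p hp =>
    hσ p fun h => hp (mem_Ico_of_mem_region hT hL h).1
  have hfreq : ∀ p : ℝ × ℝ, p.2 ∉ Ico 0 (L * cellHeight T L) → σ p = 0 := fun p hp =>
    hσ p fun h => hp (mem_Ico_of_mem_region hT hL h).2
  have hcell := fun u hu η hη => hbound Γ hcard (cellVector T L σ u η) fun i hi =>
    cellVector_eq_zero hT hL hσ (u := u) (η := η) hu hη hi
  rw [lintegral_enorm_sq_trainResponse hT hL hc hσm hσ2 htime hfreq,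
    lintegral_enorm_sq_eq_cellVector hT hL hσm htime hfreq, mul_left_comm,
    ENNReal.ofReal_mul (cellHeight_pos hT hL).le, mul_assoc]
  constructor <;> gcongr <;>
    refine setLIntegral_setLIntegral_le_const_mul measurableSet_Ico measurableSet_Ico K
      fun u hu η hη => ?_
  · exact (hcell u hu η hη).1
  · exact (hcell u hu η hη).2

theorem ae_eq_indicator_of_mem_supportedOperators {M : Set (ℝ × ℝ)} {s : SpreadingFunction}
    (hs : s ∈ supportedOperators M) : s =ᵐ[volume] M.indicator s := by
  rw [supportedOperators, mem_ofPred_eq] at hs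
  filter_upwards [hs] with p hp
  by_cases hpM : p ∈ M
  · rw [indicator_of_mem hpM]
  · rw [indicator_of_notMem hpM, hp hpM]

theorem volume_region_ne_top (hT : 0 < T) (hL : 1 ≤ L) (Γ : Finset (Fin L × Fin L)) :
    volume (region T L Γ) ≠ ⊤ :=
  ((measure_biUnion_finset_le _ _).trans_lt
    (by simp [volume_cell hT hL, ENNReal.mul_lt_top])).ne

theorem exists_boundedResponses_diracTrain (hT : 0 < T) (hL : 1 ≤ L) {B : ℝ}
    (hB : ∀ k, ‖c k‖ ≤ B) (hc : Function.Periodic c (L : ℤ)) {x : 𝓢'(ℝ, ℂ)}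
    (hx : IsDiracTrain T c x) (hspark : IsFullSpark (gaborMatrix L (rootOfUnity L) c)) :
    ∃ α β : ℝ, 0 < α ∧ α ≤ β ∧ ∀ Γ : Finset (Fin L × Fin L), Γ.card ≤ L →
      BoundedResponses x α β (supportedOperators (region T L Γ)) := by
  obtain ⟨K, hK, hbound⟩ := exists_trainResponse_energy_bounds hT hL hc hspark
  have hl := cellHeight_pos hT hL
  refine ⟨√(cellHeight T L / K), √(cellHeight T L * K), by positivity, Real.sqrt_le_sqrt <|
    (div_le_self hl.le hK).trans (le_mul_of_one_le_right hl.le hK), fun Γ hΓ s hs => ?_⟩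
  have hΓm := measurableSet_region T L Γ
  have hsσ := ae_eq_indicator_of_mem_supportedOperators hs
  set σ := (region T L Γ).indicator s
  have hσm : StronglyMeasurable σ := (Lp.stronglyMeasurable s).indicator hΓm
  have hσ2 : MemLp σ 2 := (Lp.memLp s).indicator hΓm
  have hσ0 : ∀ p ∉ region T L Γ, σ p = 0 := fun p hp => indicator_of_notMem hp _
  have hσ1 := integrable_of_memLp_two_of_eq_zero hσ2 (volume_region_ne_top hT hL Γ) hσ0
  have htime : ∀ p : ℝ × ℝ, p.1 ∉ Ico 0 (L * T) → σ p = 0 := fun p hp =>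
    hσ0 p fun h => hp (mem_Ico_of_mem_region hT hL h).1
  obtain ⟨hlower, hupper⟩ := hbound Γ hΓ σ hσm hσ2 hσ0
  rw [lintegral_enorm_sq_of_ae_eq hsσ] at hlower hupper
  have hmem : MemLp (trainResponse T c σ) 2 := (memLp_two_iff_lintegral_lt_top
    (stronglyMeasurable_trainResponse hT c hσm htime).aestronglyMeasurable).2
      (hupper.trans_lt (ENNReal.mul_lt_top ENNReal.ofReal_lt_top ENNReal.ofReal_lt_top))
  have hy := hmem.coeFn_toLp
  set y : OutputSignal := hmem.toLp _
  have hK0 : 0 < K := one_pos.trans_le hK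
  rw [lintegral_enorm_sq_of_ae_eq hy, ← ENNReal.ofReal_mul (by positivity),
    ENNReal.ofReal_le_ofReal_iff (by positivity)] at hupper
  rw [lintegral_enorm_sq_of_ae_eq hy, ← ENNReal.ofReal_mul (by positivity),
    ← ENNReal.ofReal_mul (by positivity), ENNReal.ofReal_le_ofReal_iff (by positivity)] at hlower
  refine ⟨y, isResponse_of_ae_eq_trainResponse hT hB hx hsσ hσ1 htime hy, ?_, ?_⟩
  · refine le_of_sq_le_sq ?_ (norm_nonneg _)
    rw [mul_pow, Real.sq_sqrt (by positivity), div_mul_eq_mul_div, div_le_iff₀ hK0]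
    linarith
  · refine le_of_sq_le_sq ?_ (by positivity)
    rwa [mul_pow, Real.sq_sqrt (by positivity)]

theorem exists_norm_le_of_periodic (hL : 1 ≤ L) (hc : Function.Periodic c (L : ℤ)) :
    ∃ B, ∀ k, ‖c k‖ ≤ B := by
  refine ⟨∑ q ∈ Finset.Ico (0 : ℤ) L, ‖c q‖, fun k => ?_⟩
  obtain ⟨q, hq, hkq⟩ := hc.exists_mem_Ico₀ (by exact_mod_cast hL) k
  rw [hkq]
  exact Finset.single_le_sum (f := fun q => ‖c q‖) (fun _ _ => norm_nonneg _) (Finset.mem_Ico.2 hq)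

theorem exists_diracTrain_stablyIdentifies (hT : 0 < T) (hL : 1 ≤ L) {Δ : ℝ} (hΔ : Δ ≤ 1 / 2) :
    ∃ (c : ℤ → ℂ) (x : 𝓢'(ℝ, ℂ)), (∀ k : ℤ, c (k + L) = c k) ∧
      IsDiracTrain T c x ∧ StablyIdentifies x (blindOperators T L Δ) := by
  obtain ⟨c, hc, hspark⟩ := exists_isFullSpark_gaborMatrix hL
    (Complex.isPrimitiveRoot_exp L (by omega) : IsPrimitiveRoot (rootOfUnity L) L)
  obtain ⟨B, hB⟩ := exists_norm_le_of_periodic hL hc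
  obtain ⟨x, hx⟩ := exists_isDiracTrain hT hB
  obtain ⟨α, β, hα, hαβ, hbound⟩ := exists_boundedResponses_diracTrain hT hL hB hc hx hspark
  exact ⟨c, x, hc, hx, stablyIdentifies_blindOperators hT hL hΔ hα hαβ hbound⟩

end TrainResponse

/-! ### Time-frequency shifts of responses -/

section Shift

variable {x : 𝓢'(ℝ, ℂ)} {s s' : SpreadingFunction} {y y' : OutputSignal}

theorem IsResponse.shift_frequency (h : ℝ) (hr : IsResponse s x y)
    (hs : s' =ᵐ[volume] fun p => s (p - (0, h))) (hy : y' =ᵐ[volume] fun t => modChar h t * y t) :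
    IsResponse s' x y' := by
  intro φ
  set φ' : 𝓢(ℝ, ℂ) := SchwartzMap.smulLeftCLM ℂ (modChar h) φ
  have hφ' : ∀ t, φ' t = modChar h t * φ t := fun t => by
    simp [φ', SchwartzMap.smulLeftCLM_apply_apply (modChar_hasTemperateGrowth h)]
  set K : ℝ × ℝ → ℂ := fun p => (modulation p.2 (translation p.1 x)) φ with hK
  have hKs : ∀ p : ℝ × ℝ, K (p + (0, h)) = (modulation p.2 (translation p.1 x)) φ' := by
    intro p
    rw [hK, modulation_translation_apply]
    simp only [modulation_translation_apply]
    congr 1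
    ext t
    simp only [shiftedTest_apply, hφ', Prod.fst_add, Prod.snd_add, add_zero, modChar_add_left]
    ring
  have hspread : (fun p => s' p * K p) =ᵐ[volume]
      fun p => (fun q => s q * K (q + (0, h))) (p - (0, h)) := by
    filter_upwards [hs] with p hp
    simp only [hp, sub_add_cancel]
  have hout : (fun t => y' t * φ t) =ᵐ[volume] fun t => y t * φ' t := by
    filter_upwards [hy] with t ht
    rw [ht, hφ']
    ring
  obtain ⟨hint, heq⟩ := hr φ'
  simp only [← hKs] at hint heq
  refine ⟨(hint.comp_sub_right (0, h)).congr hspread.symm, ?_⟩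
  rw [integral_congr_ae hspread, integral_congr_ae hout, ← heq]
  exact integral_sub_right_eq_self (fun q => s q * K (q + (0, h))) (0, h)

theorem IsResponse.shift_time (h : ℝ) (hr : IsResponse s x y)
    (hs : s' =ᵐ[volume] fun p => modChar (-h) p.2 * s (p - (h, 0)))
    (hy : y' =ᵐ[volume] fun t => y (t - h)) :
    IsResponse s' x y' := by
  intro φ
  set φ' : 𝓢(ℝ, ℂ) := SchwartzMap.compSubConstCLM ℂ (-h) φ
  have hφ' : ∀ t, φ' t = φ (t + h) := fun t => by simp [φ']
  set K : ℝ × ℝ → ℂ := fun p => (modulation p.2 (translation p.1 x)) φ with hK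
  have hKs : ∀ p : ℝ × ℝ, modChar (-h) p.2 * K (p + (h, 0)) =
      (modulation p.2 (translation p.1 x)) φ' := by
    intro p
    rw [hK, modulation_translation_apply]
    simp only [modulation_translation_apply]
    rw [← smul_eq_mul, ← map_smul]
    congr 1
    ext t
    simp only [shiftedTest_apply, hφ', Prod.fst_add, Prod.snd_add, add_zero, smul_apply,
      smul_eq_mul]
    rw [← add_assoc, modChar_add_right p.2 (t + p.1) h, modChar_comm p.2 h]
    linear_combination (modChar p.2 (t + p.1) * φ (t + p.1 + h)) * modChar_neg_mul_self h p.2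
  have hspread : (fun p => s' p * K p) =ᵐ[volume]
      fun p => (fun q : ℝ × ℝ => s q * (modChar (-h) q.2 * K (q + (h, 0)))) (p - (h, 0)) := by
    filter_upwards [hs] with p hp
    simp only [hp, sub_add_cancel, Prod.snd_sub, sub_zero]
    ring
  have hout : (fun t => y' t * φ t) =ᵐ[volume] fun t => (fun u => y u * φ' u) (t - h) := by
    filter_upwards [hy] with t ht
    simp only [ht, hφ', sub_add_cancel]
  obtain ⟨hint, heq⟩ := hr φ'
  simp only [← hKs] at hint heq
  refine ⟨(hint.comp_sub_right (h, 0)).congr hspread.symm, ?_⟩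
  rw [integral_congr_ae hspread, integral_congr_ae hout,
    integral_sub_right_eq_self (fun u => y u * φ' u) h, ← heq]
  exact integral_sub_right_eq_self
    (fun q : ℝ × ℝ => s q * (modChar (-h) q.2 * K (q + (h, 0)))) (h, 0)

end Shift

section ModChar

theorem modChar_eq_exp (ν t : ℝ) :
    modChar ν t = Complex.exp (Complex.I * (2 * Real.pi * (ν * t) : ℝ)) := by
  rw [modChar]
  push_cast
  ring_nf

theorem norm_modChar_sub_one_le (ν t : ℝ) : ‖modChar ν t - 1‖ ≤ 2 * Real.pi * |ν * t| := by
  rw [modChar_eq_exp]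
  refine Real.norm_exp_I_mul_ofReal_sub_one_le.trans_eq ?_
  rw [Real.norm_eq_abs, abs_mul, abs_of_pos Real.two_pi_pos]

theorem le_norm_modChar_sub_one {ν t : ℝ} (h : |ν * t| ≤ 1 / 2) :
    4 * |ν * t| ≤ ‖modChar ν t - 1‖ := by
  rw [modChar_eq_exp, Complex.norm_exp_I_mul_ofReal_sub_one, Real.norm_eq_abs, abs_mul 2, abs_two]
  have hsin := Real.mul_abs_le_abs_sin (x := Real.pi * (ν * t)) (by
    rw [abs_mul, abs_of_pos Real.pi_pos]
    nlinarith [Real.pi_pos])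
  have hjordan : 2 / Real.pi * |Real.pi * (ν * t)| = 2 * |ν * t| := by
    rw [abs_mul, abs_of_pos Real.pi_pos]
    field_simp
  rw [show 2 * Real.pi * (ν * t) / 2 = Real.pi * (ν * t) by ring]
  linarith

end ModChar

/-! ### Time-frequency atoms -/

/-- `ψ` is a Lipschitz bump function that vanishes outside `[a + δ, b - δ]` and is `1` on
`[a + 2δ, b - 2δ]`. The margin `δ` leaves room for translations by less than `δ`. -/
structure IsBump (ψ : ℝ → ℝ) (a b δ : ℝ) : Prop where
  nonneg : ∀ t, 0 ≤ ψ t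
  le_one : ∀ t, ψ t ≤ 1
  eq_zero : ∀ t ∉ Icc (a + δ) (b - δ), ψ t = 0
  eq_one : ∀ t ∈ Icc (a + 2 * δ) (b - 2 * δ), ψ t = 1
  lipschitz : ∀ t u, |ψ t - ψ u| ≤ |t - u| / δ

theorem abs_clamp_sub_clamp_le (p q : ℝ) : |max 0 (min 1 p) - max 0 (min 1 q)| ≤ |p - q| :=
  (abs_max_sub_max_le_max _ _ _ _).trans <| max_le (by simp) <|
    (abs_min_sub_min_le_max _ _ _ _).trans <| max_le (by simp) le_rfl

theorem exists_isBump (a b : ℝ) {δ : ℝ} (hδ : 0 < δ) : ∃ ψ, IsBump ψ a b δ := by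
  refine ⟨fun t => max 0 (min 1 (min (t - a - δ) (b - δ - t) / δ)), fun t => le_max_left _ _,
    fun t => max_le zero_le_one (min_le_left _ _), fun t ht => max_eq_left ?_, fun t ht => ?_,
    fun t u => (abs_clamp_sub_clamp_le _ _).trans ?_⟩
  · refine (min_le_right _ _).trans (div_nonpos_of_nonpos_of_nonneg ?_ hδ.le)
    by_contra! hpos
    rw [lt_min_iff] at hpos
    exact ht ⟨by linarith [hpos.1], by linarith [hpos.2]⟩
  · have hone : 1 ≤ min (t - a - δ) (b - δ - t) / δ := by
      rw [le_div_iff₀ hδ, one_mul, le_min_iff]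
      exact ⟨by linarith [ht.1], by linarith [ht.2]⟩
    rw [min_eq_left hone]
    exact max_eq_right zero_le_one
  · rw [← sub_div, abs_div, abs_of_pos hδ]
    refine div_le_div_of_nonneg_right ?_ hδ.le
    refine (abs_min_sub_min_le_max _ _ _ _).trans (max_le (le_of_eq ?_) (le_of_eq ?_))
    · congr 1
      ring
    · rw [abs_sub_comm]
      congr 1
      ring

theorem IsBump.continuous {ψ : ℝ → ℝ} {a b δ : ℝ} (h : IsBump ψ a b δ) (hδ : 0 < δ) :
    Continuous ψ := by
  refine (LipschitzWith.of_dist_le_mul (K := (1 / δ).toNNReal) fun t u => ?_).continuous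
  rw [Real.coe_toNNReal _ (by positivity), Real.dist_eq, Real.dist_eq]
  exact (h.lipschitz t u).trans_eq (by ring)

theorem IsBump.norm_le_one {ψ : ℝ → ℝ} {a b δ : ℝ} (h : IsBump ψ a b δ) (t : ℝ) :
    ‖(ψ t : ℂ)‖ ≤ 1 := by
  rw [Complex.norm_real, Real.norm_of_nonneg (h.nonneg t)]
  exact h.le_one t

theorem IsBump.norm_sub_le {ψ : ℝ → ℝ} {a b δ : ℝ} (hψ : IsBump ψ a b δ) (t : ℝ) {h : ℝ}
    (hh : 0 < h) : ‖((ψ (t - h) - ψ t : ℝ) : ℂ)‖ ≤ h / δ := by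
  rw [Complex.norm_real, Real.norm_eq_abs]
  simpa only [sub_sub_cancel_left, abs_neg, abs_of_pos hh] using hψ.lipschitz (t - h) t

/-- The time-frequency atom `ψ₁(τ) ψ₂(ν) e^{2πi(bτ - aν)}`: the response of an operator with this
spreading function is concentrated near time `a` and frequency `b`. -/
def atom (ψ₁ ψ₂ : ℝ → ℝ) (a b : ℝ) (p : ℝ × ℝ) : ℂ :=
  ψ₁ p.1 * ψ₂ p.2 * (modChar b p.1 * modChar (-a) p.2)

section Atom

variable {ψ₁ ψ₂ : ℝ → ℝ} {a₁ b₁ δ₁ a₂ b₂ δ₂ : ℝ}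

theorem continuous_atom (h₁ : Continuous ψ₁) (h₂ : Continuous ψ₂) (a b : ℝ) :
    Continuous (atom ψ₁ ψ₂ a b) := by
  have hb : Continuous fun p : ℝ × ℝ => modChar b p.1 :=
    continuous_modChar.comp (by fun_prop : Continuous fun p : ℝ × ℝ => (b, p.1))
  have ha : Continuous fun p : ℝ × ℝ => modChar (-a) p.2 :=
    continuous_modChar.comp (by fun_prop : Continuous fun p : ℝ × ℝ => (-a, p.2))
  unfold atom
  fun_prop

theorem atom_eq_zero (h₁ : IsBump ψ₁ a₁ b₁ δ₁) (h₂ : IsBump ψ₂ a₂ b₂ δ₂) (a b : ℝ) {p : ℝ × ℝ}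
    (hp : p ∉ Icc (a₁ + δ₁) (b₁ - δ₁) ×ˢ Icc (a₂ + δ₂) (b₂ - δ₂)) : atom ψ₁ ψ₂ a b p = 0 := by
  rw [mem_prod, not_and_or] at hp
  rcases hp with hp | hp
  · simp [atom, h₁.eq_zero _ hp]
  · simp [atom, h₂.eq_zero _ hp]

theorem atom_sub_eq_zero (h₁ : IsBump ψ₁ a₁ b₁ δ₁) (h₂ : IsBump ψ₂ a₂ b₂ δ₂) (a b : ℝ)
    {p q : ℝ × ℝ} (hp : p ∉ Ico a₁ b₁ ×ˢ Ico a₂ b₂) (hq₁ : |q.1| < δ₁) (hq₂ : |q.2| < δ₂) :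
    atom ψ₁ ψ₂ a b (p - q) = 0 := by
  refine atom_eq_zero h₁ h₂ a b fun hpq => hp ?_
  rw [mem_prod, mem_Icc, mem_Icc, Prod.fst_sub, Prod.snd_sub] at hpq
  rw [abs_lt] at hq₁ hq₂
  rw [mem_prod, mem_Ico, mem_Ico]
  refine ⟨⟨?_, ?_⟩, ⟨?_, ?_⟩⟩ <;> linarith [hpq.1.1, hpq.1.2, hpq.2.1, hpq.2.2]

theorem atom_eq_zero_of_notMem_Ico (h₁ : IsBump ψ₁ a₁ b₁ δ₁) (h₂ : IsBump ψ₂ a₂ b₂ δ₂)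
    (hδ₁ : 0 < δ₁) (hδ₂ : 0 < δ₂) (a b : ℝ) {p : ℝ × ℝ} (hp : p ∉ Ico a₁ b₁ ×ˢ Ico a₂ b₂) :
    atom ψ₁ ψ₂ a b p = 0 := by
  simpa using atom_sub_eq_zero h₁ h₂ a b (q := 0) hp (by simpa using hδ₁) (by simpa using hδ₂)

theorem memLp_atom (h₁ : IsBump ψ₁ a₁ b₁ δ₁) (h₂ : IsBump ψ₂ a₂ b₂ δ₂) (hδ₁ : 0 < δ₁)
    (hδ₂ : 0 < δ₂) (a b : ℝ) : MemLp (atom ψ₁ ψ₂ a b) 2 :=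
  (continuous_atom (h₁.continuous hδ₁) (h₂.continuous hδ₂) a b).memLp_of_hasCompactSupport
    (HasCompactSupport.intro (isCompact_Icc.prod isCompact_Icc) fun _ hp =>
      atom_eq_zero h₁ h₂ a b hp)

theorem norm_modChar_mul_modChar (ν t ν' t' : ℝ) : ‖modChar ν t * modChar ν' t'‖ = 1 := by
  rw [norm_mul, modChar_norm, modChar_norm, one_mul]

theorem norm_atom_le_one (h₁ : IsBump ψ₁ a₁ b₁ δ₁) (h₂ : IsBump ψ₂ a₂ b₂ δ₂) (a b : ℝ)
    (p : ℝ × ℝ) : ‖atom ψ₁ ψ₂ a b p‖ ≤ 1 := by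
  rw [atom, norm_mul, norm_mul, norm_modChar_mul_modChar, mul_one]
  exact mul_le_one₀ (h₁.norm_le_one _) (norm_nonneg _) (h₂.norm_le_one _)

theorem norm_atom_shift_frequency_sub_le (h₁ : IsBump ψ₁ a₁ b₁ δ₁) (h₂ : IsBump ψ₂ a₂ b₂ δ₂)
    (a b : ℝ) {h : ℝ} (hh : 0 < h) (p : ℝ × ℝ) :
    ‖modChar (-a) h * atom ψ₁ ψ₂ a b (p - (0, h)) - atom ψ₁ ψ₂ a b p‖ ≤ h / δ₂ := by
  have hchar : modChar (-a) p.2 = modChar (-a) (p.2 - h) * modChar (-a) h := by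
    rw [← modChar_add_right, sub_add_cancel]
  have hdiff : modChar (-a) h * atom ψ₁ ψ₂ a b (p - (0, h)) - atom ψ₁ ψ₂ a b p =
      ψ₁ p.1 * ((ψ₂ (p.2 - h) - ψ₂ p.2 : ℝ) : ℂ) * (modChar b p.1 * modChar (-a) p.2) := by
    simp only [atom, Prod.fst_sub, Prod.snd_sub, sub_zero, hchar]
    push_cast
    ring
  rw [hdiff, norm_mul, norm_modChar_mul_modChar, mul_one, norm_mul]
  exact (mul_le_mul (h₁.norm_le_one _) (h₂.norm_sub_le _ hh) (norm_nonneg _) zero_le_one).trans_eq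
    (one_mul _)

theorem IsBump.norm_mul_modChar_sub_one_le {ψ : ℝ → ℝ} {a b δ : ℝ} (hψ : IsBump ψ a b δ)
    (hδ : 0 < δ) (h t : ℝ) :
    ‖(ψ t : ℂ) * (modChar h t - 1)‖ ≤ 2 * Real.pi * (|a| + |b|) * |h| := by
  by_cases ht : t ∈ Icc (a + δ) (b - δ)
  · have htab : |t| ≤ |a| + |b| := by
      rw [abs_le]
      constructor
      · linarith [ht.1, neg_abs_le a, abs_nonneg b]
      · linarith [ht.2, le_abs_self b, abs_nonneg a]
    calc ‖(ψ t : ℂ) * (modChar h t - 1)‖ = ‖(ψ t : ℂ)‖ * ‖modChar h t - 1‖ := norm_mul _ _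
      _ ≤ 1 * (2 * Real.pi * |h * t|) := mul_le_mul (hψ.norm_le_one _)
          (norm_modChar_sub_one_le h t) (norm_nonneg _) zero_le_one
      _ = 2 * Real.pi * |t| * |h| := by rw [abs_mul]; ring
      _ ≤ _ := by gcongr
  · rw [hψ.eq_zero t ht, Complex.ofReal_zero, zero_mul, norm_zero]
    positivity

theorem norm_atom_shift_time_sub_le (h₁ : IsBump ψ₁ a₁ b₁ δ₁) (h₂ : IsBump ψ₂ a₂ b₂ δ₂)
    (hδ₁ : 0 < δ₁) (hδ₂ : 0 < δ₂) (a b : ℝ) {h : ℝ} (hh : 0 < h) (p : ℝ × ℝ) :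
    ‖modChar b h * (modChar (-h) p.2 * atom ψ₁ ψ₂ a b (p - (h, 0))) - atom ψ₁ ψ₂ a b p‖ ≤
      (1 / δ₁ + 2 * Real.pi * (|a₂| + |b₂|)) * h := by
  have hchar : modChar b p.1 = modChar b (p.1 - h) * modChar b h := by
    rw [← modChar_add_right, sub_add_cancel]
  have hdiff : modChar b h * (modChar (-h) p.2 * atom ψ₁ ψ₂ a b (p - (h, 0))) -
        atom ψ₁ ψ₂ a b p =
      (((ψ₁ (p.1 - h) - ψ₁ p.1 : ℝ) : ℂ) * (ψ₂ p.2 * modChar (-h) p.2) +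
        ψ₁ p.1 * (ψ₂ p.2 * (modChar (-h) p.2 - 1))) * (modChar b p.1 * modChar (-a) p.2) := by
    simp only [atom, Prod.fst_sub, Prod.snd_sub, sub_zero, hchar]
    push_cast
    ring
  have henvelope : ‖((ψ₁ (p.1 - h) - ψ₁ p.1 : ℝ) : ℂ) * (ψ₂ p.2 * modChar (-h) p.2)‖ ≤
      h / δ₁ * 1 := by
    rw [norm_mul, norm_mul, modChar_norm, mul_one]
    exact mul_le_mul (h₁.norm_sub_le _ hh) (h₂.norm_le_one _) (norm_nonneg _) (by positivity)
  have hphase : ‖(ψ₁ p.1 : ℂ) * (ψ₂ p.2 * (modChar (-h) p.2 - 1))‖ ≤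
      1 * (2 * Real.pi * (|a₂| + |b₂|) * |(-h)|) := by
    rw [norm_mul]
    exact mul_le_mul (h₁.norm_le_one _) (h₂.norm_mul_modChar_sub_one_le hδ₂ _ _) (norm_nonneg _)
      zero_le_one
  rw [hdiff, norm_mul, norm_modChar_mul_modChar, mul_one]
  refine (norm_add_le _ _).trans ((add_le_add henvelope hphase).trans_eq ?_)
  rw [abs_neg, abs_of_pos hh]
  ring

end Atom

/-! ### Localization of responses -/

/-- The signal `y` is localized near the point `(a, b)` of the time-frequency plane. Decay away
from `a` and `b` is encoded by differences: modulating about `a`, or translating and compensating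
the phase of the frequency `b`, by a small `h` moves `y` by at most `C * h`. -/
structure IsLocalized (C h₀ a b : ℝ) (y : OutputSignal) : Prop where
  norm_le : ‖y‖ ≤ C
  time : ∀ h, 0 < h → h < h₀ →
    ∫⁻ t, ‖modChar h (t - a) * y t - y t‖ₑ ^ 2 ≤ ENNReal.ofReal ((C * h) ^ 2)
  frequency : ∀ h, 0 < h → h < h₀ →
    ∫⁻ t, ‖modChar b h * y (t - h) - y t‖ₑ ^ 2 ≤ ENNReal.ofReal ((C * h) ^ 2)

section Localization

variable {x : 𝓢'(ℝ, ℂ)} {s : SpreadingFunction} {y : OutputSignal} {α β c h : ℝ}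
  {N : Set (ℝ × ℝ)} {f : ℝ × ℝ → ℂ}

theorem lintegral_enorm_sq_le_of_ae_eq {g : ℝ → ℂ} (hg : y =ᵐ[volume] g) (hc : ‖y‖ ≤ c) :
    ∫⁻ t, ‖g t‖ₑ ^ 2 ≤ ENNReal.ofReal (c ^ 2) := by
  rw [lintegral_enorm_sq_of_ae_eq hg]
  exact ENNReal.ofReal_le_ofReal (pow_le_pow_left₀ (norm_nonneg _) hc 2)

theorem norm_le_of_ae_norm_le_indicator (hN : MeasurableSet N) (hN' : volume N ≠ ⊤) (hc : 0 ≤ c)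
    (hs : ∀ᵐ p, ‖s p‖ ≤ N.indicator (fun _ => c) p) :
    ‖s‖ ≤ c * volume.real N ^ (1 / 2 : ℝ) := by
  have hconst : ‖indicatorConstLp 2 hN hN' c‖ = c * volume.real N ^ (1 / 2 : ℝ) := by
    rw [norm_indicatorConstLp two_ne_zero ENNReal.ofNat_ne_top, Real.norm_of_nonneg hc,
      ENNReal.toReal_ofNat]
  rw [← hconst]
  refine Lp.norm_le_norm_of_ae_le ?_
  filter_upwards [hs, indicatorConstLp_coeFn (p := 2) (hs := hN) (hμs := hN') (c := c)]
    with p hp hpc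
  rw [hpc]
  exact hp.trans (le_abs_self _)

theorem BoundedResponses.norm_response_le (hβ : 0 ≤ β) (hN : MeasurableSet N)
    (hN' : volume N ≠ ⊤) (hbd : BoundedResponses x α β (supportedOperators N))
    (hr : IsResponse s x y) (hc : 0 ≤ c) (hs : ∀ᵐ p, ‖s p‖ ≤ N.indicator (fun _ => c) p) :
    ‖y‖ ≤ β * (c * volume.real N ^ (1 / 2 : ℝ)) := by
  obtain ⟨z, hz, -, hzβ⟩ := hbd s (by
    rw [supportedOperators, mem_ofPred_eq]
    filter_upwards [hs] with p hp hpN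
    rwa [indicator_of_notMem hpN, norm_le_zero_iff] at hp)
  rw [hr.unique hz]
  exact hzβ.trans (mul_le_mul_of_nonneg_left (norm_le_of_ae_norm_le_indicator hN hN' hc hs) hβ)

theorem BoundedResponses.lintegral_modulated_sub_le (hβ : 0 ≤ β) (hN : MeasurableSet N)
    (hN' : volume N ≠ ⊤) (hbd : BoundedResponses x α β (supportedOperators N))
    (hr : IsResponse s x y) (hs : s =ᵐ[volume] f) (a : ℝ) (hc : 0 ≤ c)
    (hf : ∀ p, ‖modChar (-a) h * f (p - (0, h)) - f p‖ ≤ N.indicator (fun _ => c) p) :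
    ∫⁻ t, ‖modChar h (t - a) * y t - y t‖ₑ ^ 2 ≤
      ENNReal.ofReal ((β * (c * volume.real N ^ (1 / 2 : ℝ))) ^ 2) := by
  have hshift := measurePreserving_sub_right (volume : Measure (ℝ × ℝ)) (0, h)
  have hs0 : MemLp (fun p => s (p - (0, h))) 2 := (Lp.memLp s).comp_measurePreserving hshift
  have hy0 : MemLp (fun t => modChar h t * y t) 2 := by
    simpa only [modChar_comm] using memLp_modChar_mul (Lp.memLp y) h
  have hr' := (hr.shift_frequency h hs0.coeFn_toLp hy0.coeFn_toLp).const_smul (modChar (-a) h)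
  refine lintegral_enorm_sq_le_of_ae_eq ?_ (hbd.norm_response_le hβ hN hN' (hr'.sub hr) hc ?_)
  · filter_upwards [Lp.coeFn_sub (modChar (-a) h • hy0.toLp _) y,
      Lp.coeFn_smul (modChar (-a) h) (hy0.toLp _), hy0.coeFn_toLp] with t hsub hsmul ht
    rw [hsub, Pi.sub_apply, hsmul, Pi.smul_apply, ht, smul_eq_mul, ← mul_assoc, sub_eq_add_neg t,
      modChar_add_right, modChar_comm h (-a), mul_comm (modChar h t)]
  · filter_upwards [Lp.coeFn_sub (modChar (-a) h • hs0.toLp _) s,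
      Lp.coeFn_smul (modChar (-a) h) (hs0.toLp _), hs0.coeFn_toLp, hs,
      hshift.quasiMeasurePreserving.ae hs] with p hsub hsmul hp hsp hsp'
    rw [hsub, Pi.sub_apply, hsmul, Pi.smul_apply, hp, hsp, hsp', smul_eq_mul]
    exact hf p

theorem BoundedResponses.lintegral_translated_sub_le (hβ : 0 ≤ β) (hN : MeasurableSet N)
    (hN' : volume N ≠ ⊤) (hbd : BoundedResponses x α β (supportedOperators N))
    (hr : IsResponse s x y) (hs : s =ᵐ[volume] f) (b : ℝ) (hc : 0 ≤ c)
    (hf : ∀ p, ‖modChar b h * (modChar (-h) p.2 * f (p - (h, 0))) - f p‖ ≤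
      N.indicator (fun _ => c) p) :
    ∫⁻ t, ‖modChar b h * y (t - h) - y t‖ₑ ^ 2 ≤
      ENNReal.ofReal ((β * (c * volume.real N ^ (1 / 2 : ℝ))) ^ 2) := by
  have hshift := measurePreserving_sub_right (volume : Measure (ℝ × ℝ)) (h, 0)
  have hs0 : MemLp (fun p : ℝ × ℝ => modChar (-h) p.2 * s (p - (h, 0))) 2 := by
    have hmem : MemLp (fun p => s (p - (h, 0))) 2 := (Lp.memLp s).comp_measurePreserving hshift
    refine hmem.of_le (AEStronglyMeasurable.mul ?_ hmem.1) (.of_forall fun p => ?_)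
    · exact (continuous_modChar.comp
        (by fun_prop : Continuous fun p : ℝ × ℝ => (-h, p.2))).aestronglyMeasurable
    · rw [norm_mul, modChar_norm, one_mul]
  have hy0 : MemLp (fun t => y (t - h)) 2 :=
    (Lp.memLp y).comp_measurePreserving (measurePreserving_sub_right volume h)
  have hr' := (hr.shift_time h hs0.coeFn_toLp hy0.coeFn_toLp).const_smul (modChar b h)
  refine lintegral_enorm_sq_le_of_ae_eq ?_ (hbd.norm_response_le hβ hN hN' (hr'.sub hr) hc ?_)
  · filter_upwards [Lp.coeFn_sub (modChar b h • hy0.toLp _) y,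
      Lp.coeFn_smul (modChar b h) (hy0.toLp _), hy0.coeFn_toLp] with t hsub hsmul ht
    rw [hsub, Pi.sub_apply, hsmul, Pi.smul_apply, ht, smul_eq_mul]
  · filter_upwards [Lp.coeFn_sub (modChar b h • hs0.toLp _) s,
      Lp.coeFn_smul (modChar b h) (hs0.toLp _), hs0.coeFn_toLp, hs,
      hshift.quasiMeasurePreserving.ae hs] with p hsub hsmul hp hsp hsp'
    rw [hsub, Pi.sub_apply, hsmul, Pi.smul_apply, hp, hsp, hsp', smul_eq_mul]
    exact hf p

theorem exists_isLocalized_of_atom {ψ₁ ψ₂ : ℝ → ℝ} {a₁ b₁ δ₁ a₂ b₂ δ₂ : ℝ} (hβ : 0 ≤ β)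
    (hbd : BoundedResponses x α β (supportedOperators (Ico a₁ b₁ ×ˢ Ico a₂ b₂)))
    (h₁ : IsBump ψ₁ a₁ b₁ δ₁) (h₂ : IsBump ψ₂ a₂ b₂ δ₂) (hδ₁ : 0 < δ₁) (hδ₂ : 0 < δ₂) :
    ∃ C h₀ : ℝ, 0 < h₀ ∧ ∀ (a b : ℝ) (s : SpreadingFunction) (y : OutputSignal),
      s =ᵐ[volume] atom ψ₁ ψ₂ a b → IsResponse s x y → IsLocalized C h₀ a b y := by
  set N : Set (ℝ × ℝ) := Ico a₁ b₁ ×ˢ Ico a₂ b₂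
  have hN : MeasurableSet N := measurableSet_Ico.prod measurableSet_Ico
  have hN' : volume N ≠ ⊤ := (Metric.isBounded_Ico _ _ |>.prod (Metric.isBounded_Ico _ _)
    |>.measure_lt_top).ne
  set D : ℝ := 2 * Real.pi * (|a₂| + |b₂|)
  set c : ℝ := 1 + 1 / δ₁ + 1 / δ₂ + D
  have hδ₁' : 0 < 1 / δ₁ := by positivity
  have hδ₂' : 0 < 1 / δ₂ := by positivity
  have hD : 0 ≤ D := by positivity
  refine ⟨β * (c * volume.real N ^ (1 / 2 : ℝ)), min δ₁ δ₂, lt_min hδ₁ hδ₂,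
    fun a b s y hs hr => ⟨?_, fun h hh hh₀ => ?_, fun h hh hh₀ => ?_⟩⟩
  all_goals have hzero := fun p hp => atom_eq_zero_of_notMem_Ico h₁ h₂ hδ₁ hδ₂ a b (p := p) hp
  · refine hbd.norm_response_le hβ hN hN' hr (by positivity) ?_
    filter_upwards [hs] with p hp
    rw [hp]
    exact le_indicator_apply (fun _ => (norm_atom_le_one h₁ h₂ a b p).trans (by linarith))
      fun hpN => by simp [hzero p hpN]
  · rw [mul_assoc β, mul_right_comm]
    refine hbd.lintegral_modulated_sub_le hβ hN hN' hr hs a (by positivity) fun p =>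
      le_indicator_apply (fun _ => ?_) fun hpN => Eq.le ?_
    · refine (norm_atom_shift_frequency_sub_le h₁ h₂ a b hh p).trans ?_
      rw [div_eq_mul_one_div, mul_comm]
      gcongr
      linarith
    · rw [hzero p hpN, atom_sub_eq_zero h₁ h₂ a b hpN (by simpa using hδ₁)
        (by simpa [abs_of_pos hh] using (lt_min_iff.1 hh₀).2), mul_zero, sub_zero, norm_zero]
  · rw [mul_assoc β, mul_right_comm]
    refine hbd.lintegral_translated_sub_le hβ hN hN' hr hs b (by positivity) fun p =>
      le_indicator_apply (fun _ => ?_) fun hpN => Eq.le ?_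
    · refine (norm_atom_shift_time_sub_le h₁ h₂ hδ₁ hδ₂ a b hh p).trans ?_
      gcongr
      linarith
    · rw [hzero p hpN, atom_sub_eq_zero h₁ h₂ a b hpN
        (by simpa [abs_of_pos hh] using (lt_min_iff.1 hh₀).1) (by simpa using hδ₂), mul_zero,
        mul_zero, sub_zero, norm_zero]

end Localization

/-! ### Exponentials on an interval -/

section Exponential

variable {P : ℝ} {z : OutputSignal}

theorem integral_modChar_period (hP : 0 < P) (a : ℝ) (k : ℤ) :
    ∫ t in Ico a (a + P), modChar (k / P) t = if k = 0 then (P : ℂ) else 0 := by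
  rw [restrict_Ico_eq_restrict_Ioc, ← intervalIntegral.integral_of_le (by linarith)]
  split_ifs with hk
  · simp [hk]
  · have hP' : (P : ℂ) ≠ 0 := by exact_mod_cast hP.ne'
    have hfreq : 2 * (Real.pi : ℂ) * Complex.I * ((k / P : ℝ) : ℂ) ≠ 0 := by
      simp [Real.pi_ne_zero, hk, hP']
    have hperiod : modChar (k / P) (a + P) = modChar (k / P) a := by
      have hone : modChar (k / P) P = 1 := by
        rw [← Complex.exp_int_mul_two_pi_mul_I k, modChar]
        congr 1
        push_cast
        field_simp
      rw [modChar_add_right, hone, mul_one]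
    simp only [modChar] at hperiod ⊢
    rw [integral_exp_mul_complex hfreq, hperiod, sub_self, zero_div]

theorem memLp_exponential (P : ℝ) (n : ℤ) :
    MemLp ((Ico 0 P).indicator fun t => modChar (n / P) t) 2 := by
  rw [memLp_indicator_iff_restrict measurableSet_Ico]
  refine MemLp.of_bound ?_ 1 (Filter.Eventually.of_forall fun t => (modChar_norm _ _).le)
  exact (continuous_modChar.comp (by fun_prop : Continuous fun t : ℝ =>
    (n / P, t))).aestronglyMeasurable

/-- The normalized exponential of frequency `n / P` on the interval `[0, P)`. -/
def exponential (P : ℝ) (n : ℤ) : OutputSignal :=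
  (((Real.sqrt P)⁻¹ : ℝ) : ℂ) • (memLp_exponential P n).toLp _

theorem coeFn_exponential (P : ℝ) (n : ℤ) :
    exponential P n =ᵐ[volume] (Ico 0 P).indicator
      fun t => (((Real.sqrt P)⁻¹ : ℝ) : ℂ) * modChar (n / P) t := by
  filter_upwards [Lp.coeFn_smul (((Real.sqrt P)⁻¹ : ℝ) : ℂ) ((memLp_exponential P n).toLp _),
    (memLp_exponential P n).coeFn_toLp] with t hsmul ht
  rw [exponential, hsmul, Pi.smul_apply, ht, smul_eq_mul]
  by_cases h : t ∈ Ico 0 P <;> simp [h]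

theorem inner_exponential (P : ℝ) (n : ℤ) (z : OutputSignal) :
    inner ℂ (exponential P n) z =
      (((Real.sqrt P)⁻¹ : ℝ) : ℂ) * ∫ t in Ico 0 P, z t * modChar (-(n / P)) t := by
  rw [L2.inner_def, ← integral_indicator measurableSet_Ico, ← integral_const_mul]
  refine integral_congr_ae ?_
  filter_upwards [coeFn_exponential P n] with t ht
  rw [ht, RCLike.inner_apply]
  by_cases h : t ∈ Ico 0 P
  · rw [indicator_of_mem h, indicator_of_mem h, map_mul, conj_modChar, Complex.conj_ofReal]
    ring
  · simp [h]

theorem orthonormal_exponential (hP : 0 < P) : Orthonormal ℂ (exponential P) := by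
  rw [orthonormal_iff_ite]
  intro m n
  have hmul : ∫ t in Ico 0 P, exponential P n t * modChar (-(m / P)) t =
      ∫ t in Ico 0 P, (((Real.sqrt P)⁻¹ : ℝ) : ℂ) * modChar ((n - m : ℤ) / P) t := by
    refine setIntegral_congr_ae measurableSet_Ico ?_
    filter_upwards [coeFn_exponential P n] with t hn ht
    rw [hn, indicator_of_mem ht, mul_assoc, ← modChar_add_left]
    congr 2
    push_cast
    ring
  have hperiod := integral_modChar_period hP 0 (n - m)
  rw [zero_add] at hperiod
  rw [inner_exponential, hmul, integral_const_mul, hperiod]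
  by_cases hmn : m = n
  · rw [if_pos (by omega), if_pos hmn, ← mul_assoc]
    norm_cast
    rw [← mul_inv, Real.mul_self_sqrt hP.le, inv_mul_cancel₀ hP.ne']
  · rw [if_neg (by omega), if_neg hmn, mul_zero, mul_zero]

theorem norm_inner_exponential_sq (hP : 0 < P) (n : ℤ) (z : OutputSignal) :
    ‖inner ℂ (exponential P n) z‖ ^ 2 =
      P⁻¹ * ‖∫ t in Ico 0 P, z t * modChar t ((-n : ℤ) / P)‖ ^ 2 := by
  rw [inner_exponential, norm_mul, mul_pow, Complex.norm_real,
    Real.norm_of_nonneg (by positivity), inv_pow, Real.sq_sqrt hP.le]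
  simp only [modChar_comm (-(n / P)), Int.cast_neg, neg_div]

theorem hasSum_norm_inner_exponential_sq (hP : 0 < P)
    (hz : ∀ᵐ t, t ∉ Ico 0 P → z t = 0) :
    HasSum (fun n => ‖inner ℂ (exponential P n) z‖ ^ 2) (‖z‖ ^ 2) := by
  have henergy : ∫⁻ t in Ico 0 P, ‖z t‖ₑ ^ 2 = ENNReal.ofReal (‖z‖ ^ 2) := by
    rw [← lintegral_enorm_sq_eq, ← lintegral_indicator measurableSet_Ico]
    refine lintegral_congr_ae ?_
    filter_upwards [hz] with t ht
    by_cases h : t ∈ Ico 0 P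
    · rw [indicator_of_mem h]
    · simp [h, ht h]
  have hparseval := tsum_enorm_sq_integral_modChar hP ((Lp.memLp z).restrict (Ico 0 P))
  rw [henergy, ← ENNReal.ofReal_mul hP.le] at hparseval
  simp_rw [enorm_sq_eq_ofReal] at hparseval
  have hsum := (ENNReal.summable_toReal (hparseval ▸ ENNReal.ofReal_ne_top)).hasSum
  rw [← ENNReal.tsum_toReal_eq fun _ => ENNReal.ofReal_ne_top, hparseval] at hsum
  simp only [ENNReal.toReal_ofReal (sq_nonneg _)] at hsum
  rw [ENNReal.toReal_ofReal (by positivity)] at hsum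
  simpa only [norm_inner_exponential_sq hP, inv_mul_cancel_left₀ hP.ne', Function.comp_def,
    Equiv.neg_apply] using ((Equiv.neg ℤ).hasSum_iff.2 hsum).mul_left P⁻¹

theorem norm_sub_sum_inner_smul_sq {𝕜 H ι : Type*} [RCLike 𝕜] [NormedAddCommGroup H]
    [InnerProductSpace 𝕜 H] {e : ι → H} (he : Orthonormal 𝕜 e) (J : Finset ι) (z : H) :
    ‖z - ∑ n ∈ J, inner 𝕜 (e n) z • e n‖ ^ 2 = ‖z‖ ^ 2 - ∑ n ∈ J, ‖inner 𝕜 (e n) z‖ ^ 2 := by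
  have hcross : inner 𝕜 z (∑ n ∈ J, inner 𝕜 (e n) z • e n) =
      ((∑ n ∈ J, ‖inner 𝕜 (e n) z‖ ^ 2 : ℝ) : 𝕜) := by
    rw [inner_sum, RCLike.ofReal_sum]
    refine Finset.sum_congr rfl fun n _ => ?_
    rw [inner_smul_right, ← inner_conj_symm z, RCLike.mul_conj, RCLike.ofReal_pow]
  have hself : ‖∑ n ∈ J, inner 𝕜 (e n) z • e n‖ ^ 2 = ∑ n ∈ J, ‖inner 𝕜 (e n) z‖ ^ 2 := by
    rw [← inner_self_eq_norm_sq (𝕜 := 𝕜), he.inner_sum, map_sum]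
    refine Finset.sum_congr rfl fun n _ => ?_
    rw [RCLike.conj_mul, ← RCLike.ofReal_pow, RCLike.ofReal_re]
  rw [norm_sub_sq (𝕜 := 𝕜), hcross, hself, RCLike.ofReal_re]
  ring

theorem norm_sub_sum_inner_smul_sq_le {𝕜 H ι : Type*} [RCLike 𝕜] [NormedAddCommGroup H]
    [InnerProductSpace 𝕜 H] {e : ι → H} (he : Orthonormal 𝕜 e) {z : H}
    (hz : HasSum (fun n => ‖inner 𝕜 (e n) z‖ ^ 2) (‖z‖ ^ 2)) (J : Finset ι) {c : ℝ}
    (hc : ∀ F : Finset ι, Disjoint F J → ∑ n ∈ F, ‖inner 𝕜 (e n) z‖ ^ 2 ≤ c) :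
    ‖z - ∑ n ∈ J, inner 𝕜 (e n) z • e n‖ ^ 2 ≤ c := by
  classical
  rw [norm_sub_sum_inner_smul_sq he, sub_le_iff_le_add']
  refine hasSum_le_of_sum_le hz fun F => ?_
  rw [← Finset.sum_inter_add_sum_sdiff F J]
  exact add_le_add (Finset.sum_le_sum_of_subset_of_nonneg Finset.inter_subset_right
    fun _ _ _ => sq_nonneg _) (hc _ Finset.sdiff_disjoint)

theorem inner_exponential_of_ae_eq_zero (hz : ∀ᵐ t, t ∉ Ico 0 P → z t = 0) (n : ℤ) :
    inner ℂ (exponential P n) z =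
      (((Real.sqrt P)⁻¹ : ℝ) : ℂ) * ∫ t, z t * modChar (-(n / P)) t := by
  rw [inner_exponential, setIntegral_eq_integral_of_ae_compl_eq_zero]
  filter_upwards [hz] with t ht h
  rw [ht h, zero_mul]

theorem inner_exponential_translate {z' : OutputSignal} {h : ℝ}
    (hz' : z' =ᵐ[volume] fun t => z (t - h)) (hz0 : ∀ᵐ t, t ∉ Ico 0 P → z t = 0)
    (hz'0 : ∀ᵐ t, t ∉ Ico 0 P → z' t = 0) (n : ℤ) :
    inner ℂ (exponential P n) z' =
      modChar (-(n / P)) h * inner ℂ (exponential P n) z := by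
  rw [inner_exponential_of_ae_eq_zero hz0, inner_exponential_of_ae_eq_zero hz'0,
    mul_left_comm, ← integral_const_mul (modChar _ _),
    ← integral_sub_right_eq_self (fun t => modChar (-(n / P)) h * (z t * modChar (-(n / P)) t)) h]
  congr 1
  refine integral_congr_ae ?_
  filter_upwards [hz'] with t ht
  rw [ht, mul_left_comm, ← modChar_add_right, add_sub_cancel]

end Exponential

/-! ### Localized signals are close to few exponentials -/

theorem exists_pos_lt_forall_abs_mul_le {ι : Type*} (F : Finset ι) (ω : ι → ℝ) {m : ℝ}
    (hm : 0 < m) : ∃ h, 0 < h ∧ h < m ∧ ∀ i ∈ F, |ω i * h| ≤ 1 / 2 := by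
  set B : ℝ := 1 + ∑ i ∈ F, |ω i|
  have hB : 0 < B := by positivity
  have hpos : 0 < min (m / 2) (1 / (2 * B)) := by positivity
  refine ⟨_, hpos, (min_le_left _ _).trans_lt (half_lt_self hm), fun i hi => ?_⟩
  have hi' : |ω i| ≤ ∑ i ∈ F, |ω i| :=
    Finset.single_le_sum (f := fun i => |ω i|) (fun _ _ => abs_nonneg _) hi
  rw [abs_mul, abs_of_pos hpos]
  calc |ω i| * min (m / 2) (1 / (2 * B)) ≤ B * (1 / (2 * B)) :=
        mul_le_mul (by linarith) (min_le_right _ _) hpos.le hB.le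
    _ = 1 / 2 := by field_simp

theorem mul_norm_le_norm_modChar_sub_one_mul {R h ω : ℝ} (hh : 0 < h) (hR : R ≤ |ω|)
    (hω : |ω * h| ≤ 1 / 2) (u : ℂ) : 4 * R * h * ‖u‖ ≤ ‖(modChar ω h - 1) * u‖ := by
  rw [norm_mul]
  refine mul_le_mul_of_nonneg_right ?_ (norm_nonneg _)
  calc 4 * R * h = 4 * (R * h) := by ring
    _ ≤ 4 * |ω * h| := by
      rw [abs_mul, abs_of_pos hh]
      gcongr
    _ ≤ ‖modChar ω h - 1‖ := le_norm_modChar_sub_one hω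

-- For small `h` the signal `e^{2πibh} z(t - h) - z(t)` still lives on `[0, P)`, and its `n`-th
-- coefficient is that of `z` times `e^{2πi(b - n/P)h} - 1`; Bessel's inequality does the rest.
theorem sum_norm_inner_exponential_sq_le {z : OutputSignal} {P b C δ h₀ R : ℝ} (hP : 0 < P)
    (hδ : 0 < δ) (hh₀ : 0 < h₀) (hR : 0 < R) (hz : ∀ᵐ t, t ∉ Icc δ (P - δ) → z t = 0)
    (hb : ∀ h, 0 < h → h < h₀ →
      ∫⁻ t, ‖modChar b h * z (t - h) - z t‖ₑ ^ 2 ≤ ENNReal.ofReal ((C * h) ^ 2))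
    (F : Finset ℤ) (hF : ∀ n ∈ F, R ≤ |b - n / P|) :
    ∑ n ∈ F, ‖inner ℂ (exponential P n) z‖ ^ 2 ≤ (C / (4 * R)) ^ 2 := by
  obtain ⟨h, hpos, hlt, hhF⟩ :=
    exists_pos_lt_forall_abs_mul_le F (fun n : ℤ => b - n / P) (lt_min hh₀ hδ)
  have hhδ : h < δ := hlt.trans_le (min_le_right _ _)
  have hshift := measurePreserving_sub_right (volume : Measure ℝ) h
  have hz' := Lp.coeFn_compMeasurePreserving z hshift
  set z' : OutputSignal := Lp.compMeasurePreserving (· - h) hshift z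
  have hz0 : ∀ᵐ t, t ∉ Ico 0 P → z t = 0 := by
    filter_upwards [hz] with t ht h0
    exact ht fun hm => h0 ⟨by linarith [hm.1], by linarith [hm.2]⟩
  have hz'0 : ∀ᵐ t, t ∉ Ico 0 P → z' t = 0 := by
    filter_upwards [hz', hshift.quasiMeasurePreserving.ae hz] with t ht ht' h0
    rw [ht]
    exact ht' fun hm => h0 ⟨by linarith [hm.1], by linarith [hm.2]⟩
  have hcoeff : ∀ n : ℤ, inner ℂ (exponential P n) (modChar b h • z' - z) =
      (modChar (b - n / P) h - 1) * inner ℂ (exponential P n) z := fun n => by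
    rw [inner_sub_right, inner_smul_right, inner_exponential_translate hz' hz0 hz'0,
      sub_eq_add_neg b, modChar_add_left]
    ring
  have hnorm : ‖modChar b h • z' - z‖ ^ 2 ≤ (C * h) ^ 2 := by
    have hae : modChar b h • z' - z =ᵐ[volume] fun t => modChar b h * z (t - h) - z t := by
      filter_upwards [Lp.coeFn_sub (modChar b h • z') z, Lp.coeFn_smul (modChar b h) z', hz']
        with t hsub hsmul ht
      rw [hsub, Pi.sub_apply, hsmul, Pi.smul_apply, ht, smul_eq_mul, Function.comp_apply]
    rw [← ENNReal.ofReal_le_ofReal_iff (sq_nonneg _), ← lintegral_enorm_sq_of_ae_eq hae]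
    exact hb h hpos (hlt.trans_le (min_le_left _ _))
  have hle : (4 * R * h) ^ 2 * ∑ n ∈ F, ‖inner ℂ (exponential P n) z‖ ^ 2 ≤ (C * h) ^ 2 := by
    rw [Finset.mul_sum]
    refine (Finset.sum_le_sum fun n hn => ?_).trans
      (((orthonormal_exponential hP).sum_inner_products_le _ (s := F)).trans hnorm)
    rw [hcoeff, ← mul_pow]
    exact pow_le_pow_left₀ (by positivity)
      (mul_norm_le_norm_modChar_sub_one_mul hpos (hF n hn) (hhF n hn) _) 2
  calc _ ≤ (C * h) ^ 2 / (4 * R * h) ^ 2 := (le_div_iff₀' (by positivity)).2 hle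
    _ = (C / (4 * R)) ^ 2 := by rw [← div_pow, mul_div_mul_right _ _ hpos.ne']

section Localized

variable {C h₀ a b : ℝ} {y : OutputSignal}

theorem IsLocalized.nonneg (hy : IsLocalized C h₀ a b y) : 0 ≤ C :=
  (norm_nonneg _).trans hy.norm_le

theorem IsLocalized.setLIntegral_annulus_le (hy : IsLocalized C h₀ a b y) {R h : ℝ} (hR : 0 < R)
    (hh : 0 < h) (hlt : h < h₀) :
    ∫⁻ t in {t | R ≤ |t - a| ∧ |(t - a) * h| ≤ 1 / 2}, ‖y t‖ₑ ^ 2 ≤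
      ENNReal.ofReal ((C / (4 * R)) ^ 2) := by
  have hscaled : ENNReal.ofReal ((4 * R * h) ^ 2) *
      ∫⁻ t in {t | R ≤ |t - a| ∧ |(t - a) * h| ≤ 1 / 2}, ‖y t‖ₑ ^ 2 ≤
        ENNReal.ofReal ((C * h) ^ 2) := by
    have hmeas : MeasurableSet {t : ℝ | R ≤ |t - a| ∧ |(t - a) * h| ≤ 1 / 2} := by
      have hdist : Measurable fun t : ℝ => |t - a| := by fun_prop
      have hscale : Measurable fun t : ℝ => |(t - a) * h| := by fun_prop
      exact (measurableSet_le measurable_const hdist).inter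
        (measurableSet_le hscale measurable_const)
    refine le_trans ?_ (hy.time h hh hlt)
    rw [← lintegral_const_mul' _ _ ENNReal.ofReal_ne_top]
    refine (setLIntegral_mono' hmeas fun t ht => ?_).trans (setLIntegral_le_lintegral _ _)
    rw [enorm_sq_eq_ofReal, enorm_sq_eq_ofReal, ← ENNReal.ofReal_mul (by positivity), ← mul_pow,
      modChar_comm, ← sub_one_mul]
    exact ENNReal.ofReal_le_ofReal (pow_le_pow_left₀ (by positivity)
      (mul_norm_le_norm_modChar_sub_one_mul hh ht.1 ht.2 _) 2)
  have hfactor : (C * h) ^ 2 = (4 * R * h) ^ 2 * (C / (4 * R)) ^ 2 := by field_simp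
  rw [hfactor, ENNReal.ofReal_mul (by positivity)] at hscaled
  exact (ENNReal.mul_le_mul_iff_right (ENNReal.ofReal_pos.2 (by positivity)).ne'
    ENNReal.ofReal_ne_top).1 hscaled

theorem IsLocalized.setLIntegral_tail_le (hy : IsLocalized C h₀ a b y) (hh₀ : 0 < h₀) {R : ℝ}
    (hR : 0 < R) :
    ∫⁻ t in {t | R ≤ |t - a|}, ‖y t‖ₑ ^ 2 ≤ ENNReal.ofReal ((C / (4 * R)) ^ 2) := by
  set S : ℕ → Set ℝ := fun k => {t | R ≤ |t - a| ∧ |(t - a) * (h₀ / (k + 2))| ≤ 1 / 2}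
  have hunion : {t | R ≤ |t - a|} = ⋃ k, S k := by
    ext t
    simp only [S, mem_iUnion, mem_ofPred_eq, exists_and_left, iff_self_and]
    intro _
    obtain ⟨k, hk⟩ := exists_nat_ge (2 * (|t - a| * h₀))
    refine ⟨k, ?_⟩
    rw [abs_mul, abs_of_pos (by positivity : 0 < h₀ / (k + 2)), ← mul_div_assoc,
      div_le_iff₀ (by positivity)]
    linarith
  have hmono : Monotone S := fun k l hkl t ht => by
    refine ⟨ht.1, le_trans ?_ ht.2⟩
    rw [abs_mul, abs_mul, abs_of_pos (by positivity : 0 < h₀ / (k + 2)),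
      abs_of_pos (by positivity : 0 < h₀ / (l + 2))]
    gcongr
  rw [hunion, setLIntegral_iUnion_of_directed _ hmono.directed_le]
  refine iSup_le fun k => hy.setLIntegral_annulus_le hR (by positivity) (div_lt_self hh₀ ?_)
  linarith [(Nat.cast_nonneg k : (0 : ℝ) ≤ k)]

theorem enorm_add_sq_le {E : Type*} [SeminormedAddGroup E] (u v : E) :
    ‖u + v‖ₑ ^ 2 ≤ 2 * (‖u‖ₑ ^ 2 + ‖v‖ₑ ^ 2) := by
  rw [enorm_sq_eq_ofReal, enorm_sq_eq_ofReal, enorm_sq_eq_ofReal, ← ENNReal.ofReal_ofNat 2,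
    ← ENNReal.ofReal_add (by positivity) (by positivity), ← ENNReal.ofReal_mul zero_le_two]
  exact ENNReal.ofReal_le_ofReal ((pow_le_pow_left₀ (norm_nonneg _) (norm_add_le u v) 2).trans
    add_sq_le)

variable {p q R : ℝ} {χ : ℝ → ℝ} {z : OutputSignal}

theorem IsBump.memLp_mul (hχ : IsBump χ p q R) (hR : 0 < R) (y : OutputSignal) :
    MemLp (fun t => (χ t : ℂ) * y t) 2 := by
  refine (Lp.memLp y).of_le (AEStronglyMeasurable.mul ?_ (Lp.aestronglyMeasurable y))
    (Filter.Eventually.of_forall fun t => ?_)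
  · exact (Complex.continuous_ofReal.comp (hχ.continuous hR)).aestronglyMeasurable
  · rw [norm_mul]
    exact mul_le_of_le_one_left (norm_nonneg _) (hχ.norm_le_one t)

theorem IsBump.enorm_sq_translated_sub_le (hχ : IsBump χ p q R) (hR : 1 ≤ R) {h : ℝ} (hh : 0 < h)
    (u : ℂ) (t : ℝ) :
    ‖u * (χ (t - h) * y (t - h)) - χ t * y t‖ₑ ^ 2 ≤
      2 * (‖u * y (t - h) - y t‖ₑ ^ 2 + ENNReal.ofReal (h ^ 2) * ‖y t‖ₑ ^ 2) := by
  have hsplit : u * (χ (t - h) * y (t - h)) - χ t * y t =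
      χ (t - h) * (u * y (t - h) - y t) + ((χ (t - h) - χ t : ℝ) : ℂ) * y t := by
    push_cast
    ring
  rw [hsplit]
  refine (enorm_add_sq_le _ _).trans ?_
  gcongr
  · rw [enorm_mul, ← ofReal_norm]
    exact mul_le_of_le_one_left' (ENNReal.ofReal_le_one.2 (hχ.norm_le_one _))
  · rw [enorm_mul, mul_pow, enorm_sq_eq_ofReal (Complex.ofReal _)]
    gcongr
    exact (hχ.norm_sub_le t hh).trans (div_le_self hh.le hR)

theorem IsLocalized.lintegral_cutoff_le (hy : IsLocalized C h₀ a b y) (hR : 1 ≤ R)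
    (hχ : IsBump χ p q R) {h : ℝ} (hh : 0 < h) (hlt : h < h₀) :
    ∫⁻ t, ‖modChar b h * (χ (t - h) * y (t - h)) - χ t * y t‖ₑ ^ 2 ≤
      ENNReal.ofReal ((2 * C * h) ^ 2) := by
  have henergy : ∫⁻ t, ‖y t‖ₑ ^ 2 ≤ ENNReal.ofReal (C ^ 2) :=
    lintegral_enorm_sq_le_of_ae_eq Filter.EventuallyEq.rfl hy.norm_le
  calc _ ≤ ∫⁻ t, 2 * (‖modChar b h * y (t - h) - y t‖ₑ ^ 2 +
        ENNReal.ofReal (h ^ 2) * ‖y t‖ₑ ^ 2) :=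
        lintegral_mono fun t => hχ.enorm_sq_translated_sub_le hR hh _ t
    _ = 2 * ((∫⁻ t, ‖modChar b h * y (t - h) - y t‖ₑ ^ 2) +
        ENNReal.ofReal (h ^ 2) * ∫⁻ t, ‖y t‖ₑ ^ 2) := by
        rw [lintegral_const_mul' _ _ ENNReal.ofNat_ne_top, lintegral_add_right,
          lintegral_const_mul' _ _ ENNReal.ofReal_ne_top]
        exact ((Lp.stronglyMeasurable y).enorm.pow_const _).const_mul _
    _ ≤ 2 * (ENNReal.ofReal ((C * h) ^ 2) + ENNReal.ofReal (h ^ 2) * ENNReal.ofReal (C ^ 2)) := by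
        gcongr
        exact hy.frequency h hh hlt
    _ = _ := by
        rw [← ENNReal.ofReal_mul (by positivity), ← ENNReal.ofReal_add (by positivity)
          (by positivity), ← ENNReal.ofReal_ofNat 2, ← ENNReal.ofReal_mul zero_le_two]
        congr 1
        ring

theorem IsLocalized.norm_sub_cutoff_le (hy : IsLocalized C h₀ a b y) (hh₀ : 0 < h₀) (hR : 0 < R)
    (hχ : IsBump χ p q R) (ha : a ∈ Icc (p + 3 * R) (q - 3 * R))
    (hz : z =ᵐ[volume] fun t => χ t * y t) : ‖y - z‖ ≤ C / (4 * R) := by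
  have hC := hy.nonneg
  have hmeas : MeasurableSet {t : ℝ | R ≤ |t - a|} :=
    measurableSet_le measurable_const (by fun_prop)
  refine le_of_sq_le_sq ?_ (by positivity)
  rw [← ENNReal.ofReal_le_ofReal_iff (by positivity), ← lintegral_enorm_sq_eq]
  refine le_trans ?_ (hy.setLIntegral_tail_le hh₀ hR)
  rw [← lintegral_indicator hmeas]
  refine lintegral_mono_ae ?_
  filter_upwards [Lp.coeFn_sub y z, hz] with t hsub ht
  rw [hsub, Pi.sub_apply, ht]
  by_cases hfar : t ∈ {t | R ≤ |t - a|}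
  · have hle : ‖1 - (χ t : ℂ)‖ ≤ 1 := by
      rw [← Complex.ofReal_one, ← Complex.ofReal_sub, Complex.norm_real, Real.norm_of_nonneg]
      exacts [sub_le_self _ (hχ.nonneg t), sub_nonneg.2 (hχ.le_one t)]
    rw [indicator_of_mem hfar, ← one_sub_mul, enorm_mul, mul_pow, ← ofReal_norm]
    exact mul_le_of_le_one_left' (pow_le_one₀ zero_le (ENNReal.ofReal_le_one.2 hle))
  · rw [mem_ofPred_eq, not_le, abs_lt] at hfar
    rw [hχ.eq_one t ⟨by linarith [ha.1], by linarith [ha.2]⟩]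
    simp

theorem IsLocalized.exists_norm_sub_le (hy : IsLocalized C h₀ a b y) (hh₀ : 0 < h₀) {P : ℝ}
    (hP : 0 < P) (hR : 1 ≤ R) (ha : a ∈ Icc (3 * R) (P - 3 * R)) (J : Finset ℤ)
    (hJ : ∀ n : ℤ, |b - n / P| < R → n ∈ J) :
    ∃ w ∈ Submodule.span ℂ (exponential P '' J), ‖y - w‖ ≤ C / R := by
  have hR0 : 0 < R := by linarith
  have hC := hy.nonneg
  obtain ⟨χ, hχ⟩ := exists_isBump 0 P hR0
  have hz := (hχ.memLp_mul hR0 y).coeFn_toLp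
  set z : OutputSignal := (hχ.memLp_mul hR0 y).toLp _
  have hcutoff : ‖y - z‖ ≤ C / (4 * R) :=
    hy.norm_sub_cutoff_le hh₀ hR0 hχ (by rwa [zero_add]) hz
  have hz0 : ∀ᵐ t, t ∉ Icc R (P - R) → z t = 0 := by
    filter_upwards [hz] with t ht h0
    rw [ht, hχ.eq_zero t (by rwa [zero_add]), Complex.ofReal_zero, zero_mul]
  have hmoved : ∀ h, 0 < h → h < h₀ →
      ∫⁻ t, ‖modChar b h * z (t - h) - z t‖ₑ ^ 2 ≤ ENNReal.ofReal ((2 * C * h) ^ 2) := by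
    intro h hh hlt
    refine (lintegral_congr_ae ?_).trans_le (hy.lintegral_cutoff_le hR hχ hh hlt)
    filter_upwards [hz, (measurePreserving_sub_right volume h).quasiMeasurePreserving.ae hz]
      with t ht ht'
    rw [ht, ht']
  have hproj : ‖z - ∑ n ∈ J, inner ℂ (exponential P n) z • exponential P n‖ ≤ C / (2 * R) := by
    refine le_of_sq_le_sq ?_ (by positivity)
    rw [show C / (2 * R) = 2 * C / (4 * R) by field_simp; norm_num]
    refine norm_sub_sum_inner_smul_sq_le (orthonormal_exponential hP)
      (hasSum_norm_inner_exponential_sq hP ?_) J fun F hFJ => ?_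
    · filter_upwards [hz0] with t ht h0
      exact ht fun hm => h0 ⟨by linarith [hm.1], by linarith [hm.2]⟩
    · refine sum_norm_inner_exponential_sq_le hP hR0 hh₀ hR0 hz0 hmoved F fun n hn => ?_
      by_contra! hlt
      exact Finset.disjoint_left.1 hFJ hn (hJ n hlt)
  refine ⟨∑ n ∈ J, inner ℂ (exponential P n) z • exponential P n, Submodule.sum_mem _ fun n hn =>
    Submodule.smul_mem _ _ (Submodule.subset_span ⟨n, hn, rfl⟩), ?_⟩
  calc _ ≤ C / (4 * R) + C / (2 * R) :=
        (norm_sub_le_norm_sub_add_norm_sub _ z _).trans (add_le_add hcutoff hproj)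
    _ = 3 / 4 * (C / R) := by field_simp; ring
    _ ≤ C / R := mul_le_of_le_one_left (by positivity) (by norm_num)

end Localized

/-! ### Counting dimensions -/

section Dimension

variable {𝕜 ι κ E H : Type*} [RCLike 𝕜] [Fintype ι] [Fintype κ] [NormedAddCommGroup E]
  [InnerProductSpace 𝕜 E] [NormedAddCommGroup H] [InnerProductSpace 𝕜 H]

-- Expand in an orthonormal basis of the range of `R` and move `R` to the other side of the inner
-- product: Bessel's inequality for `v` meets Parseval's identity for `b`.
theorem sum_norm_map_sq_le (R : E →ₗ[𝕜] H) (b : OrthonormalBasis ι 𝕜 E) {v : κ → E}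
    (hv : Orthonormal 𝕜 v) : ∑ l, ‖R (v l)‖ ^ 2 ≤ ∑ i, ‖R (b i)‖ ^ 2 := by
  have := b.toBasis.finiteDimensional_of_finite
  let f := stdOrthonormalBasis 𝕜 (LinearMap.range R)
  let adj : LinearMap.range R →ₗ[𝕜] E := R.rangeRestrict.adjoint
  have hexpand : ∀ x, ‖R x‖ ^ 2 = ∑ k, ‖inner 𝕜 x (adj (f k))‖ ^ 2 := fun x => by
    rw [show ‖R x‖ = ‖R.rangeRestrict x‖ from rfl, ← f.sum_sq_norm_inner_left]
    simp only [adj, LinearMap.adjoint_inner_right]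
  simp only [hexpand]
  rw [Finset.sum_comm, Finset.sum_comm (s := (Finset.univ : Finset ι))]
  refine Finset.sum_le_sum fun k _ => ?_
  rw [b.sum_sq_norm_inner_right]
  exact hv.sum_inner_products_le _

theorem card_le_finrank_add_finrank_ker (W : Submodule 𝕜 H) [FiniteDimensional 𝕜 W]
    (S : EuclideanSpace 𝕜 ι →ₗ[𝕜] H) (hS : LinearMap.range S ≤ W) :
    Fintype.card ι ≤ Module.finrank 𝕜 W + Module.finrank 𝕜 (LinearMap.ker S) := by
  rw [← finrank_euclideanSpace (𝕜 := 𝕜) (ι := ι), ← S.finrank_range_add_finrank_ker]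
  exact Nat.add_le_add_right (Submodule.finrank_mono hS) _

-- On the kernel of `c ↦ ∑ cᵢ wᵢ` the map `c ↦ ∑ cᵢ (yᵢ - wᵢ)`, whose Hilbert–Schmidt norm is small,
-- agrees with `c ↦ ∑ cᵢ yᵢ`, which is bounded below.
theorem card_sub_finrank_mul_le {y w : ι → H} (W : Submodule 𝕜 H) [FiniteDimensional 𝕜 W]
    (hw : ∀ i, w i ∈ W) {m ε : ℝ} (hm : 0 ≤ m)
    (hlower : ∀ c : ι → 𝕜, m * ∑ i, ‖c i‖ ^ 2 ≤ ‖∑ i, c i • y i‖ ^ 2)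
    (hε : ∀ i, ‖y i - w i‖ ^ 2 ≤ ε) :
    ((Fintype.card ι : ℝ) - Module.finrank 𝕜 W) * m ≤ Fintype.card ι * ε := by
  classical
  let comb (u : ι → H) : EuclideanSpace 𝕜 ι →ₗ[𝕜] H :=
    Fintype.linearCombination 𝕜 u ∘ₗ (WithLp.linearEquiv 2 𝕜 (ι → 𝕜)).toLinearMap
  have hcomb : ∀ u c, comb u c = ∑ i, c i • u i := fun _ _ => rfl
  let K := LinearMap.ker (comb w)
  let b := stdOrthonormalBasis 𝕜 K
  have hb : Orthonormal 𝕜 fun l => (b l : EuclideanSpace 𝕜 ι) :=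
    b.orthonormal.comp_linearIsometry K.subtypeₗᵢ
  have hdim : (Fintype.card ι : ℝ) ≤ Module.finrank 𝕜 W + Module.finrank 𝕜 K := by
    refine mod_cast card_le_finrank_add_finrank_ker W (comb w) ?_
    rintro _ ⟨c, rfl⟩
    exact Submodule.sum_mem _ fun i _ => Submodule.smul_mem _ _ (hw i)
  have hker : ∀ l, m ≤ ‖comb (fun i => y i - w i) (b l)‖ ^ 2 := fun l => by
    have hl : ∑ i, (b l : EuclideanSpace 𝕜 ι) i • w i = 0 := LinearMap.mem_ker.1 (b l).2
    rw [hcomb]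
    simp only [smul_sub, Finset.sum_sub_distrib, hl, sub_zero]
    refine le_trans (le_of_eq ?_) (hlower _)
    rw [← EuclideanSpace.norm_sq_eq, hb.1 l, one_pow, mul_one]
  have hbasis : ∀ i, ‖comb (fun i => y i - w i) (EuclideanSpace.basisFun ι 𝕜 i)‖ ^ 2 ≤ ε :=
    fun i => by
      rw [hcomb]
      simpa [Pi.single_apply] using hε i
  calc ((Fintype.card ι : ℝ) - Module.finrank 𝕜 W) * m ≤ Module.finrank 𝕜 K * m :=
        mul_le_mul_of_nonneg_right (by linarith) hm
    _ ≤ ∑ l, ‖comb (fun i => y i - w i) (b l)‖ ^ 2 := by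
        simpa using Finset.card_nsmul_le_sum Finset.univ _ m fun l _ => hker l
    _ ≤ ∑ i, ‖comb (fun i => y i - w i) (EuclideanSpace.basisFun ι 𝕜 i)‖ ^ 2 :=
        sum_norm_map_sq_le _ _ hb
    _ ≤ Fintype.card ι * ε := by
        simpa using Finset.sum_le_card_nsmul Finset.univ _ ε fun i _ => hbasis i

theorem mul_sum_norm_sq_le_norm_sum_sq [DecidableEq ι] {e s : ι → H} {V : ℝ}
    (hee : ∀ i j, inner 𝕜 (e i) (e j) = if i = j then (V : 𝕜) else 0)
    (hes : ∀ i j, inner 𝕜 (e i) (s j) = if i = j then (V : 𝕜) else 0) (c : ι → 𝕜) :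
    V * ∑ i, ‖c i‖ ^ 2 ≤ ‖∑ i, c i • s i‖ ^ 2 := by
  have hinner : ∀ u : ι → H, (∀ i j, inner 𝕜 (e i) (u j) = if i = j then (V : 𝕜) else 0) →
      inner 𝕜 (∑ i, c i • e i) (∑ i, c i • u i) = ((V * ∑ i, ‖c i‖ ^ 2 : ℝ) : 𝕜) := fun u hu => by
    simp only [sum_inner, inner_sum, inner_smul_left, inner_smul_right, hu, mul_ite, mul_zero,
      Finset.sum_ite_eq', Finset.mem_univ, if_true]
    push_cast
    rw [Finset.mul_sum]
    refine Finset.sum_congr rfl fun i _ => ?_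
    rw [mul_left_comm, ← mul_assoc, ← RCLike.mul_conj]
    ring
  have hnorm : ‖∑ i, c i • e i‖ ^ 2 = V * ∑ i, ‖c i‖ ^ 2 := by
    rw [← inner_self_eq_norm_sq (𝕜 := 𝕜), hinner e hee, RCLike.ofReal_re]
  have hcauchy : ‖∑ i, c i • e i‖ ^ 2 ≤ ‖∑ i, c i • e i‖ * ‖∑ i, c i • s i‖ := by
    have h := re_inner_le_norm (𝕜 := 𝕜) (∑ i, c i • e i) (∑ i, c i • s i)
    rwa [hinner s hes, RCLike.ofReal_re, ← hnorm] at h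
  rw [← hnorm]
  refine pow_le_pow_left₀ (norm_nonneg _) ?_ 2
  by_contra! hlt
  nlinarith [norm_nonneg (∑ i, c i • s i)]

end Dimension

/-! ### Characters on rectangles -/

theorem integral_modChar_mul_modChar {P : ℝ} (hP : 0 < P) (a : ℝ) (m n : ℤ) :
    ∫ t in Ico a (a + P), modChar (n / P) t * modChar (-(m / P)) t =
      if m = n then (P : ℂ) else 0 := by
  have hdiff : ∀ t, modChar (n / P) t * modChar (-(m / P)) t = modChar ((n - m : ℤ) / P) t :=
    fun t => by rw [← modChar_add_left, ← sub_eq_add_neg, ← sub_div, Int.cast_sub]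
  simp_rw [hdiff]
  rw [integral_modChar_period hP]
  exact if_congr (by omega) rfl rfl

/-- The rectangle `[a₁, a₁ + P₁) × [a₂, a₂ + P₂)`. -/
def rectangle (a₁ P₁ a₂ P₂ : ℝ) : Set (ℝ × ℝ) := Ico a₁ (a₁ + P₁) ×ˢ Ico a₂ (a₂ + P₂)

/-- The character of the plane with frequencies `(k.2 / P₁, -k.1 / P₂)`. On a rectangle of size
`P₁ × P₂` it is the exponential factor of the atom centred at time `k.1 / P₂` and frequency
`k.2 / P₁`. -/
def planeChar (P₁ P₂ : ℝ) (k : ℤ × ℤ) (p : ℝ × ℝ) : ℂ :=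
  modChar (k.2 / P₁) p.1 * modChar (-(k.1 / P₂)) p.2

section Rectangle

variable {a₁ P₁ a₂ P₂ : ℝ}

theorem measurableSet_rectangle (a₁ P₁ a₂ P₂ : ℝ) : MeasurableSet (rectangle a₁ P₁ a₂ P₂) :=
  measurableSet_Ico.prod measurableSet_Ico

theorem continuous_planeChar (P₁ P₂ : ℝ) (k : ℤ × ℤ) : Continuous (planeChar P₁ P₂ k) := by
  have hfst : Continuous fun p : ℝ × ℝ => modChar (k.2 / P₁) p.1 :=
    continuous_modChar.comp (by fun_prop : Continuous fun p : ℝ × ℝ => ((k.2 : ℝ) / P₁, p.1))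
  have hsnd : Continuous fun p : ℝ × ℝ => modChar (-(k.1 / P₂)) p.2 :=
    continuous_modChar.comp (by fun_prop : Continuous fun p : ℝ × ℝ => (-((k.1 : ℝ) / P₂), p.2))
  exact hfst.mul hsnd

theorem integral_planeChar (hP₁ : 0 < P₁) (hP₂ : 0 < P₂) (a₁ a₂ : ℝ) (k l : ℤ × ℤ) :
    ∫ p in rectangle a₁ P₁ a₂ P₂, planeChar P₁ P₂ l p * (starRingEnd ℂ) (planeChar P₁ P₂ k p) =
      if k = l then ((P₁ * P₂ : ℝ) : ℂ) else 0 := by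
  have hsplit : ∀ p : ℝ × ℝ, planeChar P₁ P₂ l p * (starRingEnd ℂ) (planeChar P₁ P₂ k p) =
      (modChar (l.2 / P₁) p.1 * modChar (-(k.2 / P₁)) p.1) *
        (modChar (k.1 / P₂) p.2 * modChar (-(l.1 / P₂)) p.2) := fun p => by
    rw [planeChar, planeChar, map_mul, conj_modChar, conj_modChar, neg_neg]
    ring
  simp_rw [hsplit]
  rw [rectangle, Measure.volume_eq_prod, setIntegral_prod_mul
    (fun t => modChar (l.2 / P₁) t * modChar (-(k.2 / P₁)) t)
    (fun t => modChar (k.1 / P₂) t * modChar (-(l.1 / P₂)) t),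
    integral_modChar_mul_modChar hP₁, integral_modChar_mul_modChar hP₂]
  simp only [Prod.ext_iff, eq_comm (a := l.1), Complex.ofReal_mul]
  by_cases hfst : k.1 = l.1 <;> by_cases hsnd : k.2 = l.2 <;> simp [hfst, hsnd]

theorem memLp_rectangleChar (a₁ P₁ a₂ P₂ : ℝ) (k : ℤ × ℤ) :
    MemLp ((rectangle a₁ P₁ a₂ P₂).indicator (planeChar P₁ P₂ k)) 2 := by
  have hfinite : volume (rectangle a₁ P₁ a₂ P₂) < ⊤ := by
    rw [rectangle, Measure.volume_eq_prod, Measure.prod_prod, Real.volume_Ico, Real.volume_Ico]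
    exact ENNReal.mul_lt_top ENNReal.ofReal_lt_top ENNReal.ofReal_lt_top
  have : Fact (volume (rectangle a₁ P₁ a₂ P₂) < ⊤) := ⟨hfinite⟩
  rw [memLp_indicator_iff_restrict (measurableSet_rectangle _ _ _ _)]
  exact MemLp.of_bound (continuous_planeChar _ _ _).aestronglyMeasurable 1
    (Filter.Eventually.of_forall fun p => (norm_modChar_mul_modChar _ _ _ _).le)

/-- The restriction of `planeChar P₁ P₂ k` to a rectangle, as an element of `L²(ℝ²)`. -/
def rectangleChar (a₁ P₁ a₂ P₂ : ℝ) (k : ℤ × ℤ) : SpreadingFunction :=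
  (memLp_rectangleChar a₁ P₁ a₂ P₂ k).toLp _

theorem inner_rectangleChar (k : ℤ × ℤ) (f : SpreadingFunction) :
    inner ℂ (rectangleChar a₁ P₁ a₂ P₂ k) f =
      ∫ p in rectangle a₁ P₁ a₂ P₂, f p * (starRingEnd ℂ) (planeChar P₁ P₂ k p) := by
  rw [L2.inner_def, ← integral_indicator (measurableSet_rectangle _ _ _ _)]
  refine integral_congr_ae ?_
  filter_upwards [(memLp_rectangleChar a₁ P₁ a₂ P₂ k).coeFn_toLp] with p hp
  rw [rectangleChar, hp, RCLike.inner_apply]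
  by_cases h : p ∈ rectangle a₁ P₁ a₂ P₂ <;> simp [h]

theorem inner_rectangleChar_of_ae_eq_planeChar (hP₁ : 0 < P₁) (hP₂ : 0 < P₂) {k l : ℤ × ℤ}
    {f : SpreadingFunction}
    (hf : ∀ᵐ p, p ∈ rectangle a₁ P₁ a₂ P₂ → f p = planeChar P₁ P₂ l p) :
    inner ℂ (rectangleChar a₁ P₁ a₂ P₂ k) f = if k = l then ((P₁ * P₂ : ℝ) : ℂ) else 0 := by
  rw [inner_rectangleChar, ← integral_planeChar hP₁ hP₂ a₁ a₂]
  refine setIntegral_congr_ae (measurableSet_rectangle _ _ _ _) ?_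
  filter_upwards [hf] with p hp hmem
  rw [hp hmem]

theorem inner_rectangleChar_of_ae_eq_zero {k : ℤ × ℤ} {f : SpreadingFunction}
    (hf : ∀ᵐ p, p ∈ rectangle a₁ P₁ a₂ P₂ → f p = 0) :
    inner ℂ (rectangleChar a₁ P₁ a₂ P₂ k) f = 0 := by
  rw [inner_rectangleChar]
  refine setIntegral_eq_zero_of_ae_eq_zero ?_
  filter_upwards [hf] with p hp hmem
  rw [hp hmem, zero_mul]

theorem mul_sum_norm_sq_le_of_rectangles {ι κ : Type*} [Fintype ι] [Fintype κ] (hP₁ : 0 < P₁)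
    (hP₂ : 0 < P₂) {a₁ a₂ : ι → ℝ} {k : κ → ℤ × ℤ} (hk : Function.Injective k)
    (hdisj : Pairwise fun i j =>
      Disjoint (rectangle (a₁ i) P₁ (a₂ i) P₂) (rectangle (a₁ j) P₁ (a₂ j) P₂))
    {s : ι × κ → SpreadingFunction}
    (hs : ∀ i m, ∀ᵐ p, p ∈ rectangle (a₁ i) P₁ (a₂ i) P₂ → s (i, m) p = planeChar P₁ P₂ (k m) p)
    (hs0 : ∀ i j m, i ≠ j → ∀ᵐ p, p ∈ rectangle (a₁ j) P₁ (a₂ j) P₂ → s (i, m) p = 0)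
    (c : ι × κ → ℂ) :
    P₁ * P₂ * ∑ i, ‖c i‖ ^ 2 ≤ ‖∑ i, c i • s i‖ ^ 2 := by
  classical
  let e (j : ι × κ) : SpreadingFunction := rectangleChar (a₁ j.1) P₁ (a₂ j.1) P₂ (k j.2)
  have hpair : ∀ f : ι × κ → SpreadingFunction,
      (∀ i m, ∀ᵐ p, p ∈ rectangle (a₁ i) P₁ (a₂ i) P₂ → f (i, m) p = planeChar P₁ P₂ (k m) p) →
      (∀ i j m, i ≠ j → ∀ᵐ p, p ∈ rectangle (a₁ j) P₁ (a₂ j) P₂ → f (i, m) p = 0) →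
      ∀ j l, inner ℂ (e j) (f l) = if j = l then ((P₁ * P₂ : ℝ) : ℂ) else 0 := by
    rintro f hf hf0 ⟨i, m⟩ ⟨i', m'⟩
    rcases eq_or_ne i' i with rfl | hne
    · rw [inner_rectangleChar_of_ae_eq_planeChar hP₁ hP₂ (hf i' m')]
      exact if_congr (by simp [hk.eq_iff]) rfl rfl
    · rw [inner_rectangleChar_of_ae_eq_zero (hf0 i' i m' hne), if_neg]
      exact fun heq => hne (congrArg Prod.fst heq).symm
  refine mul_sum_norm_sq_le_norm_sum_sq (hpair e (fun i m => ?_) fun i j m hij => ?_)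
    (hpair s hs hs0) c
  · filter_upwards [(memLp_rectangleChar (a₁ i) P₁ (a₂ i) P₂ (k m)).coeFn_toLp] with p hp hmem
    rw [show e (i, m) p = _ from hp, indicator_of_mem hmem]
  · filter_upwards [(memLp_rectangleChar (a₁ i) P₁ (a₂ i) P₂ (k m)).coeFn_toLp] with p hp hmem
    rw [show e (i, m) p = _ from hp, indicator_of_notMem (disjoint_right.1 (hdisj hij) hmem)]

end Rectangle

/-! ### Counting localized responses -/

/-- The span of the exponentials on `[0, P)` whose frequency lies in `[c, d]`. -/
def bandSpan (P c d : ℝ) : Submodule ℂ OutputSignal :=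
  Submodule.span ℂ (exponential P '' (Finset.Icc ⌈c * P⌉ ⌊d * P⌋ : Finset ℤ))

instance finiteDimensional_bandSpan (P c d : ℝ) : FiniteDimensional ℂ (bandSpan P c d) :=
  FiniteDimensional.span_of_finite ℂ ((Finset.finite_toSet _).image _)

theorem card_Icc_ceil_floor_le {a b : ℝ} (h : a ≤ b) :
    ((Finset.Icc ⌈a⌉ ⌊b⌋).card : ℝ) ≤ b - a + 1 := by
  have hmax : ((Finset.Icc ⌈a⌉ ⌊b⌋).card : ℝ) = max ((⌊b⌋ : ℝ) + 1 - ⌈a⌉) 0 := by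
    rw [Int.card_Icc]
    exact_mod_cast Int.toNat_eq_max (⌊b⌋ + 1 - ⌈a⌉)
  rw [hmax]
  exact max_le (by linarith [Int.floor_le b, Int.le_ceil a]) (by linarith)

theorem finrank_bandSpan_le {P c d : ℝ} (hP : 0 ≤ P) (hcd : c ≤ d) :
    (Module.finrank ℂ (bandSpan P c d) : ℝ) ≤ (d - c) * P + 1 := by
  classical
  have hcard : Module.finrank ℂ (bandSpan P c d) ≤ (Finset.Icc ⌈c * P⌉ ⌊d * P⌋).card := by
    rw [bandSpan, ← Finset.coe_image]
    exact (finrank_span_finset_le_card _).trans Finset.card_image_le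
  rw [sub_mul]
  exact (Nat.cast_le.2 hcard).trans
    (card_Icc_ceil_floor_le (mul_le_mul_of_nonneg_right hcd hP))

theorem IsLocalized.exists_mem_bandSpan_norm_sub_le {C h₀ a b c d P R : ℝ} {y : OutputSignal}
    (hy : IsLocalized C h₀ a b y) (hh₀ : 0 < h₀) (hP : 0 < P) (hR : 1 ≤ R)
    (ha : a ∈ Icc (3 * R) (P - 3 * R)) (hb : b ∈ Icc (c + R) (d - R)) :
    ∃ w ∈ bandSpan P c d, ‖y - w‖ ≤ C / R := by
  refine hy.exists_norm_sub_le hh₀ hP hR ha _ fun n hn => ?_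
  rw [abs_lt] at hn
  rw [Finset.mem_Icc, Int.ceil_le, Int.le_floor, ← le_div_iff₀ hP, ← div_le_iff₀ hP]
  constructor <;> linarith [hb.1, hb.2]

theorem card_mul_one_sub_le_of_isLocalized {ι : Type*} [Fintype ι] {y : ι → OutputSignal}
    {C h₀ a b : ι → ℝ} {c d P R m τ : ℝ} (hy : ∀ i, IsLocalized (C i) (h₀ i) (a i) (b i) (y i))
    (hh₀ : ∀ i, 0 < h₀ i) (hP : 0 < P) (hR : 1 ≤ R) (hcd : c ≤ d)
    (ha : ∀ i, a i ∈ Icc (3 * R) (P - 3 * R)) (hb : ∀ i, b i ∈ Icc (c + R) (d - R)) (hm : 0 < m)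
    (hlower : ∀ z : ι → ℂ, m * ∑ i, ‖z i‖ ^ 2 ≤ ‖∑ i, z i • y i‖ ^ 2)
    (hC : ∀ i, (C i / R) ^ 2 ≤ m * τ) :
    Fintype.card ι * (1 - τ) ≤ (d - c) * P + 1 := by
  choose w hw hyw using fun i =>
    (hy i).exists_mem_bandSpan_norm_sub_le (hh₀ i) hP hR (ha i) (hb i)
  have hcount := card_sub_finrank_mul_le (bandSpan P c d) hw hm.le hlower fun i =>
    (pow_le_pow_left₀ (norm_nonneg _) (hyw i) 2).trans (hC i)
  have hcount' : ((Fintype.card ι : ℝ) - Module.finrank ℂ (bandSpan P c d)) * m ≤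
      (Fintype.card ι * τ) * m := hcount.trans_eq (by ring)
  linarith [le_of_mul_le_mul_right hcount' hm, finrank_bandSpan_le hP.le hcd]

/-! ### Atoms on disjoint rectangles -/

theorem BoundedResponses.mul_norm_sum_smul_le {ι : Type*} [Fintype ι] {x : 𝓢'(ℝ, ℂ)} {α β : ℝ}
    {M : Set (ℝ × ℝ)} (hbd : BoundedResponses x α β (supportedOperators M))
    {s : ι → SpreadingFunction} {y : ι → OutputSignal} (hs : ∀ i, s i ∈ supportedOperators M)
    (hy : ∀ i, IsResponse (s i) x (y i)) (c : ι → ℂ) :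
    α * ‖∑ i, c i • s i‖ ≤ ‖∑ i, c i • y i‖ := by
  have hmem : ∑ i, c i • s i ∈ supportedSubmodule M :=
    Submodule.sum_mem _ fun i _ => Submodule.smul_mem _ (c i) (hs i)
  obtain ⟨z, hz, hαz, -⟩ := hbd _ hmem
  rwa [hz.unique (IsResponse.sum_smul Finset.univ c hy)] at hαz

/-- The `n × n` block of lattice points whose first coordinates start at `u₀`. Atoms are placed at
the times `(u₀ + u) / P₂` and frequencies `v / P₁`. -/
def gridPoint (u₀ n : ℕ) (j : Fin n × Fin n) : ℤ × ℤ := (((u₀ + j.1 : ℕ) : ℤ), ((j.2 : ℕ) : ℤ))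

theorem gridPoint_injective (u₀ n : ℕ) : Function.Injective (gridPoint u₀ n) := by
  intro j j' h
  simp only [gridPoint, Prod.mk.injEq, Nat.cast_inj, add_right_inj] at h
  exact Prod.ext (Fin.ext h.1) (Fin.ext h.2)

theorem gridPoint_fst_div_mem_Icc {P₂ r : ℝ} (hP₂ : 0 < P₂) {u₀ n : ℕ} (hu₀ : r * P₂ ≤ u₀)
    (j : Fin n × Fin n) : (gridPoint u₀ n j).1 / P₂ ∈ Icc r ((n + 2 * u₀) / P₂ - r) := by
  have hj : ((j.1 : ℕ) : ℝ) ≤ n := by exact_mod_cast j.1.2.le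
  rw [gridPoint, mem_Icc, le_div_iff₀ hP₂, div_le_iff₀ hP₂, sub_mul, div_mul_cancel₀ _ hP₂.ne']
  push_cast
  constructor <;> linarith

theorem gridPoint_snd_div_mem_Icc {P₁ : ℝ} (hP₁ : 0 < P₁) {u₀ n : ℕ} (j : Fin n × Fin n) :
    (gridPoint u₀ n j).2 / P₁ ∈ Icc 0 (n / P₁) := by
  have hj : ((j.2 : ℕ) : ℝ) ≤ n := by exact_mod_cast j.2.2.le
  rw [gridPoint, Int.cast_natCast]
  exact ⟨by positivity, by gcongr⟩

theorem le_of_forall_quadratic {m γ A B : ℝ} (hγ : 0 < γ) (hA : 0 ≤ A) (hB : 0 ≤ B)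
    (h : ∀ n : ℕ, 1 ≤ n → m * (n : ℝ) ^ 2 ≤ γ * ((n + A) * (n + B)) + 1) : m ≤ γ := by
  by_contra! hlt
  have hpos : 0 < m - γ := sub_pos.2 hlt
  set D := γ * (A + B) + γ * A * B + 1
  have hD0 : 0 < D := by positivity
  obtain ⟨n, hn⟩ := exists_nat_gt (D / (m - γ))
  have hn0 : (0 : ℝ) < n := (div_pos hD0 hpos).trans hn
  have hn1 : 1 ≤ n := by exact_mod_cast hn0
  have hn1' : (1 : ℝ) ≤ n := by exact_mod_cast hn1
  rw [div_lt_iff₀ hpos] at hn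
  have hlinear : (m - γ) * (n : ℝ) ^ 2 ≤ D * n := by
    have : 0 ≤ (γ * A * B + 1) * (n - 1) := mul_nonneg (by positivity) (by linarith)
    nlinarith [h n hn1]
  nlinarith

section DisjointRectangles

variable {ι : Type*} {M : Set (ℝ × ℝ)} {A₁ A₂ : ι → ℝ} {P₁ P₂ δ₁ δ₂ α β : ℝ}
  {ψ₁ ψ₂ : ι → ℝ → ℝ} {x : 𝓢'(ℝ, ℂ)}

theorem rectangle_margin_subset (hδ₁ : 0 ≤ δ₁) (hδ₂ : 0 ≤ δ₂) (a₁ a₂ : ℝ) :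
    rectangle (a₁ + 2 * δ₁) P₁ (a₂ + 2 * δ₂) P₂ ⊆
      rectangle a₁ (P₁ + 4 * δ₁) a₂ (P₂ + 4 * δ₂) :=
  prod_mono (Ico_subset_Ico (by linarith) (by linarith))
    (Ico_subset_Ico (by linarith) (by linarith))

theorem atom_eq_planeChar {φ₁ φ₂ : ℝ → ℝ} {a₁ a₂ : ℝ} (h₁ : IsBump φ₁ a₁ (a₁ + (P₁ + 4 * δ₁)) δ₁)
    (h₂ : IsBump φ₂ a₂ (a₂ + (P₂ + 4 * δ₂)) δ₂) (k : ℤ × ℤ) {p : ℝ × ℝ}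
    (hp : p ∈ rectangle (a₁ + 2 * δ₁) P₁ (a₂ + 2 * δ₂) P₂) :
    atom φ₁ φ₂ (k.1 / P₂) (k.2 / P₁) p = planeChar P₁ P₂ k p := by
  rw [rectangle, mem_prod, mem_Ico, mem_Ico] at hp
  rw [atom, h₁.eq_one _ ⟨hp.1.1, by linarith [hp.1.2]⟩, h₂.eq_one _ ⟨hp.2.1, by linarith [hp.2.2]⟩,
    planeChar, Complex.ofReal_one, one_mul, one_mul]

theorem mul_sum_norm_sq_le_of_atoms [Fintype ι] {κ : Type*} [Fintype κ] (hP₁ : 0 < P₁)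
    (hP₂ : 0 < P₂) (hδ₁ : 0 < δ₁) (hδ₂ : 0 < δ₂)
    (h₁ : ∀ i, IsBump (ψ₁ i) (A₁ i) (A₁ i + (P₁ + 4 * δ₁)) δ₁)
    (h₂ : ∀ i, IsBump (ψ₂ i) (A₂ i) (A₂ i + (P₂ + 4 * δ₂)) δ₂)
    (hdisj : Pairwise fun i j => Disjoint (rectangle (A₁ i) (P₁ + 4 * δ₁) (A₂ i) (P₂ + 4 * δ₂))
      (rectangle (A₁ j) (P₁ + 4 * δ₁) (A₂ j) (P₂ + 4 * δ₂)))
    {k : κ → ℤ × ℤ} (hk : Function.Injective k) {s : ι × κ → SpreadingFunction}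
    (hs : ∀ j, s j =ᵐ[volume] atom (ψ₁ j.1) (ψ₂ j.1) ((k j.2).1 / P₂) ((k j.2).2 / P₁))
    (c : ι × κ → ℂ) : P₁ * P₂ * ∑ j, ‖c j‖ ^ 2 ≤ ‖∑ j, c j • s j‖ ^ 2 := by
  have hmargin := fun i => rectangle_margin_subset (P₁ := P₁) (P₂ := P₂) hδ₁.le hδ₂.le (A₁ i) (A₂ i)
  refine mul_sum_norm_sq_le_of_rectangles hP₁ hP₂ hk
    (fun i j hij => (hdisj hij).mono (hmargin i) (hmargin j)) (fun i m => ?_)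
    (fun i j m hij => ?_) c
  · filter_upwards [hs (i, m)] with p hp hpi
    rw [hp, atom_eq_planeChar (h₁ i) (h₂ i) (k m) hpi]
  · filter_upwards [hs (i, m)] with p hp hpj
    rw [hp]
    exact atom_eq_zero_of_notMem_Ico (h₁ i) (h₂ i) hδ₁ hδ₂ _ _
      (Set.disjoint_right.1 (hdisj hij) (hmargin j hpj))

theorem BoundedResponses.exists_responses_of_atoms [Fintype ι] {κ : Type*} [Fintype κ]
    (hbd : BoundedResponses x α β (supportedOperators M)) (hα : 0 ≤ α)
    (hP₁ : 0 < P₁) (hP₂ : 0 < P₂) (hδ₁ : 0 < δ₁) (hδ₂ : 0 < δ₂)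
    (hM : ∀ i, rectangle (A₁ i) (P₁ + 4 * δ₁) (A₂ i) (P₂ + 4 * δ₂) ⊆ M)
    (hdisj : Pairwise fun i j => Disjoint (rectangle (A₁ i) (P₁ + 4 * δ₁) (A₂ i) (P₂ + 4 * δ₂))
      (rectangle (A₁ j) (P₁ + 4 * δ₁) (A₂ j) (P₂ + 4 * δ₂)))
    (h₁ : ∀ i, IsBump (ψ₁ i) (A₁ i) (A₁ i + (P₁ + 4 * δ₁)) δ₁)
    (h₂ : ∀ i, IsBump (ψ₂ i) (A₂ i) (A₂ i + (P₂ + 4 * δ₂)) δ₂)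
    {k : κ → ℤ × ℤ} (hk : Function.Injective k) :
    ∃ (s : ι × κ → SpreadingFunction) (y : ι × κ → OutputSignal),
      (∀ j, s j =ᵐ[volume] atom (ψ₁ j.1) (ψ₂ j.1) ((k j.2).1 / P₂) ((k j.2).2 / P₁)) ∧
      (∀ j, IsResponse (s j) x (y j)) ∧
      ∀ c : ι × κ → ℂ, α ^ 2 * (P₁ * P₂) * ∑ j, ‖c j‖ ^ 2 ≤ ‖∑ j, c j • y j‖ ^ 2 := by
  let s : ι × κ → SpreadingFunction := fun j =>
    (memLp_atom (h₁ j.1) (h₂ j.1) hδ₁ hδ₂ ((k j.2).1 / P₂) ((k j.2).2 / P₁)).toLp _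
  have hs : ∀ j, s j =ᵐ[volume] atom (ψ₁ j.1) (ψ₂ j.1) ((k j.2).1 / P₂) ((k j.2).2 / P₁) :=
    fun j => MemLp.coeFn_toLp _
  have hsupp : ∀ j, s j ∈ supportedOperators M := fun j => by
    rw [supportedOperators, mem_ofPred_eq]
    filter_upwards [hs j] with p hp hpM
    rw [hp]
    exact atom_eq_zero_of_notMem_Ico (h₁ _) (h₂ _) hδ₁ hδ₂ _ _ fun h => hpM (hM j.1 h)
  choose y hy _ _ using fun j => hbd (s j) (hsupp j)
  refine ⟨s, y, hs, hy, fun c => ?_⟩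
  calc
    α ^ 2 * (P₁ * P₂) * ∑ j, ‖c j‖ ^ 2 = α ^ 2 * (P₁ * P₂ * ∑ j, ‖c j‖ ^ 2) := mul_assoc _ _ _
    _ ≤ α ^ 2 * ‖∑ j, c j • s j‖ ^ 2 := mul_le_mul_of_nonneg_left
      (mul_sum_norm_sq_le_of_atoms hP₁ hP₂ hδ₁ hδ₂ h₁ h₂ hdisj hk hs c) (sq_nonneg α)
    _ = (α * ‖∑ j, c j • s j‖) ^ 2 := (mul_pow _ _ _).symm
    _ ≤ ‖∑ j, c j • y j‖ ^ 2 := pow_le_pow_left₀ (mul_nonneg hα (norm_nonneg _))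
      (hbd.mul_norm_sum_smul_le hsupp hy c) 2

-- Each rectangle carries `n ^ 2` atoms, while all the responses nearly live on a time interval of
-- length about `n / P₂` in a frequency band of width about `n / P₁`.
theorem BoundedResponses.card_mul_sq_le [Fintype ι]
    (hbd : BoundedResponses x α β (supportedOperators M)) (hα : 0 < α)
    (hP₁ : 0 < P₁) (hP₂ : 0 < P₂) (hδ₁ : 0 < δ₁) (hδ₂ : 0 < δ₂)
    (hM : ∀ i, rectangle (A₁ i) (P₁ + 4 * δ₁) (A₂ i) (P₂ + 4 * δ₂) ⊆ M)
    (hdisj : Pairwise fun i j => Disjoint (rectangle (A₁ i) (P₁ + 4 * δ₁) (A₂ i) (P₂ + 4 * δ₂))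
      (rectangle (A₁ j) (P₁ + 4 * δ₁) (A₂ j) (P₂ + 4 * δ₂)))
    (h₁ : ∀ i, IsBump (ψ₁ i) (A₁ i) (A₁ i + (P₁ + 4 * δ₁)) δ₁)
    (h₂ : ∀ i, IsBump (ψ₂ i) (A₂ i) (A₂ i + (P₂ + 4 * δ₂)) δ₂)
    {C h₀ : ι → ℝ} (hh₀ : ∀ i, 0 < h₀ i)
    (hloc : ∀ i (a b : ℝ) (s : SpreadingFunction) (y : OutputSignal),
      s =ᵐ[volume] atom (ψ₁ i) (ψ₂ i) a b → IsResponse s x y → IsLocalized (C i) (h₀ i) a b y)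
    {R τ : ℝ} (hR : 1 ≤ R) (hC : ∀ i, (C i / R) ^ 2 ≤ α ^ 2 * (P₁ * P₂) * τ) {u₀ n : ℕ}
    (hu₀ : 3 * R * P₂ ≤ u₀) (hn : 1 ≤ n) :
    Fintype.card ι * (1 - τ) * (n : ℝ) ^ 2 ≤
      1 / (P₁ * P₂) * ((n + 2 * R * P₁) * (n + 2 * u₀)) + 1 := by
  obtain ⟨s, y, hs, hy, hlower⟩ := hbd.exists_responses_of_atoms hα.le hP₁ hP₂ hδ₁ hδ₂ hM hdisj
    h₁ h₂ (gridPoint_injective u₀ n)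
  have hband : -R ≤ n / P₁ + R := by linarith [show 0 ≤ n / P₁ by positivity]
  have hcount : Fintype.card (ι × (Fin n × Fin n)) * (1 - τ) ≤
      (n / P₁ + R - -R) * ((n + 2 * u₀) / P₂) + 1 :=
    card_mul_one_sub_le_of_isLocalized
      (fun j => hloc j.1 _ _ (s j) (y j) (hs j) (hy j)) (fun j => hh₀ j.1) (by positivity) hR
      hband (fun j => gridPoint_fst_div_mem_Icc hP₂ hu₀ j.2)
      (fun j => by simpa using gridPoint_snd_div_mem_Icc hP₁ j.2) (by positivity) hlower
      fun j => hC j.1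
  have hcard : (Fintype.card (ι × (Fin n × Fin n)) : ℝ) = Fintype.card ι * (n : ℝ) ^ 2 := by
    rw [Fintype.card_prod, Fintype.card_prod, Fintype.card_fin, Nat.cast_mul, Nat.cast_mul, sq]
  calc
    _ = Fintype.card (ι × (Fin n × Fin n)) * (1 - τ) := by rw [hcard]; ring
    _ ≤ _ := hcount
    _ = _ := by field_simp; ring

theorem BoundedResponses.card_mul_le_one_of_margin [Fintype ι]
    (hbd : BoundedResponses x α β (supportedOperators M)) (hα : 0 < α) (hβ : 0 ≤ β)
    (hP₁ : 0 < P₁) (hP₂ : 0 < P₂) (hδ₁ : 0 < δ₁) (hδ₂ : 0 < δ₂)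
    (hM : ∀ i, rectangle (A₁ i) (P₁ + 4 * δ₁) (A₂ i) (P₂ + 4 * δ₂) ⊆ M)
    (hdisj : Pairwise fun i j => Disjoint (rectangle (A₁ i) (P₁ + 4 * δ₁) (A₂ i) (P₂ + 4 * δ₂))
      (rectangle (A₁ j) (P₁ + 4 * δ₁) (A₂ j) (P₂ + 4 * δ₂))) :
    Fintype.card ι * (P₁ * P₂) ≤ 1 := by
  choose ψ₁ h₁ using fun i => exists_isBump (A₁ i) (A₁ i + (P₁ + 4 * δ₁)) hδ₁
  choose ψ₂ h₂ using fun i => exists_isBump (A₂ i) (A₂ i + (P₂ + 4 * δ₂)) hδ₂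
  choose C h₀ hh₀ hloc using fun i => exists_isLocalized_of_atom hβ
    (fun s hs => hbd s (supportedOperators_mono (hM i) hs)) (h₁ i) (h₂ i) hδ₁ hδ₂
  have hτ : ∀ τ > 0, Fintype.card ι * (1 - τ) ≤ 1 / (P₁ * P₂) := fun τ hτ => by
    have hsmall : ∀ i, ∀ᶠ R in Filter.atTop, (C i / R) ^ 2 ≤ α ^ 2 * (P₁ * P₂) * τ := fun i => by
      have hlim := (Filter.Tendsto.const_div_atTop Filter.tendsto_id (C i)).pow 2
      rw [zero_pow two_ne_zero] at hlim
      exact hlim.eventually_le_const (by positivity)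
    obtain ⟨R, hR, hC⟩ :=
      ((Filter.eventually_ge_atTop 1).and (Filter.eventually_all.2 hsmall)).exists
    obtain ⟨u₀, hu₀⟩ := exists_nat_ge (3 * R * P₂)
    exact le_of_forall_quadratic (by positivity) (by positivity) (by positivity) fun n hn =>
      hbd.card_mul_sq_le hα hP₁ hP₂ hδ₁ hδ₂ hM hdisj h₁ h₂ hh₀ hloc hR hC hu₀ hn
  have hlim : Filter.Tendsto (fun τ : ℝ => Fintype.card ι * (1 - τ)) (nhdsWithin 0 (Ioi 0))
      (nhds (Fintype.card ι)) := by
    exact tendsto_nhdsWithin_of_tendsto_nhds (Continuous.tendsto' (by fun_prop) _ _ (by simp))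
  rw [← le_div_iff₀ (by positivity)]
  exact le_of_tendsto hlim (eventually_mem_nhdsWithin.mono hτ)

theorem BoundedResponses.card_mul_le_one [Fintype ι] {S₁ S₂ : ℝ}
    (hbd : BoundedResponses x α β (supportedOperators M)) (hα : 0 < α) (hβ : 0 ≤ β)
    (hS₁ : 0 < S₁) (hS₂ : 0 < S₂) (hM : ∀ i, rectangle (A₁ i) S₁ (A₂ i) S₂ ⊆ M)
    (hdisj : Pairwise fun i j =>
      Disjoint (rectangle (A₁ i) S₁ (A₂ i) S₂) (rectangle (A₁ j) S₁ (A₂ j) S₂)) :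
    Fintype.card ι * (S₁ * S₂) ≤ 1 := by
  have hmargin : ∀ ρ ∈ Ioo (0 : ℝ) (1 / 4),
      Fintype.card ι * (((1 - 4 * ρ) * S₁) * ((1 - 4 * ρ) * S₂)) ≤ 1 := fun ρ hρ => by
    have hρ0 : 0 < ρ := hρ.1
    have hρ1 : 0 < 1 - 4 * ρ := by linarith [hρ.2]
    have hside : ∀ S : ℝ, (1 - 4 * ρ) * S + 4 * (ρ * S) = S := fun S => by ring
    refine hbd.card_mul_le_one_of_margin (A₁ := A₁) (A₂ := A₂) (δ₁ := ρ * S₁) (δ₂ := ρ * S₂)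
      hα hβ (by positivity) (by positivity) (by positivity) (by positivity) ?_ ?_
    all_goals simpa only [hside]
  have hlim : Filter.Tendsto
      (fun ρ : ℝ => Fintype.card ι * (((1 - 4 * ρ) * S₁) * ((1 - 4 * ρ) * S₂)))
      (nhdsWithin 0 (Ioi 0)) (nhds (Fintype.card ι * (S₁ * S₂))) :=
    tendsto_nhdsWithin_of_tendsto_nhds (Continuous.tendsto' (by fun_prop) _ _ (by simp))
  exact le_of_tendsto hlim
    (Filter.mem_of_superset (Ioo_mem_nhdsGT (by norm_num)) hmargin)

end DisjointRectangles

theorem cell_eq_rectangle (T : ℝ) (L k m : ℕ) :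
    cell T L k m = rectangle (k * T) T (m * cellHeight T L) (cellHeight T L) := by
  rw [cell, rectangle, cellHeight, mul_one_div, ← add_div, add_one_mul]

theorem BoundedResponses.card_le {T : ℝ} (hT : 0 < T) {L : ℕ} (hL : 1 ≤ L) {α β : ℝ} (hα : 0 < α)
    (hβ : 0 ≤ β) {U : Finset (Fin L × Fin L)} {x : 𝓢'(ℝ, ℂ)}
    (hbd : BoundedResponses x α β (supportedOperators (region T L U))) : U.card ≤ L := by
  have hcount := hbd.card_mul_le_one (ι := U) (A₁ := fun i => (i.1.1 : ℕ) * T)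
    (A₂ := fun i => (i.1.2 : ℕ) * cellHeight T L) hα hβ hT (cellHeight_pos hT hL)
    (fun i p hp => mem_region.2 ⟨i.1, i.2, by rwa [cell_eq_rectangle]⟩)
    (fun i j hij => by
      simp only [← cell_eq_rectangle]
      exact disjoint_cell hT hL fun h => hij (Subtype.ext h))
  have hL0 : (0 : ℝ) < L := by exact_mod_cast hL
  have harea : T * cellHeight T L = 1 / L := by rw [cellHeight]; field_simp
  rw [harea, mul_one_div, div_le_one hL0, Fintype.card_coe] at hcount
  exact_mod_cast hcount

end OperatorIdentification

end

open OperatorIdentification in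
theorem theorem2 (T : ℝ) (hT : 0 < T) (L : ℕ) (hL : 1 ≤ L) (Δ : ℝ) :
    (2 ≤ L →
      (1 / 2 < Δ → ∃ Γ : Finset (Fin L × Fin L), 1 / 2 < area T L Γ ∧ area T L Γ ≤ Δ) →
      (StablyIdentifiable (blindOperators T L Δ) ↔ Δ ≤ 1 / 2)) ∧
    (Δ ≤ 1 / 2 → ∃ (c : ℤ → ℂ) (x : 𝓢'(ℝ, ℂ)), (∀ k : ℤ, c (k + L) = c k) ∧
      IsDiracTrain T c x ∧ StablyIdentifies x (blindOperators T L Δ)) := by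
  refine ⟨fun hL2 hΓ => ⟨?_, fun hΔ => ?_⟩, exists_diracTrain_stablyIdentifies hT hL⟩
  · rintro ⟨x, hx⟩
    by_contra! hΔ
    obtain ⟨Γ, hΓarea, hΓΔ⟩ := hΓ hΔ
    obtain ⟨α, β, U, hα, hβ, hU, hbd⟩ := hx.exists_boundedResponses_region hT hL2 hΓarea hΓΔ
    have hU_le : U.card ≤ L := hbd.card_le hT hL hα hβ.le
    omega
  · obtain ⟨c, x, -, -, hx⟩ := exists_diracTrain_stablyIdentifies hT hL hΔ
    exact ⟨x, hx⟩
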